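/- Let $M$ be a smooth manifold of dimension $n$, with slit tangent bundle $\mathcal TM=TM\setminus 0$, Liouville vector field $C=y^i\,\partial/\partial y^i$ and vertical endomorphism $J=dx^i\otimes\partial/\partial y^i$. Let $S$ be a spray over $M$: a smooth vector field on $\mathcal TM$ with $JS=C$ and $[C,S]=S$. Let $\Gamma=[J,S]$, i.e. $\Gamma X=[JX,S]-J[X,S]$, be the associated connection; a vector field $X$ on $\mathcal TM$ is horizontal if $\Gamma X=X$. The holonomy distribution $\mathcal H\subset T\mathcal TM$ of $S$ is the distribution generated by the horizontal vector fields and their successive Lie brackets. Suppose that $C_v\notin\mathcal H_v$ for every $v\in\mathcal TM$, and that the rank of $\mathcal H$ is locally constant on $\mathcal TM$. Let $\mathfrak h:T\mathcal TM\to\mathcal H$ be an arbitrary smooth projection onto $\mathcal H$, and put, for smooth functions $E$ and vector fields $X$ on $\mathcal TM$, $$P_cE=\mathcal L_CE-2E,\qquad (P_{\mathfrak h}E)(X)=(\mathfrak hX)(E).$$ Then $P_F^2=(P_c,P_{\mathfrak h}):C^\infty(\mathcal TM)\to C^\infty(\mathcal TM)\oplus \mathrm{Sec}(T^*\mathcal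 TM)$ is a linear differential operator of order $1$ which is formally integrable at every $v\in\mathcal TM$. That is, if $R_{1+l,v}$ denotes the kernel of $j_{1+l,v}(E)\mapsto j_{l,v}(P_F^2E)$, the space of formal solutions of order $1+l$ at $v$, then for all $l\ge 0$ the spaces $R_{1+l,v}$ form a smooth vector bundle near each point and the projection $R_{2+l,v}\to R_{1+l,v}$ is onto; in particular, every first-order formal solution lifts to a second-order one. Moreover the symbol of $P_F^2$ is involutive at every $v\in\mathcal TM$. That is, $T_v\mathcal TM$ has a basis $e_1,\dots,e_{2n}$ which is quasi-regular: $$\dim g_{2,v}=\dim g_{1,v}+\sum_{j=1}^{2n}\dim\{A\in g_{1,v} : i_{e_1}A=\dots=i_{e_j}A=0\},$$ where $g_{1,v}$ and $g_{2,v}$ are the kernels of the symbols at $v$ of $P_F^2$ and of its first prolongation. -/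

import Mathlib

open Set Filter Topology Bundle Manifold VectorField
open scoped ContDiff

noncomputable section

namespace SprayPDE

/-! ### Jets of sections, formal integrability and involutivity of the symbol

`N` is a smooth manifold (without boundary), `U ⊆ N` is an open subset, and `V`, `V₁`, `V₂` are
vector bundles over `N` with model fibres `F`, `F₁`, `F₂`.  The manifold on which everything takes
place is `U`; its sections are written as dependent functions on `N`, whose values outside `U`
play no role. -/

section Formal

variable {E : Type*} [NormedAddCommGroup E] [NormedSpace ℝ E]
  {H : Type*} [TopologicalSpace H] (I : ModelWithCorners ℝ E H)
  {N : Type*} [TopologicalSpace N] [ChartedSpace H N]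

section Bundle

variable (F : Type*) [NormedAddCommGroup F] [NormedSpace ℝ F]
  {V : N → Type*} [TopologicalSpace (TotalSpace F V)] [∀ x, TopologicalSpace (V x)]
  [FiberBundle F V]

/-- `s` is a smooth section of `V` over `U`. -/
def IsSmoothSectionOn (U : Set N) (s : ∀ x, V x) : Prop :=
  ContMDiffOn I (I.prod 𝓘(ℝ, F)) ∞ (fun x ↦ (TotalSpace.mk' F x (s x) : TotalSpace F V)) U

/-- The section `s`, read in the preferred chart of `N` and in the preferred trivialization of `V`
at the point `p`: an `F`-valued function of the coordinates. -/
def localRep (p : N) (s : ∀ x, V x) : E → F := fun z ↦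
  (trivializationAt F V p
    (TotalSpace.mk' F ((extChartAt I p).symm z) (s ((extChartAt I p).symm z)))).2

end Bundle

/-- Coordinate expressions of `m`-jets: a component of each order `j ≤ m`. -/
abbrev JetModel (E F : Type*) [NormedAddCommGroup E] [NormedSpace ℝ E]
    [NormedAddCommGroup F] [NormedSpace ℝ F] (m : ℕ) : Type _ :=
  ∀ j : Fin (m + 1), ContinuousMultilinearMap ℝ (fun _ : Fin (j : ℕ) ↦ E) F

/-- The projection from `(m+1)`-jets to `m`-jets, which forgets the derivatives of
order `m + 1`. -/
def truncateJet {E F : Type*} [NormedAddCommGroup E] [NormedSpace ℝ E]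
    [NormedAddCommGroup F] [NormedSpace ℝ F] (m : ℕ) (ξ : JetModel E F (m + 1)) :
    JetModel E F m := fun j ↦ ξ j.castSucc

section Bundle

variable (F : Type*) [NormedAddCommGroup F] [NormedSpace ℝ F]
  {V : N → Type*} [TopologicalSpace (TotalSpace F V)] [∀ x, TopologicalSpace (V x)]
  [FiberBundle F V]

/-- The `m`-jet at `x` of the section `s`, in the coordinates belonging to the preferred chart and
trivialization at `p`: the derivatives of order `≤ m` at `x`.  It is meant for points `x` of the
domains of this chart and this trivialization. -/
def jetIn (p : N) (m : ℕ) (s : ∀ x, V x) (x : N) : JetModel E F m :=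
  fun j ↦ iteratedFDeriv ℝ (j : ℕ) (localRep I F p s) (extChartAt I p x)

end Bundle

variable (F₁ : Type*) [NormedAddCommGroup F₁] [NormedSpace ℝ F₁]
  {V₁ : N → Type*} [TopologicalSpace (TotalSpace F₁ V₁)] [∀ x, TopologicalSpace (V₁ x)]
  [∀ x, AddCommGroup (V₁ x)] [∀ x, Module ℝ (V₁ x)] [FiberBundle F₁ V₁]
  (F₂ : Type*) [NormedAddCommGroup F₂] [NormedSpace ℝ F₂]
  {V₂ : N → Type*} [TopologicalSpace (TotalSpace F₂ V₂)] [∀ x, TopologicalSpace (V₂ x)]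
  [∀ x, AddCommGroup (V₂ x)] [∀ x, Module ℝ (V₂ x)] [FiberBundle F₂ V₂]

/-- `P` is a linear differential operator of order (at most) `k` over `U`: a linear map from the
smooth sections of `V₁` to those of `V₂` such that the value of `P s` at `x` depends only on the
`k`-jet of `s` at `x`. -/
structure IsLinearDiffOpOn (U : Set N) (k : ℕ) (P : (∀ x, V₁ x) → ∀ x, V₂ x) : Prop where
  smooth : ∀ s, IsSmoothSectionOn I F₁ U s → IsSmoothSectionOn I F₂ U (P s)
  add : ∀ s t, IsSmoothSectionOn I F₁ U s → IsSmoothSectionOn I F₁ U t →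
    ∀ x ∈ U, P (s + t) x = P s x + P t x
  smul : ∀ (c : ℝ) (s), IsSmoothSectionOn I F₁ U s → ∀ x ∈ U, P (c • s) x = c • P s x
  order : ∀ s, IsSmoothSectionOn I F₁ U s → ∀ x ∈ U, jetIn I F₁ x k s x = 0 → P s x = 0

/-- The space `R_{k+l,x}(P)` of formal solutions of order `k + l` at `x` of an operator `P` of
order `k`, in the coordinates at `p`.  It is the kernel of `j_{k+l,x}(s) ↦ j_{l,x}(P s)`, that is,
the set of the jets `j_{k+l,x}(s)` with `j_{l,x}(P s) = 0`. -/
def formalSolutions (U : Set N) (k : ℕ) (P : (∀ x, V₁ x) → ∀ x, V₂ x) (l : ℕ) (p x : N) :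
    Set (JetModel E F₁ (k + l)) :=
  {ξ | ∃ s, IsSmoothSectionOn I F₁ U s ∧ jetIn I F₁ p (k + l) s x = ξ ∧
    jetIn I F₂ p l (P s) x = 0}

/-- `R_{k+l}(P)` is a vector bundle near `p`: over an open neighbourhood `W` of `p` it has a smooth
frame, that is, there are smooth sections of the bundle of `(k+l)`-jets over `W` whose values
at each `x ∈ W` form a basis of `R_{k+l,x}(P)`. -/
def IsVectorBundleNear (U : Set N) (k : ℕ) (P : (∀ x, V₁ x) → ∀ x, V₂ x) (l : ℕ) (p : N) : Prop :=
  ∃ W : Set N, IsOpen W ∧ p ∈ W ∧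
    W ⊆ U ∩ (chartAt H p).source ∩ (trivializationAt F₁ V₁ p).baseSet ∩
      (trivializationAt F₂ V₂ p).baseSet ∧
    ∃ (r : ℕ) (σ : Fin r → N → JetModel E F₁ (k + l)),
      (∀ i, ContMDiffOn I 𝓘(ℝ, JetModel E F₁ (k + l)) ∞ (σ i) W) ∧
      ∀ x ∈ W, LinearIndependent ℝ (fun i ↦ σ i x) ∧
        (Submodule.span ℝ (range fun i ↦ σ i x) : Set (JetModel E F₁ (k + l))) =
          formalSolutions I F₁ F₂ U k P l p x

/-- The operator `P` of order `k` is formally integrable at `p`: all `R_{k+l}(P)`, `l ≥ 0`, are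
vector bundles near `p`, and all projections `R_{k+l+1,p}(P) → R_{k+l,p}(P)`, `l ≥ 0`, are onto. -/
def FormallyIntegrableAt (U : Set N) (k : ℕ) (P : (∀ x, V₁ x) → ∀ x, V₂ x) (p : N) : Prop :=
  (∀ l, IsVectorBundleNear I F₁ F₂ U k P l p) ∧
  ∀ l, SurjOn (truncateJet (k + l)) (formalSolutions I F₁ F₂ U k P (l + 1) p p)
    (formalSolutions I F₁ F₂ U k P l p p)

/-- The kernel `g_{k+l,x}(P)` of the symbol `S^{k+l}T*N ⊗ V₁ → S^lT*N ⊗ V₂` of the `l`-th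
prolongation of an operator `P` of order `k` at `x`.  Elements of `S^{k+l}T*N ⊗ V₁` are the leading
derivatives of sections `s` whose `(k+l-1)`-jet vanishes at `x`; the symbol maps such an element to
the derivative of order `l` of `P s` at `x`. -/
def symbolKernel (U : Set N) (k : ℕ) (P : (∀ x, V₁ x) → ∀ x, V₂ x) (l : ℕ) (x : N) :
    Set (ContinuousMultilinearMap ℝ (fun _ : Fin (k + l) ↦ E) F₁) :=
  {A | ∃ s, IsSmoothSectionOn I F₁ U s ∧
    (∀ j < k + l, iteratedFDeriv ℝ j (localRep I F₁ x s) (extChartAt I x x) = 0) ∧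
    iteratedFDeriv ℝ (k + l) (localRep I F₁ x s) (extChartAt I x x) = A ∧
    iteratedFDeriv ℝ l (localRep I F₂ x (P s)) (extChartAt I x x) = 0}

/-- The subspace of those `A ∈ g_{k,x}(P)` with `i_{e_1} A = ⋯ = i_{e_j} A = 0` (as `A` is
symmetric, it does not matter into which argument a vector is inserted). -/
def symbolKernelAnnihilating (U : Set N) (k : ℕ) (P : (∀ x, V₁ x) → ∀ x, V₂ x) (x : N) {d : ℕ}
    (e : Fin d → TangentSpace I x) (j : ℕ) :
    Set (ContinuousMultilinearMap ℝ (fun _ : Fin (k + 0) ↦ E) F₁) :=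
  {A | A ∈ symbolKernel I F₁ F₂ U k P 0 x ∧
    ∀ i : Fin d, (i : ℕ) < j → ∀ v : Fin (k + 0) → E, (∃ a, v a = e i) → A v = 0}

/-- The symbol of the operator `P` of order `k` is involutive at `x`: there is a quasi-regular
basis of `T_xN`. -/
def SymbolInvolutiveAt (U : Set N) (k : ℕ) (P : (∀ x, V₁ x) → ∀ x, V₂ x) (x : N) : Prop :=
  ∃ e : Module.Basis (Fin (Module.finrank ℝ E)) ℝ (TangentSpace I x),
    Set.finrank ℝ (symbolKernel I F₁ F₂ U k P 1 x) =
      Set.finrank ℝ (symbolKernel I F₁ F₂ U k P 0 x) +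
        ∑ j ∈ Finset.Icc 1 (Module.finrank ℝ E),
          Set.finrank ℝ (symbolKernelAnnihilating I F₁ F₂ U k P x e j)

end Formal

/-! ### Sprays and the holonomy distribution -/

section Spray

variable {E : Type*} [NormedAddCommGroup E] [NormedSpace ℝ E]
  {M : Type*} [TopologicalSpace M] [ChartedSpace E M] [IsManifold 𝓘(ℝ, E) ∞ M]

variable (E M) in
/-- The tangent bundle `TM`. -/
abbrev TM : Type _ := TangentBundle 𝓘(ℝ, E) M

variable (E) in
/-- The model with corners of the manifold `TM`. -/
abbrev IT : ModelWithCorners ℝ (E × E) (ModelProd E E) := 𝓘(ℝ, E).tangent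

variable (E M) in
/-- The slit tangent bundle. -/
def slit : Set (TM E M) := {v | v.2 ≠ 0}

variable (E M) in
/-- (Not necessarily smooth) vector fields on `TM`. -/
abbrev VF : Type _ := ∀ v : TM E M, TangentSpace (IT E) v

/-- The vertical lift of `w` at `v`: the velocity at `t = 0` of the curve `v + t w` in a fibre
of `TM`. -/
def verticalLift (v : TM E M) (w : TangentSpace 𝓘(ℝ, E) v.1) : TangentSpace (IT E) v :=
  mfderiv 𝓘(ℝ, ℝ) (IT E) (fun t : ℝ ↦ (⟨v.1, v.2 + t • w⟩ : TM E M)) 0 (1 : ℝ)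

/-- The canonical vertical vector field `C`. -/
def liouville : VF E M := fun v ↦ verticalLift v v.2

/-- The canonical vertical endomorphism `J`: the vertical lift of the projection to `TM`. -/
def vertEndo (v : TM E M) (ξ : TangentSpace (IT E) v) : TangentSpace (IT E) v :=
  verticalLift v
    (mfderiv (IT E) 𝓘(ℝ, E) (TotalSpace.proj : TM E M → M) v ξ : TangentSpace 𝓘(ℝ, E) v.1)

/-- `X` is smooth on the slit tangent bundle. -/
def IsSmoothVF (X : VF E M) : Prop :=
  IsSmoothSectionOn (IT E) (E × E) (slit E M) X

/-- A spray: a smooth vector field `S` on the slit tangent bundle with `JS = C` and `[C, S] = S`. -/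
structure IsSpray (S : VF E M) : Prop where
  smooth : IsSmoothVF S
  vert : ∀ v ∈ slit E M, vertEndo v (S v) = liouville v
  homog : ∀ v ∈ slit E M, mlieBracket (IT E) liouville S v = S v

/-- The connection `Γ = [J, S]`, applied to a vector field: `Γ X = [JX, S] - J[X, S]`. -/
def connection (S X : VF E M) : VF E M := fun v ↦
  mlieBracket (IT E) (fun u ↦ vertEndo u (X u)) S v - vertEndo v (mlieBracket (IT E) X S v)

/-- Horizontal vector fields on the slit tangent bundle: `ΓX = X`. -/
def IsHorizontal (S X : VF E M) : Prop :=
  IsSmoothVF X ∧ ∀ v ∈ slit E M, connection S X v = X v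

/-- The horizontal vector fields and their successive Lie brackets. -/
inductive IsHolonomyField (S : VF E M) : VF E M → Prop
  | horizontal (X : VF E M) : IsHorizontal S X → IsHolonomyField S X
  | bracket (X Y : VF E M) : IsHolonomyField S X → IsHolonomyField S Y →
      IsHolonomyField S (mlieBracket (IT E) X Y)

/-- The holonomy distribution `ℋ` of a spray. -/
def holonomy (S : VF E M) (v : TM E M) : Submodule ℝ (TangentSpace (IT E) v) :=
  Submodule.span ℝ {ξ | ∃ X, IsHolonomyField S X ∧ X v = ξ}

/-- `𝔥` is a smooth projection of the tangent bundle of the slit tangent bundle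
onto the distribution `ℋ`. -/
structure IsSmoothProjection
    (𝔥 : ∀ v : TM E M, TangentSpace (IT E) v →L[ℝ] TangentSpace (IT E) v)
    (ℋ : ∀ v : TM E M, Submodule ℝ (TangentSpace (IT E) v)) : Prop where
  smooth : ∀ X : VF E M, IsSmoothVF X → IsSmoothVF fun v ↦ 𝔥 v (X v)
  proj : ∀ v ∈ slit E M, LinearMap.IsProj (ℋ v) (𝔥 v : TangentSpace (IT E) v →ₗ[ℝ] _)

variable (E M) in
/-- The fibres of the trivial line bundle over `TM`. -/
abbrev LineFib : TM E M → Type := Bundle.Trivial (TM E M) ℝ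

variable (E M) in
/-- The fibres of the cotangent bundle of `TM`. -/
abbrev CotFib : TM E M → Type _ := fun v ↦ TangentSpace (IT E) v →L[ℝ] LineFib E M v

variable (E M) in
/-- The fibres of the direct sum of the trivial line bundle and the cotangent bundle of `TM`. -/
abbrev SumFib : TM E M → Type _ := fun v ↦ LineFib E M v × CotFib E M v

/-- The differential `df` of a function on `TM`. -/
def differential (f : TM E M → ℝ) (v : TM E M) : TangentSpace (IT E) v →L[ℝ] ℝ :=
  mfderiv (IT E) 𝓘(ℝ, ℝ) f v

/-- The operator `(P_c, P_𝔥)`, where `P_c f = ℒ_C f - 2 f` and `P_𝔥 f (X) = 𝔥X(f)`. -/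
def sprayOperator (𝔥 : ∀ v : TM E M, TangentSpace (IT E) v →L[ℝ] TangentSpace (IT E) v)
    (f : ∀ v, LineFib E M v) : ∀ v, SumFib E M v := fun v ↦
  (differential (fun u ↦ f u) v (liouville v) - (2 * f v : ℝ),
    (differential (fun u ↦ f u) v).comp (𝔥 v))

end Spray

end SprayPDE

end

/-! The equations say `C f = 2 f` and `X f = 0` for every `X` in the holonomy distribution. Near a
point of the slit bundle, take a frame `X i` of the holonomy distribution consisting of iterated
brackets of horizontal fields, and adjoin `C`. The fields are independent because `C` is not in the
distribution. Every bracket of two of them lies in the holonomy distribution again: for the `X i` by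
definition, and for `[C, X i]` because `[C, J] = -J` and `[C, S] = S` make `Γ` commute with the
bracket by `C` (`IsHorizontal.mlieBracket_liouville`, `IsHolonomyField.mlieBracket_liouville`). So
no bracket has a component along `C`, the only field with a nonzero zeroth order term, and the
system has no hidden compatibility condition.

Encode `f ↦ df(X) - w f` as the vector field `(X, w)` on a space with one extra coordinate. The
fields become an involutive frame there. Changing the frame so that a linear map `t` sends it to
constant basis vectors makes it commute (`lieBracket_eq_zero_of_frame`, `exists_commutingSystem`),
and gives commuting operators `D a f = df(Y a) - l a f`. The original operator and the `D a` are
smooth linear combinations of each other, so they vanish to the same orders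
(`exists_commutingSystem_sprayOperator`).

For a commuting system, truncated exponentials `∑ (-τ)^k / k! D^k` solve all equations modulo powers
of the `τ a`, with arbitrary data transversal to the frame (`exists_formal_solution`), while a
formal solution is determined by its jet along `ker t`
(`CommutingSystem.vanishesToOrder_of_restriction`). Thus formal solutions of order `m` correspond
exactly to `m`-jets along `ker t`. This gives the lifting property at once, and carrying the base
point as a parameter gives smooth frames (`CommutingSystem.exists_parametric_solution`).

The symbol kernels consist of the symmetric forms annihilated by the `Y a`. A basis which ends with
the `Y a` is quasi-regular by counting binomial coefficients (`exists_quasiRegular_basis`). -/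

namespace SprayPDE

/-! ### Functions vanishing to a given order -/

section Calculus

variable {G : Type*} [NormedAddCommGroup G] [NormedSpace ℝ G]
  {Q : Type*} [NormedAddCommGroup Q] [NormedSpace ℝ Q]
  {F : Type*} [NormedAddCommGroup F] [NormedSpace ℝ F]
  {F' : Type*} [NormedAddCommGroup F'] [NormedSpace ℝ F']
  {F'' : Type*} [NormedAddCommGroup F''] [NormedSpace ℝ F'']

/-- All derivatives of `f` of order less than `k` vanish at `x`. -/
def VanishesToOrder (k : ℕ) (f : G → F) (x : G) : Prop :=
  ∀ j < k, iteratedFDeriv ℝ j f x = 0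

theorem VanishesToOrder.mono {k k' : ℕ} {f : G → F} {x : G} (h : VanishesToOrder k f x)
    (hk : k' ≤ k) : VanishesToOrder k' f x := fun j hj ↦ h j (hj.trans_le hk)

theorem vanishesToOrder_zero (f : G → F) (x : G) : VanishesToOrder 0 f x :=
  fun _ hj ↦ absurd hj (Nat.not_lt_zero _)

theorem vanishesToOrder_one {f : G → F} {x : G} : VanishesToOrder 1 f x ↔ f x = 0 := by
  refine ⟨fun h ↦ ?_, fun h j hj ↦ ?_⟩
  · have := congrArg (fun A ↦ A (fun _ ↦ 0)) (h 0 one_pos)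
    simpa using this
  · obtain rfl : j = 0 := by omega
    ext v
    simpa using h

theorem VanishesToOrder.congr {k : ℕ} {f g : G → F} {x : G} (h : VanishesToOrder k f x)
    (hfg : g =ᶠ[𝓝 x] f) : VanishesToOrder k g x := fun j hj ↦ by
  rw [(hfg.iteratedFDeriv ℝ j).eq_of_nhds, h j hj]

theorem vanishesToOrder_zero_fun (k : ℕ) (x : G) : VanishesToOrder k (fun _ : G ↦ (0 : F)) x :=
  fun j _ ↦ by simp

theorem VanishesToOrder.fderiv {k : ℕ} {f : G → F} {x : G} (h : VanishesToOrder (k + 1) f x) :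
    VanishesToOrder k (fderiv ℝ f) x := fun j hj ↦ by
  have := h (j + 1) (by omega)
  rw [iteratedFDeriv_succ_eq_comp_right] at this
  exact (LinearIsometryEquiv.map_eq_zero_iff _).1 this

/-- The map `L` serves as a projection onto a transversal, as the inclusion of a slice of a product,
and as a scaling. -/
theorem iteratedFDeriv_comp_affine {f : Q → F} {Ω : Set Q} (hΩ : IsOpen Ω)
    (hf : ContDiffOn ℝ ∞ f Ω) (L : G →L[ℝ] Q) (c : Q) (y : G) (hy : c + L y ∈ Ω) (j : ℕ) :
    iteratedFDeriv ℝ j (fun y ↦ f (c + L y)) y =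
      (iteratedFDeriv ℝ j f (c + L y)).compContinuousLinearMap (fun _ ↦ L) := by
  have hΩ' : IsOpen ((fun q ↦ c + q) ⁻¹' Ω) := hΩ.preimage (by fun_prop)
  have hf' : ContDiffOn ℝ ∞ (fun q ↦ f (c + q)) ((fun q ↦ c + q) ⁻¹' Ω) :=
    hf.comp (by fun_prop) (fun _ h ↦ h)
  have h := L.iteratedFDerivWithin_comp_right (i := j) hf' hΩ'.uniqueDiffOn
    (hΩ'.preimage L.continuous).uniqueDiffOn (x := y) hy (by exact_mod_cast le_top)
  rw [iteratedFDerivWithin_of_isOpen j (hΩ'.preimage L.continuous) hy,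
    iteratedFDerivWithin_of_isOpen j hΩ' hy] at h
  rw [← iteratedFDeriv_comp_add_left (𝕜 := ℝ) (f := f) j c (L y), ← h]
  rfl

/-- In the Leibniz bound for the derivative of order `j < a + b`, each summand has `i < a` or `j - i
< b`, so one of its factors is zero. -/
theorem VanishesToOrder.bilinear {a b : ℕ} {f : G → F} {g : G → F'} {x : G} {Ω : Set G}
    (B : F →L[ℝ] F' →L[ℝ] F'') (hΩ : IsOpen Ω) (hx : x ∈ Ω)
    (hf : ContDiffOn ℝ ∞ f Ω) (hg : ContDiffOn ℝ ∞ g Ω) (hfx : VanishesToOrder a f x)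
    (hgx : VanishesToOrder b g x) : VanishesToOrder (a + b) (fun z ↦ B (f z) (g z)) x := by
  intro j hj
  have h := B.norm_iteratedFDerivWithin_le_of_bilinear hf hg hΩ.uniqueDiffOn hx (n := j)
    (by exact_mod_cast le_top)
  rw [iteratedFDerivWithin_of_isOpen j hΩ hx] at h
  rw [← norm_le_zero_iff]
  refine h.trans_eq ?_
  rw [Finset.sum_eq_zero, mul_zero]
  intro i hi
  rw [iteratedFDerivWithin_of_isOpen i hΩ hx, iteratedFDerivWithin_of_isOpen (j - i) hΩ hx]
  rcases lt_or_ge i a with hia | hia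
  · simp [hfx i hia]
  · simp [hgx (j - i) (by have := Finset.mem_range.1 hi; omega)]

theorem VanishesToOrder.clm_apply {k : ℕ} {f : G → F →L[ℝ] F'} {g : G → F} {x : G} {Ω : Set G}
    (hΩ : IsOpen Ω) (hx : x ∈ Ω) (hf : ContDiffOn ℝ ∞ f Ω) (hg : ContDiffOn ℝ ∞ g Ω)
    (hgx : VanishesToOrder k g x) : VanishesToOrder k (fun z ↦ f z (g z)) x := by
  simpa using VanishesToOrder.bilinear (a := 0) (b := k) (ContinuousLinearMap.id ℝ (F →L[ℝ] F'))
    hΩ hx hf hg (vanishesToOrder_zero _ _) hgx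

theorem VanishesToOrder.smul {a b : ℕ} {f : G → ℝ} {g : G → F} {x : G} {Ω : Set G}
    (hΩ : IsOpen Ω) (hx : x ∈ Ω) (hf : ContDiffOn ℝ ∞ f Ω) (hg : ContDiffOn ℝ ∞ g Ω)
    (hfx : VanishesToOrder a f x) (hgx : VanishesToOrder b g x) :
    VanishesToOrder (a + b) (fun z ↦ f z • g z) x :=
  VanishesToOrder.bilinear (ContinuousLinearMap.lsmul ℝ ℝ) hΩ hx hf hg hfx hgx

theorem VanishesToOrder.smul_left {k : ℕ} {f : G → ℝ} {g : G → F} {x : G} {Ω : Set G}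
    (hΩ : IsOpen Ω) (hx : x ∈ Ω) (hf : ContDiffOn ℝ ∞ f Ω) (hg : ContDiffOn ℝ ∞ g Ω)
    (hfx : VanishesToOrder k f x) :
    VanishesToOrder k (fun z ↦ f z • g z) x := by
  simpa using hfx.smul hΩ hx hf hg (vanishesToOrder_zero _ _)

theorem VanishesToOrder.pow_mul {k : ℕ} {u h : G → ℝ} {x : G} {Ω : Set G}
    (hΩ : IsOpen Ω) (hx : x ∈ Ω) (hu : ContDiffOn ℝ ∞ u Ω) (hh : ContDiffOn ℝ ∞ h Ω)
    (hux : u x = 0) : VanishesToOrder k (fun z ↦ u z ^ k * h z) x := by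
  induction k with
  | zero => exact vanishesToOrder_zero _ _
  | succ k ih =>
    have := (vanishesToOrder_one.2 hux).smul hΩ hx hu ((hu.pow k).mul hh) ih
    refine (this.mono (by omega)).congr (Eventually.of_forall fun z ↦ ?_)
    simp only [smul_eq_mul]
    ring

theorem iteratedFDeriv_sum_of_contDiffOn {ι : Type*} {s : Finset ι} {f : ι → G → F} {x : G}
    {Ω : Set G} (hΩ : IsOpen Ω) (hx : x ∈ Ω) (hf : ∀ i ∈ s, ContDiffOn ℝ ∞ (f i) Ω) (j : ℕ) :
    iteratedFDeriv ℝ j (fun z ↦ ∑ i ∈ s, f i z) x = ∑ i ∈ s, iteratedFDeriv ℝ j (f i) x := by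
  classical
  induction s using Finset.induction_on with
  | empty => simp
  | insert a s ha ih =>
    have h1 : ContDiffAt ℝ j (f a) x :=
      ((hf a (by simp)).contDiffAt (hΩ.mem_nhds hx)).of_le (by exact_mod_cast le_top)
    have h2 : ContDiffAt ℝ j (fun z ↦ ∑ i ∈ s, f i z) x :=
      ((ContDiffOn.sum fun i hi ↦ hf i (by simp [hi])).contDiffAt
        (hΩ.mem_nhds hx)).of_le (by exact_mod_cast le_top)
    simp only [Finset.sum_insert ha]
    rw [← ih fun i hi ↦ hf i (by simp [hi])]
    exact iteratedFDeriv_add_apply h1 h2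

theorem VanishesToOrder.sum {ι : Type*} {s : Finset ι} {k : ℕ} {f : ι → G → F} {x : G}
    {Ω : Set G} (hΩ : IsOpen Ω) (hx : x ∈ Ω) (hf : ∀ i ∈ s, ContDiffOn ℝ ∞ (f i) Ω)
    (h : ∀ i ∈ s, VanishesToOrder k (f i) x) :
    VanishesToOrder k (fun z ↦ ∑ i ∈ s, f i z) x := fun j hj ↦ by
  rw [iteratedFDeriv_sum_of_contDiffOn hΩ hx hf, Finset.sum_eq_zero fun i hi ↦ h i hi j hj]

theorem iteratedFDeriv_fderiv_apply_const {f : G → ℝ} {x : G} {Ω : Set G} (hΩ : IsOpen Ω)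
    (hx : x ∈ Ω) (hf : ContDiffOn ℝ ∞ f Ω) (j : ℕ) (v : Fin j → G) (w : G) :
    iteratedFDeriv ℝ j (fun z ↦ fderiv ℝ f z w) x v = iteratedFDeriv ℝ j (fderiv ℝ f) x v w := by
  have := (ContinuousLinearMap.apply ℝ ℝ w).iteratedFDeriv_comp_left (f := fderiv ℝ f)
    ((hf.fderiv_of_isOpen hΩ (by simp)).contDiffAt (n := ∞) (hΩ.mem_nhds hx)) (i := j)
    (by exact_mod_cast le_top)
  exact congrArg (fun A ↦ A v) this

theorem iteratedFDeriv_succ_snoc (f : G → ℝ) (x : G) (j : ℕ) (v : Fin j → G) (w : G) :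
    iteratedFDeriv ℝ (j + 1) f x (Fin.snoc v w) = iteratedFDeriv ℝ j (fderiv ℝ f) x v w := by
  have h3 : Fin.init (Fin.snoc v w : Fin (j + 1) → G) = v := Fin.init_snoc (α := fun _ ↦ G) _ _
  have h4 : (Fin.snoc v w : Fin (j + 1) → G) (Fin.last j) = w :=
    Fin.snoc_last (α := fun _ ↦ G) _ _
  rw [iteratedFDeriv_succ_apply_right, h3, h4]

/-- The leading derivative of a first order expression in a function vanishing to high order. -/
theorem VanishesToOrder.iteratedFDeriv_fderiv_apply {j : ℕ} {f : G → ℝ} {X : G → G} {l : G → ℝ}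
    {x : G} {Ω : Set G} (hΩ : IsOpen Ω) (hx : x ∈ Ω) (hf : ContDiffOn ℝ ∞ f Ω)
    (hX : ContDiffOn ℝ ∞ X Ω) (hl : ContDiffOn ℝ ∞ l Ω) (h : VanishesToOrder (j + 1) f x)
    (v : Fin j → G) :
    iteratedFDeriv ℝ j (fun z ↦ _root_.fderiv ℝ f z (X z) - l z * f z) x v =
      iteratedFDeriv ℝ (j + 1) f x (Fin.snoc v (X x)) := by
  have hf' : ContDiffOn ℝ ∞ (_root_.fderiv ℝ f) Ω := hf.fderiv_of_isOpen hΩ (by simp)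
  -- Freeze the coefficient at `x`. The remainder `X z - X x` vanishes at `x` and gains one order
  -- against `df`, and the term with `l` already contains `f`. Both vanish to order `j + 1`, so only
  -- `f₀` contributes.
  let f₀ : G → ℝ := fun z ↦ _root_.fderiv ℝ f z (X x)
  let f₁ : G → ℝ := fun z ↦ _root_.fderiv ℝ f z (X z - X x)
  let f₂ : G → ℝ := fun z ↦ f z • (- l z)
  have h₀ : ContDiffOn ℝ ∞ f₀ Ω := hf'.clm_apply contDiffOn_const
  have h₁ : ContDiffOn ℝ ∞ f₁ Ω := hf'.clm_apply (hX.sub contDiffOn_const)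
  have h₂ : ContDiffOn ℝ ∞ f₂ Ω := hf.smul hl.neg
  have e₁ : VanishesToOrder (j + 1) f₁ x :=
    VanishesToOrder.bilinear (ContinuousLinearMap.id ℝ (G →L[ℝ] ℝ)) hΩ hx hf'
      (hX.sub contDiffOn_const) h.fderiv (vanishesToOrder_one.2 (by simp))
  have e₂ : VanishesToOrder (j + 1) f₂ x := h.smul_left hΩ hx hf hl.neg
  have hsum : (fun z ↦ _root_.fderiv ℝ f z (X z) - l z * f z) =
      fun z ↦ ∑ i : Fin 3, (![f₀, f₁, f₂] i) z := by
    ext z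
    simp [Fin.sum_univ_three, f₀, f₁, f₂]
    ring
  rw [hsum, iteratedFDeriv_sum_of_contDiffOn hΩ hx, Fin.sum_univ_three]
  · change (iteratedFDeriv ℝ j f₀ x + iteratedFDeriv ℝ j f₁ x + iteratedFDeriv ℝ j f₂ x) v = _
    rw [e₁ j (by omega), e₂ j (by omega), add_zero, add_zero,
      iteratedFDeriv_fderiv_apply_const hΩ hx hf, iteratedFDeriv_succ_snoc]
  · intro i _
    fin_cases i
    exacts [h₀, h₁, h₂]

theorem contDiffOn_iteratedFDeriv {f : Q → F} {Ω : Set Q} (hΩ : IsOpen Ω)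
    (hf : ContDiffOn ℝ ∞ f Ω) (j : ℕ) : ContDiffOn ℝ ∞ (iteratedFDeriv ℝ j f) Ω := fun z hz ↦
  ((hf.contDiffAt (hΩ.mem_nhds hz)).iteratedFDeriv_right (i := j) (m := ∞)
    (by exact_mod_cast (le_top : (⊤ : ℕ∞) + j ≤ ⊤))).contDiffWithinAt

end Calculus

end SprayPDE

namespace SprayPDE

/-! ### Formal flows of commuting first order operators -/

section FormalFlow

variable {A : Type*} [CommRing A] [Algebra ℝ A] {ι : Type*} [DecidableEq ι]

/-- The truncated formal flow `∑_{k ≤ N} (-τ)^k / k! D^k`. -/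
noncomputable def truncatedFlow (D : A →ₗ[ℝ] A) (τ : A) (N : ℕ) (f : A) : A :=
  ∑ k ∈ Finset.range (N + 1), ((-1) ^ k / (k.factorial : ℝ)) • (τ ^ k * (D ^ k) f)

theorem apply_pow_mul {D : A →ₗ[ℝ] A} {τ : A} (hD : ∀ f, D (τ * f) = f + τ * D f) (k : ℕ) (f : A) :
    D (τ ^ (k + 1) * f) = ((k : ℝ) + 1) • (τ ^ k * f) + τ ^ (k + 1) * D f := by
  induction k with
  | zero => simp [hD]
  | succ k ih =>
    rw [pow_succ' τ (k + 1), mul_assoc, hD, ih]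
    simp only [Algebra.smul_def, map_add, map_one, Nat.cast_add, Nat.cast_one]
    ring

theorem apply_pow_mul_of_commute {D : A →ₗ[ℝ] A} {τ : A} (hD : ∀ f, D (τ * f) = τ * D f)
    (k : ℕ) (f : A) : D (τ ^ k * f) = τ ^ k * D f := by
  induction k with
  | zero => simp
  | succ k ih => rw [pow_succ', mul_assoc, hD, ih, mul_assoc]

/-- Since `D τ - τ D = 1`, the sum telescopes: differentiating the power of `τ` in one term cancels
the application of `D` in the preceding one. Only the last term survives, and it carries `τ ^ N`. -/
theorem apply_truncatedFlow {D : A →ₗ[ℝ] A} {τ : A} (hD : ∀ f, D (τ * f) = f + τ * D f) (N : ℕ)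
    (f : A) : D (truncatedFlow D τ N f) =
      τ ^ N * (((-1) ^ N / (N.factorial : ℝ)) • (D ^ (N + 1)) f) := by
  induction N with
  | zero => simp [truncatedFlow]
  | succ N ih =>
    rw [truncatedFlow, Finset.sum_range_succ, map_add, ← truncatedFlow, ih, map_smul,
      apply_pow_mul hD, smul_add, smul_smul, ← Module.End.mul_apply, ← pow_succ',
      mul_smul_comm, mul_smul_comm, ← add_assoc, ← add_smul]
    have : ((-1) ^ N / (N.factorial : ℝ)) +
        ((-1) ^ (N + 1) / ((N + 1).factorial : ℝ)) * ((N : ℝ) + 1) = 0 := by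
      rw [Nat.factorial_succ]
      push_cast
      field_simp
      ring
    rw [this, zero_smul, zero_add]

theorem truncatedFlow_eq_add (D : A →ₗ[ℝ] A) (τ : A) (N : ℕ) (f : A) :
    ∃ h, truncatedFlow D τ N f = f + τ * h := by
  refine ⟨∑ k ∈ Finset.range N,
    ((-1) ^ (k + 1) / ((k + 1).factorial : ℝ)) • (τ ^ k * (D ^ (k + 1)) f), ?_⟩
  rw [truncatedFlow, Finset.sum_range_succ', add_comm, Finset.mul_sum]
  congr 1
  · simp
  · refine Finset.sum_congr rfl fun k _ ↦ ?_
    rw [mul_smul_comm, pow_succ' τ, mul_assoc]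

theorem map_truncatedFlow {D D' : A →ₗ[ℝ] A} {τ : A} (hD : ∀ f, D' (τ * f) = τ * D' f)
    (hcomm : ∀ f, D' (D f) = D (D' f)) (N : ℕ) (f : A) :
    D' (truncatedFlow D τ N f) = truncatedFlow D τ N (D' f) := by
  have hk (k : ℕ) (f : A) : D' ((D ^ k) f) = (D ^ k) (D' f) := by
    induction k generalizing f with
    | zero => rfl
    | succ k ih => rw [pow_succ', Module.End.mul_apply, Module.End.mul_apply, hcomm, ih]
  simp only [truncatedFlow, map_sum, map_smul, apply_pow_mul_of_commute hD, hk]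

theorem truncatedFlow_pow_mul {D : A →ₗ[ℝ] A} {τ σ : A} (hD : ∀ f, D (σ * f) = σ * D f)
    (N n : ℕ) (f : A) :
    truncatedFlow D τ N (σ ^ n * f) = σ ^ n * truncatedFlow D τ N f := by
  have hk (k : ℕ) : (D ^ k) (σ ^ n * f) = σ ^ n * (D ^ k) f := by
    induction k with
    | zero => rfl
    | succ k ih =>
      rw [pow_succ', Module.End.mul_apply, ih, apply_pow_mul_of_commute hD, Module.End.mul_apply]
  simp only [truncatedFlow, Finset.mul_sum, hk, mul_smul_comm]
  refine Finset.sum_congr rfl fun k _ ↦ ?_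
  rw [mul_left_comm]

/-- A system of commuting first order operators `D a` with `[D a, τ b] = δ_{ab}` has solutions
modulo powers of the `τ a`, with prescribed values modulo the `τ a`. -/
theorem exists_formal_solution [Fintype ι] (D : ι → A →ₗ[ℝ] A) (τ : ι → A)
    (hD : ∀ a f, D a (τ a * f) = f + τ a * D a f)
    (hD' : ∀ a b f, a ≠ b → D a (τ b * f) = τ b * D a f)
    (hcomm : ∀ a b f, D a (D b f) = D b (D a f)) (N : ℕ) (g : A) :
    ∃ (f : A) (h h' : ι → A), f = g + ∑ a, τ a * h a ∧ ∀ a, D a f = τ a ^ N * h' a := by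
  -- Solve one equation at a time.
  suffices H : ∀ s : Finset ι, ∃ (f : A) (h h' : ι → A), f = g + ∑ a, τ a * h a ∧
      ∀ a ∈ s, D a f = τ a ^ N * h' a by
    obtain ⟨f, h, h', hf, hs⟩ := H Finset.univ
    exact ⟨f, h, h', hf, fun a ↦ hs a (Finset.mem_univ a)⟩
  intro s
  induction s using Finset.induction_on with
  | empty => exact ⟨g, 0, 0, by simp, by simp⟩
  | insert b s hb ih =>
    obtain ⟨f, h, h', hf, hs⟩ := ih
    obtain ⟨k, hk⟩ := truncatedFlow_eq_add (D b) (τ b) N f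
    -- The flow of `D b` solves equation `b` modulo `τ b ^ N`. It keeps the earlier ones solved,
    -- because `D a` passes through the flow (it commutes with `D b` and `τ b`) and the flow
    -- commutes with `τ a ^ N`.
    refine ⟨truncatedFlow (D b) (τ b) N f, fun a ↦ h a + if a = b then k else 0,
      fun a ↦ if a = b then ((-1) ^ N / (N.factorial : ℝ)) • (D b ^ (N + 1)) f
        else truncatedFlow (D b) (τ b) N (h' a), ?_, fun a ha ↦ ?_⟩
    · rw [hk, hf]
      simp [mul_add, Finset.sum_add_distrib, add_assoc]
    · by_cases hab : a = b
      · subst hab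
        beta_reduce
        rw [if_pos rfl, apply_truncatedFlow (hD a)]
      · beta_reduce
        rw [if_neg hab, map_truncatedFlow (fun f ↦ hD' a b f hab) (hcomm a b),
          hs a (Finset.mem_of_mem_insert_of_ne ha hab),
          truncatedFlow_pow_mul fun f ↦ hD' b a f (Ne.symm hab)]

end FormalFlow

end SprayPDE

namespace SprayPDE

/-! ### First order operators on the algebra of smooth functions on an open set -/

section SmoothFunctions

variable {Q : Type*} [NormedAddCommGroup Q] [NormedSpace ℝ Q] {Ω : Set Q}

/-- The algebra of smooth functions on an open subset of a normed space. -/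
def smoothFunctions (Ω : Set Q) : Subalgebra ℝ (Ω → ℝ) where
  carrier := {f | ∃ F : Q → ℝ, ContDiffOn ℝ ∞ F Ω ∧ ∀ z : Ω, f z = F z}
  mul_mem' := by
    rintro f g ⟨F, hF, hf⟩ ⟨G, hG, hg⟩
    exact ⟨fun z ↦ F z * G z, hF.mul hG, fun z ↦ by simp [hf, hg]⟩
  add_mem' := by
    rintro f g ⟨F, hF, hf⟩ ⟨G, hG, hg⟩
    exact ⟨fun z ↦ F z + G z, hF.add hG, fun z ↦ by simp [hf, hg]⟩
  algebraMap_mem' c := ⟨fun _ ↦ c, contDiffOn_const, fun _ ↦ rfl⟩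

/-- A smooth function on `Ω`, given by a function on the whole space. -/
def smoothFunctions.mk (F : Q → ℝ) (hF : ContDiffOn ℝ ∞ F Ω) : smoothFunctions Ω :=
  ⟨fun z ↦ F z, F, hF, fun _ ↦ rfl⟩

@[simp]
theorem smoothFunctions.mk_apply (F : Q → ℝ) (hF : ContDiffOn ℝ ∞ F Ω) (z : Ω) :
    (smoothFunctions.mk F hF).1 z = F z := rfl

/-- A function on the whole space which represents a smooth function on `Ω`. -/
noncomputable def smoothRep (f : smoothFunctions Ω) : Q → ℝ := f.2.choose

theorem contDiffOn_smoothRep (f : smoothFunctions Ω) : ContDiffOn ℝ ∞ (smoothRep f) Ω :=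
  f.2.choose_spec.1

theorem smoothRep_apply (f : smoothFunctions Ω) (z : Ω) : smoothRep f z = f.1 z :=
  (f.2.choose_spec.2 z).symm

/-- On an open set the derivative does not depend on the chosen extension to the whole space, so the
operators below are well defined and linear. -/
theorem fderiv_smoothRep (hΩ : IsOpen Ω) (f : smoothFunctions Ω) {F : Q → ℝ}
    (h : ∀ z : Ω, f.1 z = F z) (z : Ω) : fderiv ℝ (smoothRep f) z = fderiv ℝ F z := by
  refine Filter.EventuallyEq.fderiv_eq ?_
  filter_upwards [hΩ.mem_nhds z.2] with u hu
  rw [← h ⟨u, hu⟩, ← smoothRep_apply f]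

theorem differentiableAt_smoothRep (hΩ : IsOpen Ω) (f : smoothFunctions Ω) (z : Ω) :
    DifferentiableAt ℝ (smoothRep f) z :=
  ((contDiffOn_smoothRep f).contDiffAt (hΩ.mem_nhds z.2)).differentiableAt (by simp)

/-- The operator `f ↦ df(Y) - l f`. -/
noncomputable def firstOrderOperator (hΩ : IsOpen Ω) {Y : Q → Q} {l : Q → ℝ}
    (hY : ContDiffOn ℝ ∞ Y Ω) (hl : ContDiffOn ℝ ∞ l Ω) :
    smoothFunctions Ω →ₗ[ℝ] smoothFunctions Ω where
  toFun f := smoothFunctions.mk (fun z ↦ fderiv ℝ (smoothRep f) z (Y z) - l z * smoothRep f z)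
    ((((contDiffOn_smoothRep f).fderiv_of_isOpen hΩ (by simp)).clm_apply hY).sub
      (hl.mul (contDiffOn_smoothRep f)))
  map_add' f g := by
    ext z
    have hd := fderiv_smoothRep hΩ (f + g) (F := fun z ↦ smoothRep f z + smoothRep g z)
      (fun z ↦ by simp [smoothRep_apply]) z
    rw [fderiv_fun_add (differentiableAt_smoothRep hΩ f z) (differentiableAt_smoothRep hΩ g z)] at hd
    simp only [smoothFunctions.mk_apply, Subalgebra.coe_add, Pi.add_apply,
      smoothRep_apply, hd, add_apply]
    ring
  map_smul' c f := by
    ext z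
    have hd := fderiv_smoothRep hΩ (c • f) (F := fun z ↦ c • smoothRep f z)
      (fun z ↦ by simp [smoothRep_apply]) z
    rw [fderiv_fun_const_smul (differentiableAt_smoothRep hΩ f z)] at hd
    simp only [smoothFunctions.mk_apply, RingHom.id_apply, SetLike.val_smul, Pi.smul_apply,
      smoothRep_apply, hd, smul_apply, smul_eq_mul]
    ring

theorem firstOrderOperator_apply (hΩ : IsOpen Ω) {Y : Q → Q} {l : Q → ℝ}
    (hY : ContDiffOn ℝ ∞ Y Ω) (hl : ContDiffOn ℝ ∞ l Ω) (f : smoothFunctions Ω) {F : Q → ℝ}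
    (h : ∀ z : Ω, f.1 z = F z) (z : Ω) :
    (firstOrderOperator hΩ hY hl f).1 z = fderiv ℝ F z (Y z) - l z * F z := by
  rw [← fderiv_smoothRep hΩ f h, ← h]
  simp [firstOrderOperator, smoothRep_apply]

theorem fderiv_firstOrder (hΩ : IsOpen Ω) {Y : Q → Q} {l F : Q → ℝ} {z : Q} (hz : z ∈ Ω)
    (hY : ContDiffOn ℝ ∞ Y Ω) (hl : ContDiffOn ℝ ∞ l Ω) (hF : ContDiffOn ℝ ∞ F Ω) (v : Q) :
    fderiv ℝ (fun u ↦ fderiv ℝ F u (Y u) - l u * F u) z v =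
      fderiv ℝ (fderiv ℝ F) z v (Y z) + fderiv ℝ F z (fderiv ℝ Y z v) -
        (fderiv ℝ l z v * F z + l z * fderiv ℝ F z v) := by
  have hd {f : Q → ℝ} (hf : ContDiffOn ℝ ∞ f Ω) : DifferentiableAt ℝ f z :=
    (hf.contDiffAt (hΩ.mem_nhds hz)).differentiableAt (by simp)
  have hF' : ContDiffOn ℝ ∞ (fderiv ℝ F) Ω := hF.fderiv_of_isOpen hΩ (by simp)
  have h1 : DifferentiableAt ℝ (fun u ↦ fderiv ℝ F u (Y u)) z := hd (hF'.clm_apply hY)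
  have h2 : DifferentiableAt ℝ (fun u ↦ l u * F u) z := hd (hl.mul hF)
  rw [fderiv_fun_sub h1 h2, fderiv_fun_mul (hd hl) (hd hF), fderiv_clm_apply
    ((hF'.contDiffAt (hΩ.mem_nhds hz)).differentiableAt (by simp))
    ((hY.contDiffAt (hΩ.mem_nhds hz)).differentiableAt (by simp))]
  simp
  ring

theorem isSymmSndFDerivAt_of_contDiffOn (hΩ : IsOpen Ω) {F : Q → ℝ} {z : Q} (hz : z ∈ Ω)
    (hF : ContDiffOn ℝ ∞ F Ω) : IsSymmSndFDerivAt ℝ F z :=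
  (hF.contDiffAt (hΩ.mem_nhds hz)).isSymmSndFDerivAt
    (by simpa using WithTop.coe_le_coe.2 (le_top : (2 : ℕ∞) ≤ ⊤))

/-- First order operators whose coefficients satisfy the commutation relations commute. -/
theorem firstOrder_commute (hΩ : IsOpen Ω) {Y Y' : Q → Q} {l l' F : Q → ℝ} {z : Q} (hz : z ∈ Ω)
    (hY : ContDiffOn ℝ ∞ Y Ω) (hl : ContDiffOn ℝ ∞ l Ω) (hY' : ContDiffOn ℝ ∞ Y' Ω)
    (hl' : ContDiffOn ℝ ∞ l' Ω) (hF : ContDiffOn ℝ ∞ F Ω) (hb : lieBracket ℝ Y Y' z = 0)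
    (hll : fderiv ℝ l' z (Y z) = fderiv ℝ l z (Y' z)) :
    fderiv ℝ (fun u ↦ fderiv ℝ F u (Y' u) - l' u * F u) z (Y z) -
        l z * (fderiv ℝ F z (Y' z) - l' z * F z) =
      fderiv ℝ (fun u ↦ fderiv ℝ F u (Y u) - l u * F u) z (Y' z) -
        l' z * (fderiv ℝ F z (Y z) - l z * F z) := by
  have hs := isSymmSndFDerivAt_of_contDiffOn hΩ hz hF (Y z) (Y' z)
  have hb' : fderiv ℝ F z (fderiv ℝ Y' z (Y z)) = fderiv ℝ F z (fderiv ℝ Y z (Y' z)) := by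
    rw [lieBracket, sub_eq_zero] at hb
    rw [hb]
  -- The second derivatives cancel by symmetry, the first derivatives by `hb`, and the terms in `F`
  -- itself by `hll`.
  rw [fderiv_firstOrder hΩ hz hY' hl' hF, fderiv_firstOrder hΩ hz hY hl hF, hll, hb', hs]
  ring

/-- This is `exists_formal_solution` in the algebra of smooth functions on `Ω`: the Leibniz rule and
`Y a (τ b) = δ_{ab}` give the relations with the `τ b`, and `firstOrder_commute` gives commutation.
-/
theorem exists_solution_mod {ι : Type*} [Fintype ι] [DecidableEq ι] (hΩ : IsOpen Ω)
    {Y : ι → Q → Q} {l τ : ι → Q → ℝ} (hY : ∀ a, ContDiffOn ℝ ∞ (Y a) Ω)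
    (hl : ∀ a, ContDiffOn ℝ ∞ (l a) Ω) (hτ : ∀ a, ContDiffOn ℝ ∞ (τ a) Ω)
    (hYτ : ∀ a b, ∀ z ∈ Ω, fderiv ℝ (τ b) z (Y a z) = if a = b then 1 else 0)
    (hYY : ∀ a b, ∀ z ∈ Ω, lieBracket ℝ (Y a) (Y b) z = 0)
    (hll : ∀ a b, ∀ z ∈ Ω, fderiv ℝ (l b) z (Y a z) = fderiv ℝ (l a) z (Y b z))
    (N : ℕ) {g : Q → ℝ} (hg : ContDiffOn ℝ ∞ g Ω) :
    ∃ (f : Q → ℝ) (h h' : ι → Q → ℝ), ContDiffOn ℝ ∞ f Ω ∧ (∀ a, ContDiffOn ℝ ∞ (h' a) Ω) ∧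
      (∀ z ∈ Ω, f z = g z + ∑ a, τ a z * h a z) ∧
      ∀ a, ∀ z ∈ Ω, fderiv ℝ f z (Y a z) - l a z * f z = τ a z ^ N * h' a z := by
  have hprod (a b : ι) (f : smoothFunctions Ω) (z : Ω) :
      (firstOrderOperator hΩ (hY a) (hl a) (smoothFunctions.mk (τ b) (hτ b) * f)).1 z =
        (if a = b then 1 else 0) * f.1 z +
          τ b z * (firstOrderOperator hΩ (hY a) (hl a) f).1 z := by
    rw [firstOrderOperator_apply hΩ (hY a) (hl a) _ (F := fun u ↦ τ b u * smoothRep f u)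
      (fun u ↦ by simp [smoothRep_apply]) z,
      firstOrderOperator_apply hΩ (hY a) (hl a) f (fun u ↦ (smoothRep_apply f u).symm) z,
      fderiv_fun_mul (((hτ b).contDiffAt (hΩ.mem_nhds z.2)).differentiableAt (by simp))
        (differentiableAt_smoothRep hΩ f z)]
    simp [hYτ a b z z.2, smoothRep_apply]
    ring
  obtain ⟨f, h, h', hf, hf'⟩ := exists_formal_solution
    (fun a ↦ firstOrderOperator hΩ (hY a) (hl a)) (fun a ↦ smoothFunctions.mk (τ a) (hτ a))
    (fun a f ↦ by ext z; simpa using hprod a a f z)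
    (fun a b f hab ↦ by ext z; simpa [hab] using hprod a b f z)
    (fun a b f ↦ by
      ext z
      rw [firstOrderOperator_apply hΩ (hY a) (hl a) _
          (F := fun u ↦ fderiv ℝ (smoothRep f) u (Y b u) - l b u * smoothRep f u) (firstOrderOperator_apply hΩ
          (hY b) (hl b) f (F := smoothRep f) fun u ↦ (smoothRep_apply f u).symm) z,
        firstOrderOperator_apply hΩ (hY b) (hl b) _
          (F := fun u ↦ fderiv ℝ (smoothRep f) u (Y a u) - l a u * smoothRep f u) (firstOrderOperator_apply hΩ
          (hY a) (hl a) f (F := smoothRep f) fun u ↦ (smoothRep_apply f u).symm) z]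
      exact firstOrder_commute hΩ z.2 (hY a) (hl a) (hY b) (hl b) (contDiffOn_smoothRep f)
        (hYY a b z z.2) (hll a b z z.2))
    N (smoothFunctions.mk g hg)
  refine ⟨smoothRep f, fun a ↦ smoothRep (h a), fun a ↦ smoothRep (h' a), contDiffOn_smoothRep f,
    fun a ↦ (contDiffOn_smoothRep (h' a)), fun z hz ↦ ?_, fun a z hz ↦ ?_⟩
  · have e (f : smoothFunctions Ω) : smoothRep f z = f.1 ⟨z, hz⟩ := smoothRep_apply f ⟨z, hz⟩
    have := congrArg (fun f ↦ f.1 (⟨z, hz⟩ : Ω)) hf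
    simpa [e, Finset.sum_apply] using this
  · have e (f : smoothFunctions Ω) : smoothRep f z = f.1 ⟨z, hz⟩ := smoothRep_apply f ⟨z, hz⟩
    have := congrArg (fun f ↦ f.1 (⟨z, hz⟩ : Ω)) (hf' a)
    rw [firstOrderOperator_apply hΩ (hY a) (hl a) f (fun u ↦ (smoothRep_apply f u).symm)] at this
    refine this.trans ?_
    simp [e]

end SmoothFunctions

/-! ### Commuting frames of involutive distributions -/

section CommutingFrame

variable {G : Type*} [NormedAddCommGroup G] [NormedSpace ℝ G] {ι : Type*} [Fintype ι]

/-- A frame of an involutive distribution with constant components along a complement of the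
kernel of a linear map commutes. -/
theorem lieBracket_eq_zero_of_frame {κ : Type*} {X : ι → G → G} {Y : κ → G → G}
    {m : κ → ι → G → ℝ} {z : G}
    (hX : ∀ a, DifferentiableAt ℝ (X a) z) (hm : ∀ a b, DifferentiableAt ℝ (m a b) z)
    (hYX : ∀ a, Y a =ᶠ[𝓝 z] fun u ↦ ∑ b, m a b u • X b u)
    (hbr : ∀ a b, lieBracket ℝ (X a) (X b) z ∈ Submodule.span ℝ (range fun c ↦ X c z))
    {T : Type*} [NormedAddCommGroup T] [NormedSpace ℝ T] (t : G →L[ℝ] T) (c : κ → T)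
    (ht : ∀ a, ∀ᶠ u in 𝓝 z, t (Y a u) = c a)
    (hinj : ∀ v ∈ Submodule.span ℝ (range fun c ↦ X c z), t v = 0 → v = 0) (a b : κ) :
    lieBracket ℝ (Y a) (Y b) z = 0 := by
  have hd (a : κ) : HasFDerivAt (Y a)
      (∑ b, (m a b z • fderiv ℝ (X b) z + (fderiv ℝ (m a b) z).smulRight (X b z))) z :=
    (HasFDerivAt.fun_sum fun b _ ↦ (hm a b).hasFDerivAt.smul (hX b).hasFDerivAt).congr_of_eventuallyEq
      (hYX a)
  have hY (a : κ) : Y a z = ∑ b, m a b z • X b z := (hYX a).eq_of_nhds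
  -- The bracket lies in the span by involutivity, and `t` kills it because `t` is constant along
  -- each `Y a`. On the span only zero is killed.
  refine hinj _ ?_ ?_
  · have hXmem (b : ι) : X b z ∈ Submodule.span ℝ (range fun c ↦ X c z) :=
      Submodule.subset_span ⟨b, rfl⟩
    -- Modulo the span, differentiating `Y b` along `Y a` does not see the derivatives of the
    -- coefficients `m`.
    have key (a b : κ) : fderiv ℝ (Y b) z (Y a z) - ∑ c, ∑ d,
        (m a c z * m b d z) • fderiv ℝ (X d) z (X c z) ∈
          Submodule.span ℝ (range fun c ↦ X c z) := by
      have : fderiv ℝ (Y b) z (Y a z) - ∑ c, ∑ d,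
          (m a c z * m b d z) • fderiv ℝ (X d) z (X c z) =
          ∑ d, (fderiv ℝ (m b d) z (Y a z)) • X d z := by
        rw [(hd b).fderiv, Finset.sum_comm, sum_apply, ← Finset.sum_sub_distrib]
        refine Finset.sum_congr rfl fun d _ ↦ ?_
        have : fderiv ℝ (X d) z (Y a z) = ∑ c, m a c z • fderiv ℝ (X d) z (X c z) := by
          rw [hY, map_sum]
          simp
        simp only [add_apply, smul_apply, this,
          ContinuousLinearMap.smulRight_apply, Finset.smul_sum, smul_smul, mul_comm (m b d z)]
        abel
      rw [this]
      exact Submodule.sum_mem _ fun d _ ↦ Submodule.smul_mem _ _ (hXmem d)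
    have hsum : ∑ c, ∑ d, (m a c z * m b d z) • fderiv ℝ (X d) z (X c z) -
        ∑ c, ∑ d, (m b c z * m a d z) • fderiv ℝ (X d) z (X c z) =
        ∑ c, ∑ d, (m a c z * m b d z) • lieBracket ℝ (X c) (X d) z := by
      rw [Finset.sum_comm (f := fun c d ↦ (m b c z * m a d z) • fderiv ℝ (X d) z (X c z))]
      simp only [lieBracket, smul_sub, Finset.sum_sub_distrib, mul_comm (m b _ z)]
    have h3 : ∑ c, ∑ d, (m a c z * m b d z) • lieBracket ℝ (X c) (X d) z ∈
        Submodule.span ℝ (range fun c ↦ X c z) :=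
      Submodule.sum_mem _ fun c _ ↦ Submodule.sum_mem _ fun d _ ↦
        Submodule.smul_mem _ _ (hbr c d)
    rw [← hsum] at h3
    have h4 := Submodule.add_mem _ (Submodule.sub_mem _ (key a b) (key b a)) h3
    convert h4 using 1
    rw [lieBracket]
    abel
  · have hconst (b : κ) (v : G) : t (fderiv ℝ (Y b) z v) = 0 := by
      have h1 : HasFDerivAt (fun u ↦ t (Y b u)) (t.comp (fderiv ℝ (Y b) z)) z :=
        t.hasFDerivAt.comp z (hd b).differentiableAt.hasFDerivAt
      have h2 : HasFDerivAt (fun u ↦ t (Y b u)) (0 : G →L[ℝ] T) z :=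
        (hasFDerivAt_const (c b) z).congr_of_eventuallyEq (ht b)
      simpa using congrArg (fun A ↦ A v) (h1.unique h2)
    rw [lieBracket, map_sub, hconst, hconst, sub_zero]

end CommutingFrame

end SprayPDE

namespace SprayPDE

/-! ### Commuting systems of first order operators and their construction from involutive frames -/

section CommutingSystem

variable {G : Type*} [NormedAddCommGroup G] [NormedSpace ℝ G] {ι : Type*}

/-- The first order operators `f ↦ df(Y a) - l a f` commute, and the vector fields `Y a` project
under the linear map `t` to the coordinate vectors. -/
structure CommutingSystem [DecidableEq ι] (W : Set G) (t : G →L[ℝ] (ι → ℝ)) (Y : ι → G → G)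
    (l : ι → G → ℝ) : Prop where
  isOpen : IsOpen W
  smooth_Y : ∀ a, ContDiffOn ℝ ∞ (Y a) W
  smooth_l : ∀ a, ContDiffOn ℝ ∞ (l a) W
  t_Y : ∀ z ∈ W, ∀ a, t (Y a z) = Pi.single a 1
  bracket : ∀ z ∈ W, ∀ a b, lieBracket ℝ (Y a) (Y b) z = 0
  compat : ∀ z ∈ W, ∀ a b, fderiv ℝ (l b) z (Y a z) = fderiv ℝ (l a) z (Y b z)

/-- The operator `f ↦ df(X) - l f` is encoded as the field `(X, l)` on `G × ℝ`, constant in the last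
coordinate. Its bracket then collects both commutation conditions: one on the fields and one on the
zeroth order terms. -/
theorem lieBracket_prodMk {X X' : G → G} {l l' : G → ℝ} {z : G × ℝ}
    (hX : DifferentiableAt ℝ X z.1) (hX' : DifferentiableAt ℝ X' z.1)
    (hl : DifferentiableAt ℝ l z.1) (hl' : DifferentiableAt ℝ l' z.1) :
    lieBracket ℝ (fun u : G × ℝ ↦ (X u.1, l u.1)) (fun u : G × ℝ ↦ (X' u.1, l' u.1)) z =
      (lieBracket ℝ X X' z.1, fderiv ℝ l' z.1 (X z.1) - fderiv ℝ l z.1 (X' z.1)) := by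
  have key {X : G → G} {l : G → ℝ} (hX : DifferentiableAt ℝ X z.1)
      (hl : DifferentiableAt ℝ l z.1) : fderiv ℝ (fun u : G × ℝ ↦ (X u.1, l u.1)) z =
        ((fderiv ℝ X z.1).comp (ContinuousLinearMap.fst ℝ G ℝ)).prod
          ((fderiv ℝ l z.1).comp (ContinuousLinearMap.fst ℝ G ℝ)) :=
    ((hX.hasFDerivAt.comp z hasFDerivAt_fst).prodMk
      (hl.hasFDerivAt.comp z hasFDerivAt_fst)).fderiv
  simp [lieBracket, key hX hl, key hX' hl']

/-- Take for `t` a left inverse of `c ↦ ∑ c a X a p`. Near `p` the matrix `B z` of the `t (X b z)`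
stays invertible, and its inverse turns the `X b` into fields `Y a` with `t (Y a) = e_a`. The
condition `∑ k c * w c = 0` says exactly that the fields `(X a, w a)` on `G × ℝ` are involutive,
since constant last components contribute zero to a bracket. -/
theorem exists_commutingSystem [FiniteDimensional ℝ G] [Fintype ι] [DecidableEq ι] {W₀ : Set G}
    (hW₀ : IsOpen W₀) {p : G} (hp : p ∈ W₀) {X : ι → G → G} (hX : ∀ a, ContDiffOn ℝ ∞ (X a) W₀)
    (w : ι → ℝ) (hind : LinearIndependent ℝ fun a ↦ X a p)
    (hbr : ∀ z ∈ W₀, ∀ a b, ∃ k : ι → ℝ,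
      lieBracket ℝ (X a) (X b) z = ∑ c, k c • X c z ∧ ∑ c, k c * w c = 0) :
    ∃ (W : Set G) (t : G →L[ℝ] (ι → ℝ)) (Y : ι → G → G) (l : ι → G → ℝ) (m : ι → ι → G → ℝ),
      W ⊆ W₀ ∧ p ∈ W ∧ CommutingSystem W t Y l ∧ (∀ a b, ContDiffOn ℝ ∞ (m a b) W) ∧
      (∀ z ∈ W, ∀ a, Y a z = ∑ b, m a b z • X b z ∧ l a z = ∑ b, m a b z * w b) ∧
      ∀ z ∈ W, ∀ b, X b z = ∑ a, t (X b z) a • Y a z ∧ w b = ∑ a, t (X b z) a * l a z := by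
  obtain ⟨t₀, ht₀⟩ := LinearMap.exists_leftInverse_of_injective
    (Fintype.linearCombination ℝ fun a ↦ X a p) (by
      rw [LinearMap.ker_eq_bot]
      exact hind.fintypeLinearCombination_injective)
  let t : G →L[ℝ] (ι → ℝ) := LinearMap.toContinuousLinearMap t₀
  let Ξ : G → (ι → ℝ) →L[ℝ] G := fun z ↦
    ∑ b, (ContinuousLinearMap.proj (R := ℝ) (φ := fun _ : ι ↦ ℝ) b).smulRight (X b z)
  have Ξ_apply (z : G) (c : ι → ℝ) : Ξ z c = ∑ b, c b • X b z := by simp [Ξ]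
  have Ξ_single (z : G) (b : ι) : Ξ z (Pi.single b 1) = X b z := by
    simp [Ξ_apply, Pi.single_apply]
  have hΞ : ContDiffOn ℝ ∞ Ξ W₀ := ContDiffOn.sum fun b _ ↦ contDiffOn_const.smulRight (hX b)
  let B : G → (ι → ℝ) →L[ℝ] (ι → ℝ) := fun z ↦ t.comp (Ξ z)
  have hB : ContDiffOn ℝ ∞ B W₀ := contDiffOn_const.clm_comp hΞ
  have hBp : B p = 1 := by
    ext1 c
    have := LinearMap.congr_fun ht₀ c
    simpa [B, Ξ_apply, t, Fintype.linearCombination_apply] using this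
  let W : Set G := W₀ ∩ B ⁻¹' {x | IsUnit x}
  have hW : IsOpen W := hB.continuousOn.isOpen_inter_preimage hW₀ Units.isOpen
  let R : G → (ι → ℝ) →L[ℝ] (ι → ℝ) := fun z ↦ Ring.inverse (B z)
  have hR : ContDiffOn ℝ ∞ R W := by
    rintro z ⟨hz, hu⟩
    obtain ⟨u, hu⟩ := hu
    have := contDiffAt_ringInverse ℝ u (n := ∞)
    rw [hu] at this
    exact this.comp_contDiffWithinAt z ((hB z hz).mono inter_subset_left)
  have hBR (z : G) (hz : z ∈ W) (c : ι → ℝ) : B z (R z c) = c :=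
    congrArg (fun A : (ι → ℝ) →L[ℝ] (ι → ℝ) ↦ A c) (Ring.mul_inverse_cancel _ hz.2)
  have hRB (z : G) (hz : z ∈ W) (c : ι → ℝ) : R z (B z c) = c :=
    congrArg (fun A : (ι → ℝ) →L[ℝ] (ι → ℝ) ↦ A c) (Ring.inverse_mul_cancel _ hz.2)
  let Y : ι → G → G := fun a z ↦ Ξ z (R z (Pi.single a 1))
  let m : ι → ι → G → ℝ := fun a b z ↦ R z (Pi.single a 1) b
  let l : ι → G → ℝ := fun a z ↦ ∑ b, m a b z * w b
  have hm (a b : ι) : ContDiffOn ℝ ∞ (m a b) W :=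
    contDiffOn_pi.1 (hR.clm_apply contDiffOn_const) b
  have hY (a : ι) : ContDiffOn ℝ ∞ (Y a) W :=
    (hΞ.mono inter_subset_left).clm_apply (hR.clm_apply contDiffOn_const)
  have hl (a : ι) : ContDiffOn ℝ ∞ (l a) W :=
    ContDiffOn.sum fun b _ ↦ (hm a b).mul contDiffOn_const
  have htY (z : G) (hz : z ∈ W) (a : ι) : t (Y a z) = Pi.single a 1 := hBR z hz _
  have hYm (z : G) (a : ι) : Y a z = ∑ b, m a b z • X b z := Ξ_apply _ _
  have hsum (c : ι → ℝ) : ∑ a, c a • (Pi.single a 1 : ι → ℝ) = c := by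
    ext b
    simp [Finset.sum_apply, Pi.single_apply]
  have hYY (z : G) (hz : z ∈ W) (a b : ι) :
      (lieBracket ℝ (Y a) (Y b) z, fderiv ℝ (l b) z (Y a z) - fderiv ℝ (l a) z (Y b z)) =
        (0 : G × ℝ) := by
    have hdX (a : ι) : DifferentiableAt ℝ (X a) z :=
      ((hX a).contDiffAt (hW₀.mem_nhds hz.1)).differentiableAt (by simp)
    have hdY (a : ι) : DifferentiableAt ℝ (Y a) z :=
      ((hY a).contDiffAt (hW.mem_nhds hz)).differentiableAt (by simp)
    have hdl (a : ι) : DifferentiableAt ℝ (l a) z :=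
      ((hl a).contDiffAt (hW.mem_nhds hz)).differentiableAt (by simp)
    have hdm (a b : ι) : DifferentiableAt ℝ (m a b) z :=
      ((hm a b).contDiffAt (hW.mem_nhds hz)).differentiableAt (by simp)
    have hev : ∀ᶠ u : G × ℝ in 𝓝 (z, 0), u.1 ∈ W :=
      continuous_fst.continuousAt.eventually_mem (hW.mem_nhds hz)
    -- Applied to the extended fields, so that one vanishing bracket yields both the commutation of
    -- the `Y a` and the compatibility of the `l a`.
    have := lieBracket_eq_zero_of_frame (z := ((z, 0) : G × ℝ))
      (X := fun a (u : G × ℝ) ↦ (X a u.1, w a)) (Y := fun a (u : G × ℝ) ↦ (Y a u.1, l a u.1))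
      (m := fun a b u ↦ m a b u.1)
      (fun a ↦ ((hdX a).comp (f := Prod.fst) (z, (0 : ℝ)) differentiableAt_fst).prodMk
        (differentiableAt_const _))
      (fun a b ↦ (hdm a b).comp (f := Prod.fst) (z, (0 : ℝ)) differentiableAt_fst)
      (fun a ↦ Eventually.of_forall fun u ↦ by
        simp [Prod.ext_iff, Prod.fst_sum, Prod.snd_sum, hYm, l])
      (fun a b ↦ by
        rw [lieBracket_prodMk (l := fun _ ↦ w a) (l' := fun _ ↦ w b) (hdX a) (hdX b)
          (differentiableAt_const _) (differentiableAt_const _)]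
        obtain ⟨k, hk, hkw⟩ := hbr z hz.1 a b
        have : ((lieBracket ℝ (X a) (X b) z, 0) : G × ℝ) = ∑ c, k c • (X c z, w c) := by
          simp [Prod.ext_iff, Prod.fst_sum, Prod.snd_sum, hk, hkw]
        simp only [fderiv_fun_const, Pi.zero_apply, zero_apply, sub_zero, this]
        exact Submodule.sum_mem _ fun c _ ↦ Submodule.smul_mem _ _
          (Submodule.subset_span ⟨c, rfl⟩))
      (t.comp (ContinuousLinearMap.fst ℝ G ℝ)) (fun a ↦ Pi.single a 1)
      (fun a ↦ hev.mono fun u hu ↦ htY u.1 hu a)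
      (fun v hv hv0 ↦ by
        obtain ⟨c, rfl⟩ := (Submodule.mem_span_range_iff_exists_fun ℝ).1 hv
        have h1 : B z c = 0 := by
          simpa [B, Ξ_apply, Prod.fst_sum] using hv0
        have h2 : c = 0 := by rw [← hRB z hz c, h1, map_zero]
        simp [h2]) a b
    rwa [lieBracket_prodMk (hdY a) (hdY b) (hdl a) (hdl b)] at this
  refine ⟨W, t, Y, l, m, inter_subset_left, ⟨hp, ?_⟩, ⟨hW, hY, hl, htY, ?_, ?_⟩, hm,
    fun z _ a ↦ ⟨hYm z a, rfl⟩, fun z hz b ↦ ?_⟩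
  · simp [hBp]
  · exact fun z hz a b ↦ (Prod.ext_iff.1 (hYY z hz a b)).1
  · exact fun z hz a b ↦ sub_eq_zero.1 (Prod.ext_iff.1 (hYY z hz a b)).2
  · have h1 : B z (Pi.single b 1) = t (X b z) := by simp [B, Ξ_single]
    have h2 : ∑ a, t (X b z) a • R z (Pi.single a 1) = Pi.single b 1 := by
      simp only [← map_smul, ← map_sum, hsum, ← h1, hRB z hz]
    refine ⟨?_, ?_⟩
    · have h3 := congrArg (Ξ z) h2
      simp only [map_sum, map_smul, Ξ_single] at h3
      exact h3.symm
    · have h3 := congrArg (fun c : ι → ℝ ↦ ∑ d, c d * w d) h2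
      simp only [Pi.single_apply, ite_mul, one_mul, zero_mul, Finset.sum_ite_eq',
        Finset.mem_univ, if_true, Finset.sum_apply, Pi.smul_apply, smul_eq_mul,
        Finset.sum_mul] at h3
      rw [Finset.sum_comm] at h3
      simp only [l, m, Finset.mul_sum]
      rw [← h3]
      simp only [mul_assoc]

end CommutingSystem

end SprayPDE

namespace SprayPDE

/-! ### Jets of solutions of a commuting system -/

section Jets

variable {G : Type*} [NormedAddCommGroup G] [NormedSpace ℝ G]
  {F : Type*} [NormedAddCommGroup F] [NormedSpace ℝ F]

/-- The `m`-jet of a function on a normed space. -/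
noncomputable def jetAt (m : ℕ) (f : G → F) (x : G) : JetModel G F m :=
  fun j ↦ iteratedFDeriv ℝ (j : ℕ) f x

theorem jetAt_eq_zero_iff {m : ℕ} {f : G → F} {x : G} :
    jetAt m f x = 0 ↔ VanishesToOrder (m + 1) f x :=
  ⟨fun h j hj ↦ congrFun h ⟨j, hj⟩, fun h ↦ funext fun j ↦ h j j.2⟩

theorem jetAt_congr {m : ℕ} {f g : G → F} {x : G} (h : f =ᶠ[𝓝 x] g) :
    jetAt m f x = jetAt m g x :=
  funext fun j ↦ (h.iteratedFDeriv ℝ j).eq_of_nhds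

theorem VanishesToOrder.add {k : ℕ} {f g : G → F} {x : G} {Ω : Set G} (hΩ : IsOpen Ω) (hx : x ∈ Ω)
    (hf : ContDiffOn ℝ ∞ f Ω) (hg : ContDiffOn ℝ ∞ g Ω) (hfx : VanishesToOrder k f x)
    (hgx : VanishesToOrder k g x) : VanishesToOrder k (fun z ↦ f z + g z) x := fun j hj ↦ by
  have := iteratedFDeriv_add_apply (𝕜 := ℝ) (i := j) (x := x) (f := f) (g := g)
    ((hf.contDiffAt (hΩ.mem_nhds hx)).of_le (by exact_mod_cast le_top))
    ((hg.contDiffAt (hΩ.mem_nhds hx)).of_le (by exact_mod_cast le_top))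
  rw [hfx j hj, hgx j hj, add_zero] at this
  exact this

theorem VanishesToOrder.const_smul {k : ℕ} {f : G → F} {x : G} {Ω : Set G} (hΩ : IsOpen Ω)
    (hx : x ∈ Ω) (hf : ContDiffOn ℝ ∞ f Ω) (hfx : VanishesToOrder k f x) (c : ℝ) :
    VanishesToOrder k (fun z ↦ c • f z) x := fun j hj ↦ by
  have := iteratedFDeriv_const_smul_apply (𝕜 := ℝ) (i := j) (x := x) (f := f) (a := c)
    ((hf.contDiffAt (hΩ.mem_nhds hx)).of_le (by exact_mod_cast le_top))
  rw [hfx j hj, smul_zero] at this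
  exact this

theorem jetAt_add {m : ℕ} {f g : G → F} {x : G} {Ω : Set G} (hΩ : IsOpen Ω) (hx : x ∈ Ω)
    (hf : ContDiffOn ℝ ∞ f Ω) (hg : ContDiffOn ℝ ∞ g Ω) :
    jetAt m (fun z ↦ f z + g z) x = jetAt m f x + jetAt m g x :=
  funext fun _ ↦ iteratedFDeriv_add_apply
    ((hf.contDiffAt (hΩ.mem_nhds hx)).of_le (by exact_mod_cast le_top))
    ((hg.contDiffAt (hΩ.mem_nhds hx)).of_le (by exact_mod_cast le_top))

theorem jetAt_const_smul {m : ℕ} {f : G → F} {x : G} {Ω : Set G} (hΩ : IsOpen Ω) (hx : x ∈ Ω)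
    (hf : ContDiffOn ℝ ∞ f Ω) (c : ℝ) :
    jetAt m (fun z ↦ c • f z) x = c • jetAt m f x :=
  funext fun _ ↦ iteratedFDeriv_const_smul_apply
    ((hf.contDiffAt (hΩ.mem_nhds hx)).of_le (by exact_mod_cast le_top))

/-- The composition of jets with a linear endomorphism of the source. -/
noncomputable def compJet (m : ℕ) (ρ : G →L[ℝ] G) : JetModel G F m →ₗ[ℝ] JetModel G F m where
  toFun ξ j := (ξ j).compContinuousLinearMap fun _ ↦ ρ
  map_add' _ _ := rfl
  map_smul' _ _ := rfl

theorem compJet_jetAt {m : ℕ} {ρ : G →L[ℝ] G} {f : G → F} {x : G} {Ω : Set G} (hΩ : IsOpen Ω)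
    (hx : x ∈ Ω) (hf : ContDiffOn ℝ ∞ f Ω) :
    compJet m ρ (jetAt m f x) = jetAt m (fun y ↦ f (x + ρ y)) 0 := by
  funext j
  have := iteratedFDeriv_comp_affine hΩ hf ρ x 0 (by simpa using hx) j
  simp only [map_zero, add_zero] at this
  exact this.symm

theorem exists_contDiff_eventuallyEq [FiniteDimensional ℝ G] {f : G → ℝ} {W : Set G} {x : G}
    (hW : IsOpen W) (hx : x ∈ W) (hf : ContDiffOn ℝ ∞ f W) :
    ∃ g : G → ℝ, ContDiff ℝ ∞ g ∧ g =ᶠ[𝓝 x] f := by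
  obtain ⟨ε, hε, hεW⟩ := Metric.nhds_basis_closedBall.mem_iff.1 (hW.mem_nhds hx)
  let χ : ContDiffBump x := ⟨ε / 2, ε, by positivity, by linarith⟩
  refine ⟨fun z ↦ χ z * f z, contDiff_iff_contDiffAt.2 fun z ↦ ?_, ?_⟩
  · by_cases hz : z ∈ tsupport χ
    · rw [χ.tsupport_eq] at hz
      exact χ.contDiff.contDiffAt.mul (hf.contDiffAt (hW.mem_nhds (hεW hz)))
    · refine (contDiffAt_const (c := (0 : ℝ))).congr_of_eventuallyEq ?_
      filter_upwards [notMem_tsupport_iff_eventuallyEq.1 hz] with u hu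
      simp [hu]
  · filter_upwards [χ.eventuallyEq_one] with z hz
    simp [hz]

end Jets

/-! ### Formal solutions of a commuting system: uniqueness, existence, lifting and frames -/

section LocalSolutions

variable {G : Type*} [NormedAddCommGroup G] [NormedSpace ℝ G] {ι : Type*} [DecidableEq ι]
  {W : Set G} {t : G →L[ℝ] (ι → ℝ)} {Y : ι → G → G} {l : ι → G → ℝ}

theorem CommutingSystem.contDiffOn_op (hW : CommutingSystem W t Y l) {f : G → ℝ}
    (hf : ContDiffOn ℝ ∞ f W) (a : ι) :
    ContDiffOn ℝ ∞ (fun z ↦ fderiv ℝ f z (Y a z) - l a z * f z) W :=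
  ((hf.fderiv_of_isOpen hW.isOpen (by simp)).clm_apply (hW.smooth_Y a)).sub
    ((hW.smooth_l a).mul hf)

/-- The space of formal solutions of order `m` at `x` of a commuting system. -/
def localSolutions (hW : CommutingSystem W t Y l) (m : ℕ) {x : G} (hx : x ∈ W) :
    Submodule ℝ (JetModel G ℝ m) where
  carrier := {ξ | ∃ f, ContDiffOn ℝ ∞ f W ∧ jetAt m f x = ξ ∧
    ∀ a, VanishesToOrder m (fun z ↦ fderiv ℝ f z (Y a z) - l a z * f z) x}
  zero_mem' := ⟨fun _ ↦ 0, contDiffOn_const, by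
    rw [jetAt_eq_zero_iff]; exact vanishesToOrder_zero_fun _ _, fun a ↦ by
    simpa using vanishesToOrder_zero_fun m x⟩
  add_mem' := by
    rintro _ _ ⟨f, hf, rfl, hf'⟩ ⟨g, hg, rfl, hg'⟩
    refine ⟨fun z ↦ f z + g z, hf.add hg, jetAt_add hW.isOpen hx hf hg, fun a ↦ ?_⟩
    refine ((hf' a).add hW.isOpen hx (hW.contDiffOn_op hf a) (hW.contDiffOn_op hg a)
      (hg' a)).congr ?_
    filter_upwards [hW.isOpen.mem_nhds hx] with z hz
    rw [fderiv_fun_add ((hf.contDiffAt (hW.isOpen.mem_nhds hz)).differentiableAt (by simp))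
      ((hg.contDiffAt (hW.isOpen.mem_nhds hz)).differentiableAt (by simp)), add_apply]
    ring
  smul_mem' := by
    rintro c _ ⟨f, hf, rfl, hf'⟩
    refine ⟨fun z ↦ c • f z, hf.const_smul c, jetAt_const_smul hW.isOpen hx hf c,
      fun a ↦ ?_⟩
    refine ((hf' a).const_smul hW.isOpen hx (hW.contDiffOn_op hf a) c).congr ?_
    filter_upwards [hW.isOpen.mem_nhds hx] with z hz
    rw [fderiv_fun_const_smul ((hf.contDiffAt (hW.isOpen.mem_nhds hz)).differentiableAt (by simp)),
      smul_apply]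
    simp only [smul_eq_mul]
    ring

/-- A projection onto the kernel of `t`. -/
theorem CommutingSystem.exists_proj [Fintype ι] (hW : CommutingSystem W t Y l) {x₀ : G} (hx₀ : x₀ ∈ W) :
    ∃ ρ : G →L[ℝ] G, (∀ v, t (ρ v) = 0) ∧ ∀ v, t v = 0 → ρ v = v := by
  refine ⟨ContinuousLinearMap.id ℝ G - ∑ a, ((ContinuousLinearMap.proj (R := ℝ)
    (φ := fun _ : ι ↦ ℝ) a).comp t).smulRight (Y a x₀), fun v ↦ ?_, fun v hv ↦ ?_⟩
  · ext b
    simp [sum_apply, hW.t_Y x₀ hx₀, Pi.single_apply]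
  · simp [sum_apply, hv]

/-- Uniqueness of formal solutions: derivatives along `ker t` are prescribed, and the equations
express derivatives along the `Y a` through lower order ones. The proof is by induction on the
order. -/
theorem CommutingSystem.vanishesToOrder_of_restriction [Fintype ι] (hW : CommutingSystem W t Y l)
    {x : G} (hx : x ∈ W) {ρ : G →L[ℝ] G} (hρ : ∀ v, t v = 0 → ρ v = v) {m : ℕ} {f : G → ℝ}
    (hf : ContDiffOn ℝ ∞ f W)
    (hD : ∀ a, VanishesToOrder m (fun z ↦ fderiv ℝ f z (Y a z) - l a z * f z) x)
    (h : ∀ j ≤ m, ∀ v : Fin j → G, iteratedFDeriv ℝ j f x (fun i ↦ ρ (v i)) = 0) :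
    VanishesToOrder (m + 1) f x := by
  induction m generalizing f with
  | zero =>
    rw [zero_add, vanishesToOrder_one]
    simpa using h 0 le_rfl 0
  | succ m ih =>
    have hm := ih hf (fun a ↦ (hD a).mono (by omega)) (fun j hj ↦ h j (by omega))
    have hf' : ContDiffOn ℝ ∞ (fderiv ℝ f) W := hf.fderiv_of_isOpen hW.isOpen (by simp)
    -- For `w ∈ ker t` the function `df(w)` satisfies the same hypotheses one order lower: `D a (df
    -- w) = d(D a f) w - df(dY a w) + f dl a(w)`, and the last two terms vanish to order `m` by the
    -- induction hypothesis for `f`.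
    have hker (w : G) (hw : t w = 0) : VanishesToOrder (m + 1) (fun z ↦ fderiv ℝ f z w) x := by
      have hfw : ContDiffOn ℝ ∞ (fun z ↦ fderiv ℝ f z w) W := hf'.clm_apply contDiffOn_const
      refine ih hfw (fun a ↦ ?_) fun j hj v ↦ ?_
      · have h1 : ContDiffOn ℝ ∞
            (fderiv ℝ (fun z ↦ fderiv ℝ f z (Y a z) - l a z * f z)) W :=
          (hW.contDiffOn_op hf a).fderiv_of_isOpen hW.isOpen (by simp)
        have h2 : ContDiffOn ℝ ∞ (fderiv ℝ (Y a)) W :=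
          (hW.smooth_Y a).fderiv_of_isOpen hW.isOpen (by simp)
        have h3 : ContDiffOn ℝ ∞ (fderiv ℝ (l a)) W :=
          (hW.smooth_l a).fderiv_of_isOpen hW.isOpen (by simp)
        let A : (G →L[ℝ] ℝ) →L[ℝ] G →L[ℝ] ℝ := ContinuousLinearMap.id ℝ _
        have e1 : VanishesToOrder m
            (fun z ↦ fderiv ℝ (fun z ↦ fderiv ℝ f z (Y a z) - l a z * f z) z w) x :=
          VanishesToOrder.bilinear (b := 0) A hW.isOpen hx h1 (contDiffOn_const (c := w))
            (hD a).fderiv (vanishesToOrder_zero _ _)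
        have e2 : VanishesToOrder m (fun z ↦ (-1 : ℝ) • fderiv ℝ f z (fderiv ℝ (Y a) z w)) x :=
          (VanishesToOrder.bilinear (b := 0) A hW.isOpen hx hf' (h2.clm_apply contDiffOn_const)
            hm.fderiv (vanishesToOrder_zero _ _)).const_smul hW.isOpen hx
            (hf'.clm_apply (h2.clm_apply contDiffOn_const)) _
        have e3 : VanishesToOrder m (fun z ↦ f z • fderiv ℝ (l a) z w) x :=
          (hm.mono (by omega)).smul_left hW.isOpen hx hf (h3.clm_apply contDiffOn_const)
        have h12 := e1.add hW.isOpen hx (h1.clm_apply contDiffOn_const)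
          ((hf'.clm_apply (h2.clm_apply contDiffOn_const)).const_smul _) e2
        refine (h12.add hW.isOpen hx ((h1.clm_apply contDiffOn_const).add
          ((hf'.clm_apply (h2.clm_apply contDiffOn_const)).const_smul _))
          (hf.smul (h3.clm_apply contDiffOn_const)) e3).congr ?_
        filter_upwards [hW.isOpen.mem_nhds hx] with z hz
        have hd : DifferentiableAt ℝ (fderiv ℝ f) z :=
          (hf'.contDiffAt (hW.isOpen.mem_nhds hz)).differentiableAt (by simp)
        rw [fderiv_firstOrder hW.isOpen hz (hW.smooth_Y a) (hW.smooth_l a) hf,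
          fderiv_clm_apply hd (differentiableAt_const w),
          isSymmSndFDerivAt_of_contDiffOn hW.isOpen hz hf w (Y a z)]
        simp
        ring
      · rw [iteratedFDeriv_fderiv_apply_const hW.isOpen hx hf, ← iteratedFDeriv_succ_snoc]
        convert h (j + 1) (by omega) (Fin.snoc v w) using 2
        funext i
        refine Fin.lastCases ?_ (fun i ↦ ?_) i
        · simp [hρ w hw]
        · simp
    intro j hj
    rcases Nat.lt_succ_iff_lt_or_eq.1 hj with hj | rfl
    · exact hm j hj
    ext v
    -- Split the last argument along the `Y a x` and `ker t`. On the first part the leading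
    -- derivative is that of `D a f`; on the second part `hker` applies.
    have hv : v (Fin.last m) = (v (Fin.last m) - ∑ a, t (v (Fin.last m)) a • Y a x) +
        ∑ a, t (v (Fin.last m)) a • Y a x := by abel
    have hw : t (v (Fin.last m) - ∑ a, t (v (Fin.last m)) a • Y a x) = 0 := by
      ext b
      simp [hW.t_Y x hx, Pi.single_apply]
    have hY (a : ι) : iteratedFDeriv ℝ m (fderiv ℝ f) x (Fin.init v) (Y a x) = 0 := by
      rw [← iteratedFDeriv_succ_snoc, ← hm.iteratedFDeriv_fderiv_apply hW.isOpen hx hf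
        (hW.smooth_Y a) (hW.smooth_l a), hD a m (by omega)]
      rfl
    rw [iteratedFDeriv_succ_apply_right, hv, map_add, map_sum,
      ← iteratedFDeriv_fderiv_apply_const hW.isOpen hx hf, hker _ hw m (by omega)]
    simp [hY]

theorem CommutingSystem.vanishesToOrder_of_compJet [Fintype ι] (hW : CommutingSystem W t Y l)
    {x : G} (hx : x ∈ W) {ρ : G →L[ℝ] G} (hρ : ∀ v, t v = 0 → ρ v = v) {m : ℕ} {f : G → ℝ}
    (hf : ContDiffOn ℝ ∞ f W)
    (hD : ∀ a, VanishesToOrder m (fun z ↦ fderiv ℝ f z (Y a z) - l a z * f z) x)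
    (h : compJet m ρ (jetAt m f x) = 0) : VanishesToOrder (m + 1) f x :=
  hW.vanishesToOrder_of_restriction hx hρ hf hD fun j hj v ↦
    congrArg (fun A ↦ A v) (congrFun h ⟨j, Nat.lt_succ_of_le hj⟩)

theorem CommutingSystem.injective_compJet [Fintype ι] (hW : CommutingSystem W t Y l)
    {x : G} (hx : x ∈ W) {ρ : G →L[ℝ] G} (hρ : ∀ v, t v = 0 → ρ v = v) {m : ℕ}
    {ξ η : JetModel G ℝ m} (hξ : ξ ∈ localSolutions hW m hx) (hη : η ∈ localSolutions hW m hx)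
    (h : compJet m ρ ξ = compJet m ρ η) : ξ = η := by
  rw [← sub_eq_zero]
  obtain ⟨f, hf, hfξ, hf'⟩ := Submodule.sub_mem _ hξ hη
  rw [← hfξ, jetAt_eq_zero_iff]
  refine hW.vanishesToOrder_of_compJet hx hρ hf hf' ?_
  rw [hfξ, map_sub, h, sub_self]

/-- Solve on `W ×ˢ W` with the base point `x` as a parameter and the operators acting on the second
variable `z`. Joint smoothness of the solution makes its jets at `z = x` depend smoothly on `x`. -/
theorem CommutingSystem.exists_parametric_solution [Fintype ι] (hW : CommutingSystem W t Y l)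
    {ρ : G →L[ℝ] G} (hρ : ∀ v, t (ρ v) = 0) (m : ℕ) {g : G → ℝ} (hg : ContDiff ℝ ∞ g) :
    ∃ σ : G → JetModel G ℝ m, ContDiffOn ℝ ∞ σ W ∧ ∀ x (hx : x ∈ W),
      σ x ∈ localSolutions hW m hx ∧ compJet m ρ (σ x) = compJet m ρ (jetAt m g 0) := by
  have hΩ : IsOpen (W ×ˢ W) := hW.isOpen.prod hW.isOpen
  have hdY {q : G × G} (hq : q ∈ W ×ˢ W) (a : ι) : DifferentiableAt ℝ (Y a) q.2 :=
    ((hW.smooth_Y a).contDiffAt (hW.isOpen.mem_nhds hq.2)).differentiableAt (by simp)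
  have hdl {q : G × G} (hq : q ∈ W ×ˢ W) (a : ι) : DifferentiableAt ℝ (l a) q.2 :=
    ((hW.smooth_l a).contDiffAt (hW.isOpen.mem_nhds hq.2)).differentiableAt (by simp)
  have hfl {q : G × G} (hq : q ∈ W ×ˢ W) (a : ι) (v : G × G) :
      fderiv ℝ (fun q : G × G ↦ l a q.2) q v = fderiv ℝ (l a) q.2 v.2 := by
    have : HasFDerivAt (fun q : G × G ↦ l a q.2) _ q :=
      (hdl hq a).hasFDerivAt.comp q hasFDerivAt_snd
    rw [this.fderiv]
    rfl
  have hfY {q : G × G} (hq : q ∈ W ×ˢ W) (a : ι) (v : G × G) :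
      fderiv ℝ (fun q : G × G ↦ ((0 : G), Y a q.2)) q v = (0, fderiv ℝ (Y a) q.2 v.2) := by
    have : HasFDerivAt (fun q : G × G ↦ ((0 : G), Y a q.2)) _ q :=
      (hasFDerivAt_const (0 : G) q).prodMk ((hdY hq a).hasFDerivAt.comp q hasFDerivAt_snd)
    rw [this.fderiv]
    rfl
  -- The functions `τ a = t (z - x) a` are dual to the `Y a` and vanish at `z = x`, so an error `τ a
  -- ^ m * h'` vanishes there to order `m`.
  let L : ι → G × G →L[ℝ] ℝ := fun a ↦ (ContinuousLinearMap.proj (R := ℝ)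
    (φ := fun _ : ι ↦ ℝ) a).comp
      (t.comp (ContinuousLinearMap.snd ℝ G G - ContinuousLinearMap.fst ℝ G G))
  have L_apply (a : ι) (q : G × G) : L a q = t (q.2 - q.1) a := rfl
  obtain ⟨H, h, h', hH, hh', hHg, hHD⟩ := exists_solution_mod hΩ
    (Y := fun a q ↦ ((0 : G), Y a q.2)) (l := fun a q ↦ l a q.2) (τ := fun a q ↦ L a q)
    (fun a ↦ contDiffOn_const.prodMk
      ((hW.smooth_Y a).comp contDiffOn_snd fun q hq ↦ hq.2)) 
    (fun a ↦ (hW.smooth_l a).comp contDiffOn_snd fun q hq ↦ hq.2)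
    (fun a ↦ (L a).contDiff.contDiffOn)
    (fun a b q hq ↦ by
      rw [(L b).fderiv, L_apply]
      simp only [sub_zero, hW.t_Y q.2 hq.2, Pi.single_apply, eq_comm])
    (fun a b q hq ↦ by
      rw [lieBracket, hfY hq, hfY hq, Prod.mk_sub_mk, sub_zero]
      exact congrArg _ (hW.bracket q.2 hq.2 a b))
    (fun a b q hq ↦ by
      rw [hfl hq, hfl hq]
      exact hW.compat q.2 hq.2 a b)
    m (g := fun q ↦ g (q.2 - q.1)) (hg.comp (contDiff_snd.sub contDiff_fst)).contDiffOn
  have hHx {x : G} (hx : x ∈ W) : ContDiffOn ℝ ∞ (fun z ↦ H (x, z)) W :=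
    hH.comp (contDiffOn_const.prodMk contDiffOn_id) fun z hz ↦ ⟨hx, hz⟩
  refine ⟨fun x ↦ jetAt m (fun z ↦ H (x, z)) x, ?_, fun x hx ↦ ⟨⟨_, hHx hx, rfl, fun a ↦ ?_⟩, ?_⟩⟩
  -- The derivatives in `z` are the total derivatives of `H` on the diagonal, restricted to the
  -- second factor.
  · refine contDiffOn_pi.2 fun j ↦ ?_
    have hj : ContDiffOn ℝ ∞ (fun x ↦ (iteratedFDeriv ℝ (j : ℕ) H (x, x)).compContinuousLinearMap
        fun _ ↦ ContinuousLinearMap.inr ℝ G G) W :=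
      (ContinuousMultilinearMap.compContinuousLinearMapL (𝕜 := ℝ) (F := ℝ)
        (fun _ : Fin (j : ℕ) ↦ ContinuousLinearMap.inr ℝ G G)).contDiff.comp_contDiffOn
        ((contDiffOn_iteratedFDeriv hΩ hH j).comp (contDiffOn_id.prodMk contDiffOn_id)
          fun z hz ↦ ⟨hz, hz⟩)
    refine hj.congr fun x hx ↦ ?_
    have := iteratedFDeriv_comp_affine hΩ hH (ContinuousLinearMap.inr ℝ G G) (x, 0) x
      (by simpa using hx) j
    change iteratedFDeriv ℝ (j : ℕ) (fun z ↦ H (x, z)) x = _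
    simpa using this
  · refine (VanishesToOrder.pow_mul (k := m) hW.isOpen hx (u := fun z ↦ L a (x, z))
      (h := fun z ↦ h' a (x, z))
      ((L a).contDiff.comp (contDiff_const.prodMk contDiff_id)).contDiffOn
      ((hh' a).comp (contDiffOn_const.prodMk contDiffOn_id) fun z hz ↦ ⟨hx, hz⟩)
      (by simp [L_apply])).congr ?_
    filter_upwards [hW.isOpen.mem_nhds hx] with z hz
    rw [← hHD a (x, z) ⟨hx, hz⟩]
    have : HasFDerivAt (fun z ↦ H (x, z)) _ z :=
      ((hH.contDiffAt (hΩ.mem_nhds ⟨hx, hz⟩)).differentiableAt (by simp)).hasFDerivAt.comp z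
        ((hasFDerivAt_const x z).prodMk (hasFDerivAt_id z))
    rw [this.fderiv]
    rfl
  · rw [compJet_jetAt hW.isOpen hx (hHx hx),
      compJet_jetAt isOpen_univ (mem_univ _) hg.contDiffOn]
    -- On `x + ker t` all `τ a` vanish, so `H (x, ·)` agrees with the prescribed data there.
    refine jetAt_congr ?_
    have : ∀ᶠ y in 𝓝 (0 : G), x + ρ y ∈ W :=
      ContinuousAt.eventually_mem (f := fun y ↦ x + ρ y) (by fun_prop)
        (hW.isOpen.mem_nhds (by simpa using hx))
    filter_upwards [this] with y hy
    rw [hHg (x, x + ρ y) ⟨hx, hy⟩]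
    simp [L_apply, hρ]

/-- Every jet along `ker t` extends to a formal solution. A cutoff and a translation turn `f` into
the global data `g`, centred at `0`, which can be used at all base points alike. -/
theorem CommutingSystem.exists_mem_localSolutions [Fintype ι] [FiniteDimensional ℝ G]
    (hW : CommutingSystem W t Y l)
    {ρ : G →L[ℝ] G} (hρ : ∀ v, t (ρ v) = 0) {m : ℕ} {f : G → ℝ} (hf : ContDiffOn ℝ ∞ f W)
    {x : G} (hx : x ∈ W) :
    ∃ η ∈ localSolutions hW m hx, compJet m ρ η = compJet m ρ (jetAt m f x) ∧
      ∃ g, ContDiff ℝ ∞ g ∧ compJet m ρ (jetAt m f x) = compJet m ρ (jetAt m g 0) := by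
  obtain ⟨f', hf', hff'⟩ := exists_contDiff_eventuallyEq hW.isOpen hx hf
  have hg : ContDiff ℝ ∞ fun z ↦ f' (x + z) := by fun_prop
  have h : compJet m ρ (jetAt m f x) = compJet m ρ (jetAt m (fun z ↦ f' (x + z)) 0) := by
    rw [jetAt_congr hff'.symm, compJet_jetAt isOpen_univ (mem_univ _) hf'.contDiffOn,
      compJet_jetAt isOpen_univ (mem_univ _) hg.contDiffOn]
    simp
  obtain ⟨σ, -, hσ⟩ := hW.exists_parametric_solution hρ m hg
  exact ⟨σ x, (hσ x hx).1, (hσ x hx).2.trans h.symm, _, hg, h⟩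

/-- If `f` represents `ξ`, take a formal solution of order `m + 1` with the same `(m + 1)`-jet as
`f` along `ker t`. Its truncation solves the system to order `m` and agrees with `ξ` along `ker t`,
hence equals `ξ` by uniqueness. -/
theorem CommutingSystem.surjOn_truncateJet [Fintype ι] [FiniteDimensional ℝ G]
    (hW : CommutingSystem W t Y l) (m : ℕ) {x : G} (hx : x ∈ W) :
    SurjOn (truncateJet m) (localSolutions hW (m + 1) hx : Set (JetModel G ℝ (m + 1)))
      (localSolutions hW m hx : Set (JetModel G ℝ m)) := by
  rintro ξ hξ
  obtain ⟨f, hf, rfl, hf'⟩ := id hξ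
  obtain ⟨ρ, hρ, hρ'⟩ := hW.exists_proj hx
  obtain ⟨η, hη, hηf, -⟩ := hW.exists_mem_localSolutions hρ (m := m + 1) hf hx
  refine ⟨η, hη, hW.injective_compJet hx hρ' ?_ hξ ?_⟩
  · obtain ⟨g, hg, rfl, hg'⟩ := hη
    exact ⟨g, hg, rfl, fun a ↦ (hg' a).mono (by omega)⟩
  · exact congrArg (truncateJet m) hηf

instance {m : ℕ} [FiniteDimensional ℝ G] : FiniteDimensional ℝ (JetModel G ℝ m) := by
  have (j : Fin (m + 1)) : FiniteDimensional ℝ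
      (ContinuousMultilinearMap ℝ (fun _ : Fin (j : ℕ) ↦ G) ℝ) :=
    Module.Finite.of_injective
      (ContinuousMultilinearMap.toMultilinearMapLinear (R' := ℝ) (A := ℝ)
        (M₁ := fun _ : Fin (j : ℕ) ↦ G) (M₂ := ℝ))
      ContinuousMultilinearMap.toMultilinearMap_injective
  infer_instance

/-- Jets along `ker t` form one space for all base points, because `t` and hence `ρ` are constant. A
basis of it extends to smooth families of formal solutions; these are independent since their
restrictions are, and they span by uniqueness. -/
theorem CommutingSystem.exists_frame [Fintype ι] [FiniteDimensional ℝ G]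
    (hW : CommutingSystem W t Y l) (hne : W.Nonempty) (m : ℕ) :
    ∃ (r : ℕ) (σ : Fin r → G → JetModel G ℝ m), (∀ i, ContDiffOn ℝ ∞ (σ i) W) ∧
      ∀ x (hx : x ∈ W), (LinearIndependent ℝ fun i ↦ σ i x) ∧
        Submodule.span ℝ (range fun i ↦ σ i x) = localSolutions hW m hx := by
  obtain ⟨x₀, hx₀⟩ := hne
  obtain ⟨ρ, hρ, hρ'⟩ := hW.exists_proj hx₀
  obtain ⟨b, hb, hspan, hind⟩ := exists_linearIndependent ℝ
    {ξ : JetModel G ℝ m | ∃ g, ContDiff ℝ ∞ g ∧ compJet m ρ (jetAt m g 0) = ξ}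
  have : Finite b := hind.finite
  obtain ⟨r, ⟨e⟩⟩ := Finite.exists_equiv_fin b
  choose! g hg hgb using hb
  choose σ hσ hσ' using fun i : Fin r ↦
    hW.exists_parametric_solution hρ m (hg (e.symm i).2)
  have hcomp (i : Fin r) (x : G) (hx : x ∈ W) : compJet m ρ (σ i x) = e.symm i := by
    rw [(hσ' i x hx).2, hgb (e.symm i).2]
  refine ⟨r, σ, hσ, fun x hx ↦ ⟨?_, ?_⟩⟩
  · refine LinearIndependent.of_comp (compJet m ρ) ?_
    have : (compJet m ρ ∘ fun i ↦ σ i x) = (fun y : b ↦ (y : JetModel G ℝ m)) ∘ e.symm :=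
      funext fun i ↦ hcomp i x hx
    rw [this]
    exact hind.comp _ e.symm.injective
  · refine le_antisymm (Submodule.span_le.2 ?_) fun ξ hξ ↦ ?_
    · rintro _ ⟨i, rfl⟩
      exact (hσ' i x hx).1
    · obtain ⟨f, hf, rfl, hf'⟩ := id hξ
      obtain ⟨-, -, -, g', hg', hfg⟩ := hW.exists_mem_localSolutions hρ (m := m) hf hx
      have hmem : compJet m ρ (jetAt m f x) ∈ Submodule.span ℝ b := by
        rw [hspan]
        exact Submodule.subset_span ⟨g', hg', hfg.symm⟩
      have hb' : b = range fun i ↦ compJet m ρ (σ i x) := by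
        rw [show (fun i ↦ compJet m ρ (σ i x)) = (fun y : b ↦ (y : JetModel G ℝ m)) ∘ e.symm from
          funext fun i ↦ hcomp i x hx, e.symm.surjective.range_comp, Subtype.range_coe]
      rw [hb', Submodule.mem_span_range_iff_exists_fun] at hmem
      obtain ⟨c, hc⟩ := hmem
      rw [Submodule.mem_span_range_iff_exists_fun]
      refine ⟨c, hW.injective_compJet hx hρ' ?_ hξ ?_⟩
      · exact Submodule.sum_mem _ fun i _ ↦ Submodule.smul_mem _ _ (hσ' i x hx).1
      · rw [← hc, map_sum]
        simp only [map_smul]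

end LocalSolutions

end SprayPDE

namespace SprayPDE

/-! ### Quasi-regular bases -/

section QuasiRegular

variable {G : Type*} [NormedAddCommGroup G] [NormedSpace ℝ G] [FiniteDimensional ℝ G]

/-- `Set.finrank` is the dimension of the span, so the set is first recognised as a subspace `K`.
Evaluation at the basis vectors outside `S` then identifies `K` with a coordinate space. -/
theorem finrank_annihilator {d : ℕ} (e : Module.Basis (Fin d) ℝ G) (S : Finset (Fin d)) :
    Set.finrank ℝ {A : ContinuousMultilinearMap ℝ (fun _ : Fin (1 + 0) ↦ G) ℝ |
      ∀ i ∈ S, A (fun _ ↦ e i) = 0} = Sᶜ.card := by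
  let K : Submodule ℝ (ContinuousMultilinearMap ℝ (fun _ : Fin (1 + 0) ↦ G) ℝ) :=
    { carrier := {A | ∀ i ∈ S, A (fun _ ↦ e i) = 0}
      zero_mem' := fun _ _ ↦ rfl
      add_mem' := fun {A B} hA hB i hi ↦ by
        rw [add_apply, hA i hi, hB i hi, add_zero]
      smul_mem' := fun c A hA i hi ↦ by
        rw [smul_apply, hA i hi, smul_zero] }
  let Φ : K →ₗ[ℝ] ((Sᶜ : Finset (Fin d)) → ℝ) :=
    { toFun := fun A i ↦ A.1 (fun _ ↦ e i)
      map_add' := fun _ _ ↦ rfl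
      map_smul' := fun _ _ ↦ rfl }
  have hΦ : Function.Bijective Φ := by
    constructor
    · intro A B hAB
      ext1
      refine ContinuousMultilinearMap.toMultilinearMap_injective
        (Module.Basis.ext_multilinear (fun _ ↦ e) fun v ↦ ?_)
      have hv : (fun i ↦ e (v i)) = fun _ ↦ e (v 0) := funext fun i ↦ by
        rw [show i = 0 from Fin.ext (by omega)]
      change A.1 (fun i ↦ e (v i)) = B.1 (fun i ↦ e (v i))
      rw [hv]
      by_cases h : v 0 ∈ S
      · exact (A.2 _ h).trans (B.2 _ h).symm
      · exact congrFun hAB ⟨v 0, Finset.mem_compl.2 h⟩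
    · intro c
      let A : ContinuousMultilinearMap ℝ (fun _ : Fin (1 + 0) ↦ G) ℝ := ∑ i : (Sᶜ : Finset (Fin d)),
        c i • (ContinuousMultilinearMap.mkPiAlgebra ℝ (Fin (1 + 0)) ℝ).compContinuousLinearMap
          fun _ ↦ LinearMap.toContinuousLinearMap (e.coord i)
      have hA (j : Fin d) : A (fun _ ↦ e j) = ∑ i : (Sᶜ : Finset (Fin d)),
          c i * if j = i then 1 else 0 := by
        simp [A, Finsupp.single_apply]
      refine ⟨⟨A, fun i hi ↦ ?_⟩, funext fun j ↦ ?_⟩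
      · rw [hA, Finset.sum_eq_zero]
        rintro ⟨j, hj⟩ -
        rw [if_neg, mul_zero]
        rintro rfl
        exact Finset.mem_compl.1 hj hi
      · change A (fun _ ↦ e j) = c j
        simp [hA]
  have hK : Set.finrank ℝ (K : Set (ContinuousMultilinearMap ℝ (fun _ : Fin (1 + 0) ↦ G) ℝ)) =
      Module.finrank ℝ K := by
    rw [Set.finrank, Submodule.span_eq]
  refine hK.trans ?_
  rw [(LinearEquiv.ofBijective Φ hΦ).finrank_eq, Module.finrank_fintype_fun_eq_card,
    Fintype.card_coe]

/-- Such a form is given freely by its values on unordered pairs, with repetition, of basis vectors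
outside `S`. -/
theorem finrank_symmetric_annihilator {d : ℕ} (e : Module.Basis (Fin d) ℝ G) (S : Finset (Fin d)) :
    Set.finrank ℝ {A : ContinuousMultilinearMap ℝ (fun _ : Fin (1 + 1) ↦ G) ℝ |
      (∀ v w, A ![v, w] = A ![w, v]) ∧ ∀ i ∈ S, ∀ v, A ![v, e i] = 0} =
        (Sᶜ.card + 1).choose 2 := by
  let K : Submodule ℝ (ContinuousMultilinearMap ℝ (fun _ : Fin (1 + 1) ↦ G) ℝ) :=
    { carrier := {A | (∀ v w, A ![v, w] = A ![w, v]) ∧ ∀ i ∈ S, ∀ v, A ![v, e i] = 0}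
      zero_mem' := ⟨fun _ _ ↦ rfl, fun _ _ _ ↦ rfl⟩
      add_mem' := fun {A B} hA hB ↦ ⟨fun v w ↦ by
        rw [add_apply, hA.1, hB.1, add_apply],
        fun i hi v ↦ by
        rw [add_apply, hA.2 i hi, hB.2 i hi, add_zero]⟩
      smul_mem' := fun c A hA ↦ ⟨fun v w ↦ by
        rw [smul_apply, hA.1, smul_apply],
        fun i hi v ↦ by
        rw [smul_apply, hA.2 i hi, smul_zero]⟩ }
  let Φ : K →ₗ[ℝ] (Sym2 (Sᶜ : Finset (Fin d)) → ℝ) :=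
    { toFun := fun A ↦ Sym2.lift ⟨fun i j ↦ A.1 ![e i, e j], fun i j ↦ A.2.1 _ _⟩
      map_add' := fun A B ↦ funext fun p ↦ by
        induction p with | _ i j => rfl
      map_smul' := fun c A ↦ funext fun p ↦ by
        induction p with | _ i j => rfl }
  have Φ_apply (A : K) (i j : (Sᶜ : Finset (Fin d))) : Φ A s(i, j) = A.1 ![e i, e j] := rfl
  have hΦ : Function.Bijective Φ := by
    constructor
    · intro A B hAB
      ext1
      refine ContinuousMultilinearMap.toMultilinearMap_injective
        (Module.Basis.ext_multilinear (fun _ ↦ e) fun v ↦ ?_)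
      have hv : (fun i ↦ e (v i)) = ![e (v 0), e (v 1)] := funext fun i ↦ by
        fin_cases i <;> rfl
      change A.1 (fun i ↦ e (v i)) = B.1 (fun i ↦ e (v i))
      rw [hv]
      by_cases h1 : v 1 ∈ S
      · exact (A.2.2 _ h1 _).trans (B.2.2 _ h1 _).symm
      by_cases h0 : v 0 ∈ S
      · rw [A.2.1, B.2.1]
        exact (A.2.2 _ h0 _).trans (B.2.2 _ h0 _).symm
      · exact congrFun hAB s(⟨v 0, Finset.mem_compl.2 h0⟩, ⟨v 1, Finset.mem_compl.2 h1⟩)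
    · intro c
      let B (i j : Fin d) : ContinuousMultilinearMap ℝ (fun _ : Fin (1 + 1) ↦ G) ℝ :=
        (ContinuousMultilinearMap.mkPiAlgebra ℝ (Fin (1 + 1)) ℝ).compContinuousLinearMap
          ![LinearMap.toContinuousLinearMap (e.coord i), LinearMap.toContinuousLinearMap (e.coord j)]
      have hB (i j : Fin d) (v w : G) : B i j ![v, w] = e.coord i v * e.coord j w := by
        simp [B, Fin.prod_univ_two]
      let A : ContinuousMultilinearMap ℝ (fun _ : Fin (1 + 1) ↦ G) ℝ :=
        ∑ i : (Sᶜ : Finset (Fin d)), ∑ j : (Sᶜ : Finset (Fin d)), c s(i, j) • B i j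
      have hA (v w : G) : A ![v, w] = ∑ i : (Sᶜ : Finset (Fin d)), ∑ j : (Sᶜ : Finset (Fin d)),
          c s(i, j) * (e.coord i v * e.coord j w) := by
        simp only [A, sum_apply, smul_apply, hB,
          smul_eq_mul]
      refine ⟨⟨A, fun v w ↦ ?_, fun k hk v ↦ ?_⟩, funext fun p ↦ ?_⟩
      · rw [hA, hA, Finset.sum_comm]
        refine Finset.sum_congr rfl fun i _ ↦ Finset.sum_congr rfl fun j _ ↦ ?_
        rw [Sym2.eq_swap, mul_comm (e.coord _ v)]
      · rw [hA]
        refine Finset.sum_eq_zero fun i _ ↦ Finset.sum_eq_zero fun j _ ↦ ?_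
        have : k ≠ j := by
          rintro rfl
          exact Finset.mem_compl.1 j.2 hk
        simp [this]
      · induction p with | _ i j =>
        rw [Φ_apply]
        change A ![e i, e j] = _
        rw [hA]
        simp [Finsupp.single_apply]
  have hK : Set.finrank ℝ (K : Set (ContinuousMultilinearMap ℝ (fun _ : Fin (1 + 1) ↦ G) ℝ)) =
      Module.finrank ℝ K := by
    rw [Set.finrank, Submodule.span_eq]
  refine hK.trans ?_
  rw [(LinearEquiv.ofBijective Φ hΦ).finrank_eq, Module.finrank_fintype_fun_eq_card,
    Sym2.card, Fintype.card_coe]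

/-- A basis of a complement comes first and the `y a` come last. The order matters: the leading
vectors of a quasi-regular basis must cut down the annihilator of the `y a` as fast as possible. -/
theorem exists_adapted_basis {ι : Type*} [Fintype ι] {y : ι → G} (hy : LinearIndependent ℝ y) :
    ∃ (e : Module.Basis (Fin (Module.finrank ℝ G)) ℝ G) (m : ℕ), m ≤ Module.finrank ℝ G ∧
      (∀ i : Fin (Module.finrank ℝ G), m ≤ i → e i ∈ range y) ∧
      ∀ a, ∃ i : Fin (Module.finrank ℝ G), m ≤ i ∧ e i = y a := by
  obtain ⟨D', hD'⟩ := Submodule.exists_isCompl (Submodule.span ℝ (range y))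
  let b : Module.Basis (Fin (Module.finrank ℝ D') ⊕ ι) ℝ G :=
    ((Module.finBasis ℝ D').prod (Module.Basis.span hy)).map
      (Submodule.prodEquivOfIsCompl D' _ hD'.symm)
  have hb (a : ι) : b (Sum.inr a) = y a := by
    simp [b, Module.Basis.span_apply]
  have hcard : Module.finrank ℝ D' + Fintype.card ι = Module.finrank ℝ G := by
    rw [Module.finrank_eq_card_basis b, Fintype.card_sum, Fintype.card_fin]
  let σ : Fin (Module.finrank ℝ D') ⊕ ι ≃ Fin (Module.finrank ℝ G) :=
    ((Equiv.sumCongr (Equiv.refl _) (Fintype.equivFin ι)).trans finSumFinEquiv).trans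
      (finCongr hcard)
  have hσ (a : ι) : Module.finrank ℝ D' ≤ (σ (Sum.inr a) : ℕ) := by
    simp [σ]
  refine ⟨b.reindex σ, Module.finrank ℝ D', by omega, fun i hi ↦ ?_, fun a ↦ ⟨σ (Sum.inr a), hσ a, ?_⟩⟩
  · obtain ⟨k | a, rfl⟩ := σ.surjective i
    · have : (σ (Sum.inl k) : ℕ) = k := by simp [σ]
      omega
    · exact ⟨a, by simp [hb]⟩
  · simp [hb]

/-- The sum is `(m - 1) + ⋯ + 1 + 0`; truncated subtraction makes the terms with `j ≥ m` vanish, so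
it may run up to `d`. -/
theorem sum_Icc_tsub_add (m d : ℕ) (h : m ≤ d) :
    (m + 1).choose 2 = m + ∑ j ∈ Finset.Icc 1 d, (m - j) := by
  have key : ∀ m d, m ≤ d → ∑ i ∈ Finset.range d, (m - (i + 1)) = m.choose 2 := by
    intro m
    induction m with
    | zero => simp
    | succ m ih =>
      intro d hd
      obtain ⟨d, rfl⟩ : ∃ d', d = d' + 1 := ⟨d - 1, by omega⟩
      rw [Finset.sum_range_succ', Nat.choose_succ_succ, Nat.choose_one_right, ← ih d (by omega),
        add_comm]
      congr 1
      exact Finset.sum_congr rfl fun i _ ↦ by omega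
  have h1 : ∑ j ∈ Finset.Icc 1 d, (m - j) = ∑ i ∈ Finset.range d, (m - (i + 1)) := by
    rw [Finset.range_eq_Ico, Finset.sum_Ico_add' (fun j ↦ m - j) 0 d 1]
    rfl
  rw [Nat.choose_succ_succ, Nat.choose_one_right, h1, key m d h]

/-- Let `m` be the codimension of the span of the `y a`. In an adapted basis, the forms annihilating
the `y a` and the first `j` basis vectors have dimension `m - j`, while the symmetric bilinear forms
annihilating the `y a` have dimension `m (m + 1) / 2`. -/
theorem exists_quasiRegular_basis {ι : Type*} [Fintype ι] {y : ι → G}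
    (hy : LinearIndependent ℝ y) :
    ∃ e : Module.Basis (Fin (Module.finrank ℝ G)) ℝ G,
      Set.finrank ℝ {A : ContinuousMultilinearMap ℝ (fun _ : Fin (1 + 1) ↦ G) ℝ |
          (∀ v w, A ![v, w] = A ![w, v]) ∧ ∀ a v, A ![v, y a] = 0} =
        Set.finrank ℝ {A : ContinuousMultilinearMap ℝ (fun _ : Fin (1 + 0) ↦ G) ℝ |
          ∀ a, A (fun _ ↦ y a) = 0} +
        ∑ j ∈ Finset.Icc 1 (Module.finrank ℝ G),
          Set.finrank ℝ {A : ContinuousMultilinearMap ℝ (fun _ : Fin (1 + 0) ↦ G) ℝ |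
            (∀ a, A (fun _ ↦ y a) = 0) ∧ ∀ i : Fin (Module.finrank ℝ G), (i : ℕ) < j →
              A (fun _ ↦ e i) = 0} := by
  obtain ⟨e, m, hm, hey, hye⟩ := exists_adapted_basis hy
  refine ⟨e, ?_⟩
  have hall {p : G → Prop} : (∀ a, p (y a)) ↔
      ∀ i : Fin (Module.finrank ℝ G), m ≤ i → p (e i) := by
    refine ⟨fun h i hi ↦ ?_, fun h a ↦ ?_⟩
    · obtain ⟨a, ha⟩ := hey i hi
      exact ha ▸ h a
    · obtain ⟨i, hi, ha⟩ := hye a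
      exact ha ▸ h i hi
  -- The basis vectors not annihilated are those with index in `[j, m)`.
  have hcard (j : ℕ) : (Finset.univ.filter fun i : Fin (Module.finrank ℝ G) ↦
      m ≤ (i : ℕ) ∨ (i : ℕ) < j)ᶜ.card = m - j := by
    rw [← Finset.card_map Fin.valEmbedding, ← Nat.card_Ico]
    congr 1
    ext k
    simp only [Finset.mem_map, Finset.mem_compl, Finset.mem_filter, Finset.mem_univ, true_and,
      not_or, not_le, not_lt, Fin.valEmbedding_apply, Finset.mem_Ico]
    constructor
    · rintro ⟨i, hi, rfl⟩
      exact hi.symm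
    · exact fun hk ↦ ⟨⟨k, by omega⟩, hk.symm, rfl⟩
  have h2 := finrank_symmetric_annihilator e
    (Finset.univ.filter fun i : Fin (Module.finrank ℝ G) ↦ m ≤ (i : ℕ) ∨ (i : ℕ) < 0)
  have h1 (j : ℕ) := finrank_annihilator e
    (Finset.univ.filter fun i : Fin (Module.finrank ℝ G) ↦ m ≤ (i : ℕ) ∨ (i : ℕ) < j)
  have e2 : {A : ContinuousMultilinearMap ℝ (fun _ : Fin (1 + 1) ↦ G) ℝ |
      (∀ v w, A ![v, w] = A ![w, v]) ∧ ∀ a v, A ![v, y a] = 0} =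
      {A | (∀ v w, A ![v, w] = A ![w, v]) ∧ ∀ i ∈ Finset.univ.filter
        (fun i : Fin (Module.finrank ℝ G) ↦ m ≤ (i : ℕ) ∨ (i : ℕ) < 0), ∀ v, A ![v, e i] = 0} := by
    ext A
    simp [hall (p := fun u ↦ ∀ v, A ![v, u] = 0)]
  have e1 (j : ℕ) : {A : ContinuousMultilinearMap ℝ (fun _ : Fin (1 + 0) ↦ G) ℝ |
      (∀ a, A (fun _ ↦ y a) = 0) ∧ ∀ i : Fin (Module.finrank ℝ G), (i : ℕ) < j →
        A (fun _ ↦ e i) = 0} = {A | ∀ i ∈ Finset.univ.filter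
        (fun i : Fin (Module.finrank ℝ G) ↦ m ≤ (i : ℕ) ∨ (i : ℕ) < j), A (fun _ ↦ e i) = 0} := by
    ext A
    simp only [mem_ofPred_eq, hall (p := fun u ↦ A (fun _ ↦ u) = 0), Finset.mem_filter,
      Finset.mem_univ, true_and, or_imp, forall_and]
  have e0 : {A : ContinuousMultilinearMap ℝ (fun _ : Fin (1 + 0) ↦ G) ℝ |
      ∀ a, A (fun _ ↦ y a) = 0} = {A | (∀ a, A (fun _ ↦ y a) = 0) ∧
        ∀ i : Fin (Module.finrank ℝ G), (i : ℕ) < 0 → A (fun _ ↦ e i) = 0} := by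
    ext A
    simp
  rw [e2, h2, e0, e1, h1, hcard, Nat.sub_zero, sum_Icc_tsub_add m _ hm]
  congr 1
  exact Finset.sum_congr rfl fun j _ ↦ by rw [e1, h1, hcard]

end QuasiRegular

end SprayPDE

namespace SprayPDE

/-! ### Symbols of commuting systems and of equivalent operators -/

section Symbol

variable {G : Type*} [NormedAddCommGroup G] [NormedSpace ℝ G]

/-- By homogeneity: replacing `z` by `2 z` multiplies the function by `2 ^ n` but its derivative of
order `j` at `0` by `2 ^ j`, and these factors differ for `j < n`. -/
theorem vanishesToOrder_diagonal {n : ℕ} (A : ContinuousMultilinearMap ℝ (fun _ : Fin n ↦ G) ℝ) :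
    VanishesToOrder n (fun z ↦ A fun _ ↦ z) 0 := by
  intro j hj
  have hA : ContDiff ℝ ∞ fun z ↦ A fun _ ↦ z := A.contDiff.comp (contDiff_pi.2 fun _ ↦ contDiff_id)
  have h1 := iteratedFDeriv_comp_affine isOpen_univ hA.contDiffOn
    ((2 : ℝ) • ContinuousLinearMap.id ℝ G) 0 0 (mem_univ _) j
  have h2 : (fun y ↦ A fun _ ↦ 0 + ((2 : ℝ) • ContinuousLinearMap.id ℝ G) y) =
      fun y ↦ (2 : ℝ) ^ n • A fun _ ↦ y := by
    funext y
    simpa using A.map_smul_univ (fun _ ↦ 2) (fun _ ↦ y)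
  have h3 := iteratedFDeriv_const_smul_apply (𝕜 := ℝ) (i := j) (x := (0 : G)) (a := (2 : ℝ) ^ n)
    (hA.contDiffAt.of_le (by exact_mod_cast le_top))
  change iteratedFDeriv ℝ j (fun y ↦ (2 : ℝ) ^ n • A fun _ ↦ y) 0 = _ at h3
  rw [h2, h3] at h1
  ext v
  have h4 := congrArg (fun B ↦ B v) h1
  have h5 := (iteratedFDeriv ℝ j (fun z ↦ A fun _ ↦ z) 0).map_smul_univ (fun _ ↦ (2 : ℝ)) v
  simp only [Finset.prod_const, Finset.card_univ, Fintype.card_fin] at h5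
  simp only [map_zero, add_zero, ContinuousMultilinearMap.compContinuousLinearMap_apply,
    smul_apply, ContinuousLinearMap.id_apply, h5, smul_eq_mul] at h4
  have h6 : (2 : ℝ) ^ n ≠ 2 ^ j := by
    have := pow_lt_pow_right₀ (one_lt_two (α := ℝ)) hj
    exact this.ne'
  have h7 : ((2 : ℝ) ^ n - 2 ^ j) * iteratedFDeriv ℝ j (fun z ↦ A fun _ ↦ z) 0 v = 0 := by
    linarith
  exact (mul_eq_zero.1 h7).resolve_left (sub_ne_zero.2 h6)

/-- A symmetric multilinear form is the leading derivative of a smooth function. -/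
theorem exists_contDiff_iteratedFDeriv_eq {n : ℕ}
    (A : ContinuousMultilinearMap ℝ (fun _ : Fin n ↦ G) ℝ)
    (hA : ∀ (σ : Equiv.Perm (Fin n)) v, A (fun i ↦ v (σ i)) = A v) (x : G) :
    ∃ f : G → ℝ, ContDiff ℝ ∞ f ∧ VanishesToOrder n f x ∧ iteratedFDeriv ℝ n f x = A := by
  -- The derivative of order `n` of the diagonal sums over all `n!` permutations of the arguments.
  let B := ((n.factorial : ℝ)⁻¹) • A
  have hB : ContDiff ℝ ∞ fun z ↦ B fun _ ↦ z := B.contDiff.comp (contDiff_pi.2 fun _ ↦ contDiff_id)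
  refine ⟨fun z ↦ B fun _ ↦ z - x, hB.comp (contDiff_id.sub contDiff_const), fun j hj ↦ ?_, ?_⟩
  · rw [iteratedFDeriv_comp_sub (f := fun z ↦ B fun _ ↦ z), sub_self]
    exact vanishesToOrder_diagonal B j hj
  · rw [iteratedFDeriv_comp_sub (f := fun z ↦ B fun _ ↦ z)]
    ext v
    rw [ContinuousMultilinearMap.iteratedFDeriv_comp_diagonal]
    simp only [B, smul_apply, hA, Finset.sum_const, Finset.card_univ, Fintype.card_perm,
      Fintype.card_fin, smul_eq_mul, nsmul_eq_mul]
    field_simp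

variable {ι : Type*} [DecidableEq ι] {W : Set G} {t : G →L[ℝ] (ι → ℝ)} {Y : ι → G → G}
  {l : ι → G → ℝ}

theorem VanishesToOrder.op {k : ℕ} {f : G → ℝ} {x : G} (hW : CommutingSystem W t Y l) (hx : x ∈ W)
    (hf : ContDiffOn ℝ ∞ f W) (h : VanishesToOrder (k + 1) f x) (a : ι) :
    VanishesToOrder k (fun z ↦ _root_.fderiv ℝ f z (Y a z) - l a z * f z) x := by
  intro j hj
  ext v
  rw [(h.mono (by omega)).iteratedFDeriv_fderiv_apply hW.isOpen hx hf (hW.smooth_Y a)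
    (hW.smooth_l a), h (j + 1) (by omega)]
  rfl

/-- If `f x = 0`, then `D a f` has at `x` the value `df(Y a x)`, the zeroth order term dropping out.
Conversely every linear form is the differential of a smooth function vanishing at `x`. -/
theorem CommutingSystem.symbol_zero (hW : CommutingSystem W t Y l) {x : G} (hx : x ∈ W) :
    {A : ContinuousMultilinearMap ℝ (fun _ : Fin (1 + 0) ↦ G) ℝ | ∃ f, ContDiffOn ℝ ∞ f W ∧
      VanishesToOrder (1 + 0) f x ∧ iteratedFDeriv ℝ (1 + 0) f x = A ∧
      ∀ a, VanishesToOrder (0 + 1) (fun z ↦ fderiv ℝ f z (Y a z) - l a z * f z) x} =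
    {A | ∀ a, A (fun _ ↦ Y a x) = 0} := by
  have key (f : G → ℝ) (hf : ContDiffOn ℝ ∞ f W) (hfx : VanishesToOrder (0 + 1) f x) (a : ι) :
      VanishesToOrder (0 + 1) (fun z ↦ fderiv ℝ f z (Y a z) - l a z * f z) x ↔
        iteratedFDeriv ℝ (0 + 1) f x (fun _ ↦ Y a x) = 0 := by
    have h1 := hfx.iteratedFDeriv_fderiv_apply hW.isOpen hx hf (hW.smooth_Y a) (hW.smooth_l a)
      (fun _ ↦ 0)
    have h2 : (Fin.snoc (fun _ ↦ 0) (Y a x) : Fin (0 + 1) → G) = fun _ ↦ Y a x := by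
      funext i
      rw [show i = Fin.last 0 from Fin.ext (by omega)]
      exact Fin.snoc_last (α := fun _ ↦ G) _ _
    rw [h2] at h1
    rw [← h1, zero_add, vanishesToOrder_one, iteratedFDeriv_zero_apply]
  ext A
  constructor
  · rintro ⟨f, hf, hfx, rfl, hD⟩ a
    exact (key f hf hfx a).1 (hD a)
  · intro hA
    obtain ⟨f, hf, hfx, rfl⟩ := exists_contDiff_iteratedFDeriv_eq A (fun σ v ↦ by
      congr 1
      funext i
      congr 1
      exact Fin.ext (by omega)) x
    exact ⟨f, hf.contDiffOn, hfx, rfl, fun a ↦ (key f hf.contDiffOn hfx a).2 (hA a)⟩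

theorem iteratedFDeriv_two_swap {f : G → ℝ} {x : G} (hWo : IsOpen W) (hx : x ∈ W)
    (hf : ContDiffOn ℝ ∞ f W) (v w : G) :
    iteratedFDeriv ℝ (1 + 1) f x ![v, w] = iteratedFDeriv ℝ (1 + 1) f x ![w, v] := by
  have := isSymmSndFDerivAt_of_contDiffOn hWo hx hf v w
  simpa [iteratedFDeriv_two_apply] using this

/-- If the `1`-jet of `f` vanishes, the differential of `D a f` at `x` is the second derivative of
`f` with `Y a x` inserted. Symmetry is the only other constraint on a second derivative, and a
symmetric form is realised by a polynomial. -/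
theorem CommutingSystem.symbol_one (hW : CommutingSystem W t Y l) {x : G} (hx : x ∈ W) :
    {A : ContinuousMultilinearMap ℝ (fun _ : Fin (1 + 1) ↦ G) ℝ | ∃ f, ContDiffOn ℝ ∞ f W ∧
      VanishesToOrder (1 + 1) f x ∧ iteratedFDeriv ℝ (1 + 1) f x = A ∧
      ∀ a, VanishesToOrder (1 + 1) (fun z ↦ fderiv ℝ f z (Y a z) - l a z * f z) x} =
    {A | (∀ v w, A ![v, w] = A ![w, v]) ∧ ∀ a v, A ![v, Y a x] = 0} := by
  have key (f : G → ℝ) (hf : ContDiffOn ℝ ∞ f W) (hfx : VanishesToOrder (1 + 1) f x) (a : ι) :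
      VanishesToOrder (1 + 1) (fun z ↦ fderiv ℝ f z (Y a z) - l a z * f z) x ↔
        ∀ v, iteratedFDeriv ℝ (1 + 1) f x ![v, Y a x] = 0 := by
    have h1 (v : Fin 1 → G) :=
      hfx.iteratedFDeriv_fderiv_apply hW.isOpen hx hf (hW.smooth_Y a) (hW.smooth_l a) v
    have h2 (v : Fin 1 → G) : (Fin.snoc v (Y a x) : Fin (1 + 1) → G) = ![v 0, Y a x] := by
      funext i
      fin_cases i <;> rfl
    have h3 := hfx.op hW hx hf a
    constructor
    · intro h v
      have := h1 fun _ ↦ v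
      rw [h2, h 1 (by omega)] at this
      exact this.symm
    · intro h j hj
      rcases Nat.lt_succ_iff_lt_or_eq.1 hj with hj | rfl
      · exact h3 j hj
      · ext v
        rw [h1, h2, h]
        rfl
  ext A
  constructor
  · rintro ⟨f, hf, hfx, rfl, hD⟩
    exact ⟨iteratedFDeriv_two_swap hW.isOpen hx hf, fun a ↦ (key f hf hfx a).1 (hD a)⟩
  · rintro ⟨hsymm, hA⟩
    obtain ⟨f, hf, hfx, rfl⟩ := exists_contDiff_iteratedFDeriv_eq A (fun σ v ↦ by
      have h2 (v : Fin (1 + 1) → G) : v = ![v 0, v 1] := by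
        funext i
        fin_cases i <;> rfl
      have hσ : ∀ σ : Equiv.Perm (Fin (1 + 1)), σ 0 = 0 ∧ σ 1 = 1 ∨ σ 0 = 1 ∧ σ 1 = 0 := by
        decide
      rw [h2 fun i ↦ v (σ i)]
      conv_rhs => rw [h2 v]
      rcases hσ σ with ⟨h0, h1⟩ | ⟨h0, h1⟩
      · rw [h0, h1]
      · rw [h0, h1, hsymm]) x
    exact ⟨f, hf.contDiffOn, hfx, rfl, fun a ↦ (key f hf.contDiffOn hfx a).2 (hA a)⟩

/-- An operator which is equivalent to a commuting system over the smooth functions. -/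
theorem CommutingSystem.vanishesToOrder_iff [Fintype ι] {F : Type*} [NormedAddCommGroup F]
    [NormedSpace ℝ F] (hW : CommutingSystem W t Y l) {x : G} (hx : x ∈ W) {f : G → ℝ}
    (hf : ContDiffOn ℝ ∞ f W) {Pf : G → F} {q : ι → G → F} {L : ι → G → F →L[ℝ] ℝ}
    (hq : ∀ a, ContDiffOn ℝ ∞ (q a) W) (hL : ∀ a, ContDiffOn ℝ ∞ (L a) W)
    (hPq : ∀ z ∈ W, Pf z = ∑ a, (fderiv ℝ f z (Y a z) - l a z * f z) • q a z)
    (hPL : ∀ z ∈ W, ∀ a, fderiv ℝ f z (Y a z) - l a z * f z = L a z (Pf z)) (k : ℕ) :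
    VanishesToOrder k Pf x ↔
      ∀ a, VanishesToOrder k (fun z ↦ fderiv ℝ f z (Y a z) - l a z * f z) x := by
  have hD (a : ι) := hW.contDiffOn_op hf a
  have hWx := hW.isOpen.mem_nhds hx
  constructor
  · intro h a
    have hP : ContDiffOn ℝ ∞ Pf W :=
      (ContDiffOn.sum fun a _ ↦ (hD a).smul (hq a)).congr hPq
    refine (VanishesToOrder.clm_apply hW.isOpen hx (hL a) hP h).congr ?_
    filter_upwards [hWx] with z hz using hPL z hz a
  · intro h
    refine (VanishesToOrder.sum (s := Finset.univ) hW.isOpen hx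
      (fun a _ ↦ (hD a).smul (hq a)) fun a _ ↦ (h a).smul_left hW.isOpen hx (hD a) (hq a)).congr ?_
    filter_upwards [hWx] with z hz using hPq z hz

end Symbol

end SprayPDE

namespace SprayPDE

/-! ### Sections and vector fields in coordinates -/

section Coordinates

variable {G : Type*} [NormedAddCommGroup G] [NormedSpace ℝ G]
  {H : Type*} [TopologicalSpace H] {I : ModelWithCorners ℝ G H}
  {N : Type*} [TopologicalSpace N] [ChartedSpace H N]

section Sections

variable {F : Type*} [NormedAddCommGroup F] [NormedSpace ℝ F]
  {V : N → Type*} [TopologicalSpace (TotalSpace F V)] [∀ x, TopologicalSpace (V x)]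
  [FiberBundle F V]

theorem isSmoothSectionOn_iff {U : Set N} (hU : IsOpen U) {s : ∀ x, V x} :
    IsSmoothSectionOn I F U s ↔ ∀ x ∈ U,
      ContMDiffAt I (I.prod 𝓘(ℝ, F)) ∞ (fun x ↦ (TotalSpace.mk' F x (s x) : TotalSpace F V)) x :=
  ⟨fun h x hx ↦ (h x hx).contMDiffAt (hU.mem_nhds hx), fun h x hx ↦ (h x hx).contMDiffWithinAt⟩

theorem isOpen_chart_preimage [I.Boundaryless] {p : N} {U : Set N} (hU : IsOpen U) :
    IsOpen ((extChartAt I p).target ∩ (extChartAt I p).symm ⁻¹' U) :=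
  (continuousOn_extChartAt_symm p).isOpen_inter_preimage (isOpen_extChartAt_target p) hU

theorem contMDiffAt_section_of_localRep [IsManifold I ∞ N] {p : N} {s : ∀ x, V x}
    (h : ContDiffAt ℝ ∞ (localRep I F p s) (extChartAt I p p)) :
    ContMDiffAt I (I.prod 𝓘(ℝ, F)) ∞ (fun x ↦ (TotalSpace.mk' F x (s x) : TotalSpace F V)) p := by
  rw [Bundle.contMDiffAt_section]
  have h1 : ContMDiffAt I 𝓘(ℝ, F) ∞ (localRep I F p s ∘ extChartAt I p) p :=
    h.contMDiffAt.comp p contMDiffAt_extChartAt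
  refine h1.congr_of_eventuallyEq ?_
  filter_upwards [extChartAt_source_mem_nhds (I := I) p] with x hx
  change _ = localRep I F p s (extChartAt I p x)
  unfold localRep
  rw [(extChartAt I p).left_inv hx]

variable [∀ x, AddCommGroup (V x)] [∀ x, Module ℝ (V x)] [VectorBundle ℝ F V]


theorem IsSmoothSectionOn.contDiffOn_localRep [I.Boundaryless] [IsManifold I ∞ N]
    [ContMDiffVectorBundle ∞ F V I] {p : N} {U : Set N} (hU : IsOpen U)
    (hp : (chartAt H p).source ⊆ (trivializationAt F V p).baseSet) {s : ∀ x, V x}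
    (hs : IsSmoothSectionOn I F U s) :
    ContDiffOn ℝ ∞ (localRep I F p s)
      ((extChartAt I p).target ∩ (extChartAt I p).symm ⁻¹' U) := by
  rw [← contMDiffOn_iff_contDiffOn]
  rintro z ⟨hz, hzU⟩
  have hx : (extChartAt I p).symm z ∈ (chartAt H p).source := by
    rw [← extChartAt_source I p]; exact (extChartAt I p).map_target hz
  have h1 := (Trivialization.contMDiffAt_section_iff (trivializationAt F V p) (hp hx)).1
    ((isSmoothSectionOn_iff hU).1 hs _ hzU)
  exact ((h1.comp z ((contMDiffOn_extChartAt_symm p).contMDiffAt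
    ((isOpen_extChartAt_target p).mem_nhds hz)))).contMDiffWithinAt

/-- Formal solutions are defined through sections over the whole open set, while the constructions
are local; a bump function bridges the two without changing germs. -/
theorem exists_isSmoothSectionOn_eventuallyEq [IsManifold I ∞ N]
    [T2Space N] [FiniteDimensional ℝ G] {O : Set N}
    (hO : IsOpen O) {x : N} (hx : x ∈ O) {s : ∀ x, V x} (hs : IsSmoothSectionOn I F O s) :
    ∃ t : ∀ x, V x, (∀ U, IsSmoothSectionOn I F U t) ∧ ∀ᶠ y in 𝓝 x, t y = s y := by
  obtain ⟨f, -, hf⟩ := (SmoothBumpFunction.nhds_basis_tsupport (I := I) x).mem_iff.1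
    (hO.mem_nhds hx)
  refine ⟨fun y ↦ f y • s y, fun U ↦ ?_, ?_⟩
  · exact (ContMDiffOn.smul_section_of_tsupport f.contMDiff.contMDiffOn hO hf hs).contMDiffOn
  · filter_upwards [f.eventuallyEq_one] with y hy
    simp [hy]

end Sections

variable [IsManifold I ∞ N]

/-- The components of a tangent vector in the preferred chart at `p`. -/
noncomputable def coordDeriv (I : ModelWithCorners ℝ G H) {N : Type*} [TopologicalSpace N]
    [ChartedSpace H N] (p x : N) : TangentSpace I x →L[ℝ] G :=
  mfderiv I 𝓘(ℝ, G) (extChartAt I p) x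

/-- The vector with the constant components `w` in the preferred chart at `p`. -/
noncomputable def coordField (I : ModelWithCorners ℝ G H) {N : Type*} [TopologicalSpace N]
    [ChartedSpace H N] [IsManifold I ∞ N] (p : N) (w : G) (x : N) : TangentSpace I x :=
  (trivializationAt G (TangentSpace I : N → Type _) p).symmL ℝ x w

theorem coordDeriv_apply {p x : N} (hx : x ∈ (chartAt H p).source) (v : TangentSpace I x) :
    coordDeriv I p x v = (trivializationAt G (TangentSpace I : N → Type _) p ⟨x, v⟩).2 := by
  have h : coordDeriv I p x =
      (trivializationAt G (TangentSpace I : N → Type _) p).continuousLinearMapAt ℝ x :=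
    (TangentBundle.continuousLinearMapAt_trivializationAt hx).symm
  rw [h, Trivialization.continuousLinearMapAt_apply, Trivialization.linearMapAt_def_of_mem]
  · rfl
  · simpa using hx

theorem trivializationAt_coordField {p x : N} (hx : x ∈ (chartAt H p).source) (w : G) :
    trivializationAt G (TangentSpace I : N → Type _) p ⟨x, coordField I p w x⟩ = (x, w) := by
  have hx' : x ∈ (trivializationAt G (TangentSpace I : N → Type _) p).baseSet := by simpa using hx
  have h : coordField I p w x = (trivializationAt G (TangentSpace I : N → Type _) p).symm x w :=
    Trivialization.symmL_apply _ hx' w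
  rw [h]
  exact (trivializationAt G (TangentSpace I : N → Type _) p).apply_mk_symm hx' w

theorem coordDeriv_coordField {p x : N} (hx : x ∈ (chartAt H p).source) (w : G) :
    coordDeriv I p x (coordField I p w x) = w := by
  rw [coordDeriv_apply hx]
  rw [trivializationAt_coordField hx]

theorem injective_coordDeriv {p x : N} (hx : x ∈ (chartAt H p).source) :
    Function.Injective (coordDeriv I p x) := by
  obtain ⟨e, he⟩ := isInvertible_mfderiv_extChartAt (I := I) (x := p) (y := x)
    (by rwa [extChartAt_source])
  unfold coordDeriv
  rw [← he]
  exact e.injective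

theorem coordField_coordDeriv {p x : N} (hx : x ∈ (chartAt H p).source) (v : TangentSpace I x) :
    coordField I p (coordDeriv I p x v) x = v :=
  injective_coordDeriv hx (coordDeriv_coordField hx _)

theorem isSmoothSectionOn_coordField (p : N) (w : G) :
    IsSmoothSectionOn I G (chartAt H p).source (coordField I p w) := by
  rw [isSmoothSectionOn_iff (chartAt H p).open_source]
  intro x hx
  rw [Trivialization.contMDiffAt_section_iff (trivializationAt G (TangentSpace I : N → Type _) p)
    (by simpa using hx)]
  refine contMDiffAt_const (c := w) |>.congr_of_eventuallyEq ?_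
  filter_upwards [(chartAt H p).open_source.mem_nhds hx] with y hy
  rw [trivializationAt_coordField hy]

theorem extChartAt_symm_mem_source {N : Type*} [TopologicalSpace N] [ChartedSpace H N] {p : N}
    {z : G} (hz : z ∈ (extChartAt I p).target) :
    (extChartAt I p).symm z ∈ (chartAt H p).source := by
  rw [← extChartAt_source I p]
  exact (extChartAt I p).map_target hz

theorem localRep_vectorField {p : N} (X : ∀ x : N, TangentSpace I x) {z : G}
    (hz : z ∈ (extChartAt I p).target) :
    localRep I G p X z = coordDeriv I p ((extChartAt I p).symm z) (X ((extChartAt I p).symm z)) := by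
  rw [coordDeriv_apply (extChartAt_symm_mem_source hz)]
  rfl

theorem mpullback_extChartAt_symm [I.Boundaryless] {p : N} (X : ∀ x : N, TangentSpace I x) {z : G}
    (hz : z ∈ (extChartAt I p).target) :
    mpullback 𝓘(ℝ, G) I (extChartAt I p).symm X z = localRep I G p X z := by
  rw [localRep_vectorField X hz, mpullback_apply]
  congr 1
  have h1 := mfderiv_extChartAt_comp_mfderivWithin_extChartAt_symm (I := I) hz
  have h2 := mfderivWithin_extChartAt_symm_comp_mfderiv_extChartAt (I := I) hz
  rw [I.range_eq_univ, mfderivWithin_univ] at h1 h2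
  exact ContinuousLinearMap.inverse_eq h2 h1

theorem two_le_infty : minSmoothness ℝ 2 ≤ (∞ : ℕ∞ω) := by
  rw [minSmoothness_of_isRCLikeNormedField]
  exact WithTop.coe_le_coe.2 (le_top (a := (2 : ℕ∞)))

/-- The coordinate expression of a field is its pullback under the inverse chart, and pullback
commutes with brackets. -/
theorem localRep_mlieBracket [I.Boundaryless] [CompleteSpace G] {p : N} {U : Set N} (hU : IsOpen U)
    {X Y : ∀ x : N, TangentSpace I x}
    (hX : IsSmoothSectionOn I G U X) (hY : IsSmoothSectionOn I G U Y) {z : G}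
    (hz : z ∈ (extChartAt I p).target) (hzU : (extChartAt I p).symm z ∈ U) :
    localRep I G p (mlieBracket I X Y) z =
      lieBracket ℝ (localRep I G p X) (localRep I G p Y) z := by
  have : IsManifold I (minSmoothness ℝ 2) N := IsManifold.of_le (n := ∞) two_le_infty
  rw [← mpullback_extChartAt_symm _ hz, mpullback_mlieBracket (n := ∞)
    (((isSmoothSectionOn_iff hU).1 hX _ hzU).mdifferentiableAt (by simp))
    (((isSmoothSectionOn_iff hU).1 hY _ hzU).mdifferentiableAt (by simp))
    ((contMDiffOn_extChartAt_symm p).contMDiffAt ((isOpen_extChartAt_target p).mem_nhds hz))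
    two_le_infty]
  have h : ∀ X : ∀ x : N, TangentSpace I x,
      mpullback 𝓘(ℝ, G) I (extChartAt I p).symm X =ᶠ[𝓝 z] localRep I G p X := fun X ↦ by
    filter_upwards [(isOpen_extChartAt_target p).mem_nhds hz] with z hz
    exact mpullback_extChartAt_symm X hz
  have h' : ∀ X Y : ∀ x : G, TangentSpace 𝓘(ℝ, G) x,
      mlieBracket 𝓘(ℝ, G) X Y z = lieBracket ℝ X Y z := fun X Y ↦ by
    rw [← mlieBracketWithin_univ, mlieBracketWithin_eq_lieBracketWithin]
    exact congrFun lieBracketWithin_univ z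
  exact ((h X).mlieBracket_vectorField_eq (h Y)).trans (h' _ _)

theorem isSmoothSectionOn_mlieBracket [CompleteSpace G] {U : Set N} (hU : IsOpen U)
    {X Y : ∀ x : N, TangentSpace I x}
    (hX : IsSmoothSectionOn I G U X) (hY : IsSmoothSectionOn I G U Y) :
    IsSmoothSectionOn I G U (mlieBracket I X Y) := by
  have : IsManifold I (minSmoothness ℝ 2) N := IsManifold.of_le (n := ∞) two_le_infty
  have : IsManifold I (((⊤ : ℕ∞) : ℕ∞ω) + 1) N := IsManifold.of_le (n := ∞) (by simp)
  rw [isSmoothSectionOn_iff hU] at hX hY ⊢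
  intro x hx
  exact ContMDiffAt.mlieBracket_vectorField (m := ⊤) (n := ⊤) (hX x hx) (hY x hx) (by simp)

theorem fderiv_comp_extChartAt_symm [I.Boundaryless] {p x : N} {F : Type*} [NormedAddCommGroup F] [NormedSpace ℝ F]
    (hx : x ∈ (chartAt H p).source) {f : N → F}
    (hf : MDifferentiableAt I 𝓘(ℝ, F) f x) (v : TangentSpace I x) :
    fderiv ℝ (f ∘ (extChartAt I p).symm) (extChartAt I p x)
      (coordDeriv I p x v) = mfderiv I 𝓘(ℝ, F) f x v := by
  rw [← extChartAt_source I] at hx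
  have hsymm : MDifferentiableAt 𝓘(ℝ, G) I (extChartAt I p).symm (extChartAt I p x) :=
    ((contMDiffOn_extChartAt_symm (n := ∞) p).contMDiffAt
      ((isOpen_extChartAt_target p).mem_nhds ((extChartAt I p).map_source hx))).mdifferentiableAt
      (by simp)
  rw [← mfderiv_eq_fderiv]
  have hf' : MDifferentiableAt I 𝓘(ℝ, F) f ((extChartAt I p).symm (extChartAt I p x)) := by
    rwa [(extChartAt I p).left_inv hx]
  rw [mfderiv_comp (I' := I) _ hf' hsymm]
  have h2 := mfderivWithin_extChartAt_symm_comp_mfderiv_extChartAt' (I := I) hx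
  rw [I.range_eq_univ, mfderivWithin_univ] at h2
  have h3 := DFunLike.congr_fun h2 v
  simp only [ContinuousLinearMap.comp_apply] at h3 ⊢
  rw [(extChartAt I p).left_inv hx]
  exact congrArg _ h3

end Coordinates

end SprayPDE

namespace SprayPDE

/-! ### The tangent bundle in coordinates -/

section TangentCoordinates

variable {E : Type*} [NormedAddCommGroup E] [NormedSpace ℝ E]
  {M : Type*} [TopologicalSpace M] [ChartedSpace E M] [IsManifold 𝓘(ℝ, E) ∞ M]

theorem mem_chartAt_source_iff {p v : TM E M} :
    v ∈ (chartAt (ModelProd E E) p).source ↔ v.1 ∈ (chartAt E p.1).source :=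
  TangentBundle.mem_chart_source_iff v p

theorem extChartAt_TM_apply {p v : TM E M} (hv : v ∈ (chartAt (ModelProd E E) p).source) :
    extChartAt (IT E) p v = (extChartAt 𝓘(ℝ, E) p.1 v.1, coordDeriv 𝓘(ℝ, E) p.1 v.1 v.2) := by
  rw [coordDeriv_apply (mem_chartAt_source_iff.1 hv)]
  have h := FiberBundle.extChartAt (F := E) (E := (TangentSpace 𝓘(ℝ, E) : M → Type _))
    (IB := 𝓘(ℝ, E)) p
  refine (congrArg (fun e : PartialEquiv (TM E M) (E × E) ↦ e v) h).trans ?_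
  have h2 : (trivializationAt E (TangentSpace 𝓘(ℝ, E) : M → Type _) p.1 v).1 = v.1 :=
    (trivializationAt E (TangentSpace 𝓘(ℝ, E) : M → Type _) p.1).coe_fst
      (by simpa using mem_chartAt_source_iff.1 hv)
  refine Prod.ext ?_ rfl
  exact congrArg (extChartAt 𝓘(ℝ, E) p.1) h2

theorem extChartAt_TM_snd_eq_zero_iff {p v : TM E M}
    (hv : v ∈ (chartAt (ModelProd E E) p).source) :
    (extChartAt (IT E) p v).2 = 0 ↔ v.2 = 0 := by
  rw [extChartAt_TM_apply hv]
  exact (injective_coordDeriv (mem_chartAt_source_iff.1 hv)).eq_iff' (map_zero _)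

theorem isOpen_slit : IsOpen (slit E M) := by
  rw [isOpen_iff_mem_nhds]
  intro v hv
  have h1 : ∀ᶠ u in 𝓝 v, (extChartAt (IT E) v u).2 ≠ 0 :=
    ((continuousAt_extChartAt (I := IT E) v).snd.eventually_ne
      (by rwa [Ne, extChartAt_TM_snd_eq_zero_iff (mem_chart_source _ v)]))
  filter_upwards [h1, chart_source_mem_nhds (ModelProd E E) v] with u hu hs
  rwa [Ne, extChartAt_TM_snd_eq_zero_iff hs] at hu

/-- Vectors at different base points are separated by the projection, vectors in one fibre by a
common chart. The Hausdorff property is what the bump functions on `TM` require. -/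
theorem t2Space_TM [T2Space M] : T2Space (TM E M) := by
  refine ⟨fun x y hxy ↦ ?_⟩
  by_cases h : x.1 = y.1
  · have hx : x ∈ (chartAt (ModelProd E E) x).source := mem_chart_source _ x
    have hy : y ∈ (chartAt (ModelProd E E) x).source := by
      rw [mem_chartAt_source_iff, ← h]; exact mem_chart_source _ x.1
    have hne : chartAt (ModelProd E E) x x ≠ chartAt (ModelProd E E) x y := fun h' ↦
      hxy ((chartAt (ModelProd E E) x).injOn hx hy h')
    obtain ⟨u, v, hu, hv, hxu, hyv, huv⟩ := @t2_separation (E × E) _ _ _ _ hne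
    refine ⟨_, _, (chartAt (ModelProd E E) x).isOpen_inter_preimage hu,
      (chartAt (ModelProd E E) x).isOpen_inter_preimage hv, ⟨hx, hxu⟩, ⟨hy, hyv⟩, ?_⟩
    exact (huv.preimage _).mono inter_subset_right inter_subset_right
  · exact separated_by_continuous (FiberBundle.continuous_proj E _) h

theorem hasMFDerivAt_proj (v : TM E M) :
    MDifferentiableAt (IT E) 𝓘(ℝ, E) (TotalSpace.proj : TM E M → M) v :=
  (contMDiff_proj (n := ∞) (TangentSpace 𝓘(ℝ, E) : M → Type _)).contMDiffAt.mdifferentiableAt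
    (by simp)

theorem coordDeriv_mfderiv_proj {p v : TM E M} (hv : v ∈ (chartAt (ModelProd E E) p).source)
    (ξ : TangentSpace (IT E) v) :
    coordDeriv 𝓘(ℝ, E) p.1 v.1 (mfderiv (IT E) 𝓘(ℝ, E) (TotalSpace.proj : TM E M → M) v ξ) =
      (coordDeriv (IT E) p v ξ).1 := by
  have hv1 := mem_chartAt_source_iff.1 hv
  have h1 : MDifferentiableAt 𝓘(ℝ, E) 𝓘(ℝ, E) (extChartAt 𝓘(ℝ, E) p.1) v.1 :=
    mdifferentiableAt_extChartAt hv1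
  have h2 : MDifferentiableAt (IT E) 𝓘(ℝ, E × E) (extChartAt (IT E) p) v :=
    mdifferentiableAt_extChartAt hv
  have h3 : (extChartAt 𝓘(ℝ, E) p.1 ∘ (TotalSpace.proj : TM E M → M)) =ᶠ[𝓝 v]
      (ContinuousLinearMap.fst ℝ E E) ∘ extChartAt (IT E) p := by
    filter_upwards [(chartAt (ModelProd E E) p).open_source.mem_nhds hv] with u hu
    simp
  have h4 := h3.mfderiv_eq (I := IT E) (I' := 𝓘(ℝ, E))
  rw [mfderiv_comp v h1 (hasMFDerivAt_proj v),
    mfderiv_comp (I' := 𝓘(ℝ, E × E)) v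
      ((ContinuousLinearMap.fst ℝ E E).differentiableAt.mdifferentiableAt) h2,
    mfderiv_eq_fderiv, ContinuousLinearMap.fderiv] at h4
  exact DFunLike.congr_fun h4 ξ

/-- In a bundle chart the curve `v + t w` has constant base component and affine fibre component. -/
theorem coordDeriv_verticalLift {p v : TM E M} (hv : v ∈ (chartAt (ModelProd E E) p).source)
    (w : TangentSpace 𝓘(ℝ, E) v.1) :
    coordDeriv (IT E) p v (verticalLift v w) = (0, coordDeriv 𝓘(ℝ, E) p.1 v.1 w) := by
  have hv1 := mem_chartAt_source_iff.1 hv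
  set c : ℝ → TM E M := fun t ↦ ⟨v.1, v.2 + t • w⟩ with hc
  have hcs : ∀ t, c t ∈ (chartAt (ModelProd E E) p).source := fun t ↦
    mem_chartAt_source_iff.2 hv1
  have hφc : ∀ q : TM E M, v.1 ∈ (chartAt E q.1).source → ∀ t, coordDeriv 𝓘(ℝ, E) q.1 v.1 (c t).2 =
      coordDeriv 𝓘(ℝ, E) q.1 v.1 v.2 + t • coordDeriv 𝓘(ℝ, E) q.1 v.1 w := fun q _ t ↦ by
    change coordDeriv 𝓘(ℝ, E) q.1 v.1 (v.2 + t • w) = _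
    rw [map_add, map_smul]
  have hc0 : c 0 = v := by simp [hc]
  have hcd : MDifferentiableAt 𝓘(ℝ, ℝ) (IT E) c 0 := by
    refine ContMDiffAt.mdifferentiableAt (n := ∞) ?_ (by simp)
    rw [contMDiffAt_totalSpace]
    refine ⟨contMDiffAt_const, ?_⟩
    have : ∀ t, (trivializationAt E (TangentSpace 𝓘(ℝ, E) : M → Type _) v.1 (c t)).2 =
        coordDeriv 𝓘(ℝ, E) v.1 v.1 v.2 + t • coordDeriv 𝓘(ℝ, E) v.1 v.1 w := fun t ↦ by
      rw [← hφc v (mem_chart_source _ _), coordDeriv_apply (mem_chart_source _ _)]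
    rw [hc0]
    simp only [this]
    exact (contDiff_const.add (contDiff_id.smul contDiff_const)).contMDiff.contMDiffAt
  have h2 : MDifferentiableAt (IT E) 𝓘(ℝ, E × E) (extChartAt (IT E) p) (c 0) :=
    mdifferentiableAt_extChartAt (hcs 0)
  have h3 : extChartAt (IT E) p ∘ c = fun t : ℝ ↦ ((extChartAt 𝓘(ℝ, E) p.1 v.1,
      coordDeriv 𝓘(ℝ, E) p.1 v.1 v.2 + t • coordDeriv 𝓘(ℝ, E) p.1 v.1 w) : E × E) := by
    funext t
    rw [Function.comp, extChartAt_TM_apply (hcs t), hφc p hv1]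
  have h5 : HasFDerivAt (fun t : ℝ ↦ ((extChartAt 𝓘(ℝ, E) p.1 v.1,
      coordDeriv 𝓘(ℝ, E) p.1 v.1 v.2 + t • coordDeriv 𝓘(ℝ, E) p.1 v.1 w) : E × E))
      ((0 : ℝ →L[ℝ] E).prod ((ContinuousLinearMap.id ℝ ℝ).smulRight
        (coordDeriv 𝓘(ℝ, E) p.1 v.1 w))) 0 :=
    (hasFDerivAt_const _ _).prodMk (((hasFDerivAt_id (0 : ℝ)).smul_const _).const_add _)
  have h4 := mfderiv_comp (0 : ℝ) h2 hcd
  rw [h3, mfderiv_eq_fderiv, h5.fderiv] at h4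
  have h6 := DFunLike.congr_fun h4 (1 : ℝ)
  have h7 : coordDeriv (IT E) p (c 0) (mfderiv 𝓘(ℝ, ℝ) (IT E) c 0 (1 : ℝ)) =
      (0, coordDeriv 𝓘(ℝ, E) p.1 v.1 w) := by
    refine h6.symm.trans ?_
    change ((0 : ℝ →L[ℝ] E) 1, (1 : ℝ) • coordDeriv 𝓘(ℝ, E) p.1 v.1 w) = _
    simp
  unfold verticalLift
  revert h7
  rw [hc0]
  exact id

theorem coordDeriv_liouville {p v : TM E M} (hv : v ∈ (chartAt (ModelProd E E) p).source) :
    coordDeriv (IT E) p v (liouville v) = (0, (extChartAt (IT E) p v).2) := by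
  rw [liouville, coordDeriv_verticalLift hv, extChartAt_TM_apply hv]

theorem coordDeriv_vertEndo {p v : TM E M} (hv : v ∈ (chartAt (ModelProd E E) p).source)
    (ξ : TangentSpace (IT E) v) :
    coordDeriv (IT E) p v (vertEndo v ξ) = (0, (coordDeriv (IT E) p v ξ).1) := by
  rw [vertEndo, coordDeriv_verticalLift hv, coordDeriv_mfderiv_proj hv]

theorem vertEndo_sub (v : TM E M) (ξ η : TangentSpace (IT E) v) :
    vertEndo v (ξ - η) = vertEndo v ξ - vertEndo v η := by
  refine injective_coordDeriv (I := IT E) (p := v) (mem_chart_source _ v) ?_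
  simp [coordDeriv_vertEndo (mem_chart_source _ v)]

theorem localRep_liouville {p : TM E M} {z : E × E} (hz : z ∈ (extChartAt (IT E) p).target) :
    localRep (IT E) (E × E) p liouville z = (0, z.2) := by
  rw [localRep_vectorField _ hz, coordDeriv_liouville (extChartAt_symm_mem_source hz),
    (extChartAt (IT E) p).right_inv hz]

theorem localRep_vertEndo {p : TM E M} {z : E × E} (hz : z ∈ (extChartAt (IT E) p).target)
    (X : VF E M) :
    localRep (IT E) (E × E) p (fun v ↦ vertEndo v (X v)) z =
      (0, (localRep (IT E) (E × E) p X z).1) := by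
  rw [localRep_vectorField _ hz, localRep_vectorField _ hz,
    coordDeriv_vertEndo (extChartAt_symm_mem_source hz)]

theorem isSmoothVF_liouville : IsSmoothVF (liouville : VF E M) := by
  refine (isSmoothSectionOn_iff isOpen_slit).2 fun v _ ↦ contMDiffAt_section_of_localRep ?_
  have h : ContDiffAt ℝ ∞ (fun z : E × E ↦ ((0 : E), z.2)) (extChartAt (IT E) v v) :=
    (contDiff_const.prodMk contDiff_snd).contDiffAt
  refine h.congr_of_eventuallyEq ?_
  filter_upwards [extChartAt_target_mem_nhds (I := IT E) v] with z hz
  exact localRep_liouville hz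

theorem IsSmoothVF.vertEndo {X : VF E M} (hX : IsSmoothVF X) :
    IsSmoothVF (fun v ↦ vertEndo v (X v)) := by
  refine (isSmoothSectionOn_iff isOpen_slit).2 fun v hv ↦ contMDiffAt_section_of_localRep ?_
  have h1 := (IsSmoothSectionOn.contDiffOn_localRep (I := IT E) (p := v) isOpen_slit
    (by simp) hX).contDiffAt ((isOpen_chart_preimage isOpen_slit).mem_nhds
      ⟨mem_extChartAt_target v, by rwa [mem_preimage, extChartAt_to_inv]⟩)
  have h : ContDiffAt ℝ ∞ (fun z : E × E ↦ ((0 : E), (localRep (IT E) (E × E) v X z).1))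
      (extChartAt (IT E) v v) := contDiffAt_const.prodMk h1.fst
  refine h.congr_of_eventuallyEq ?_
  filter_upwards [extChartAt_target_mem_nhds (I := IT E) v] with z hz
  exact localRep_vertEndo hz X

end TangentCoordinates

end SprayPDE

namespace SprayPDE

/-! ### Brackets with the Liouville field and the holonomy distribution -/

section Holonomy

variable {E : Type*} [NormedAddCommGroup E] [NormedSpace ℝ E]
  {M : Type*} [TopologicalSpace M] [ChartedSpace E M] [IsManifold 𝓘(ℝ, E) ∞ M]

/-- The coordinates at `p` of the open set of nonzero vectors. -/
def slitChart (p : TM E M) : Set (E × E) :=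
  (extChartAt (IT E) p).target ∩ (extChartAt (IT E) p).symm ⁻¹' slit E M

theorem isOpen_slitChart (p : TM E M) : IsOpen (slitChart p) := isOpen_chart_preimage isOpen_slit

theorem extChartAt_mem_slitChart {p v : TM E M} (hv : v ∈ (chartAt (ModelProd E E) p).source)
    (hs : v ∈ slit E M) : extChartAt (IT E) p v ∈ slitChart p := by
  rw [← extChartAt_source (IT E)] at hv
  exact ⟨(extChartAt (IT E) p).map_source hv, by rwa [mem_preimage, (extChartAt _ p).left_inv hv]⟩

theorem IsSmoothVF.contDiffOn {X : VF E M} (hX : IsSmoothVF X) (p : TM E M) :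
    ContDiffOn ℝ ∞ (localRep (IT E) (E × E) p X) (slitChart p) :=
  IsSmoothSectionOn.contDiffOn_localRep (I := IT E) isOpen_slit (by simp) hX

theorem IsSmoothVF.contMDiffAt {X : VF E M} (hX : IsSmoothVF X) {v : TM E M} (hv : v ∈ slit E M) :
    ContMDiffAt (IT E) (IT E).tangent ∞ (fun v ↦ (⟨v, X v⟩ : TangentBundle (IT E) (TM E M))) v :=
  (isSmoothSectionOn_iff isOpen_slit).1 hX v hv

theorem IsSmoothVF.mdifferentiableAt {X : VF E M} (hX : IsSmoothVF X) {v : TM E M}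
    (hv : v ∈ slit E M) :
    MDifferentiableAt (IT E) (IT E).tangent
      (fun v ↦ (⟨v, X v⟩ : TangentBundle (IT E) (TM E M))) v :=
  (hX.contMDiffAt hv).mdifferentiableAt (by simp)

theorem IsSmoothVF.add {X Y : VF E M} (hX : IsSmoothVF X) (hY : IsSmoothVF Y) :
    IsSmoothVF (X + Y) := ContMDiffOn.add_section hX hY

theorem IsSmoothVF.const_smul {X : VF E M} (hX : IsSmoothVF X) (c : ℝ) :
    IsSmoothVF (c • X) := ContMDiffOn.const_smul_section hX

theorem isSmoothVF_zero : IsSmoothVF (0 : VF E M) :=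
  (Bundle.contMDiff_zeroSection ℝ (TangentSpace (IT E) : TM E M → Type _)).contMDiffOn

theorem mlieBracket_congr_slit {X X' Y Y' : VF E M} (hX : ∀ v ∈ slit E M, X v = X' v)
    (hY : ∀ v ∈ slit E M, Y v = Y' v) {v : TM E M} (hv : v ∈ slit E M) :
    mlieBracket (IT E) X Y v = mlieBracket (IT E) X' Y' v :=
  Filter.EventuallyEq.mlieBracket_vectorField_eq
    (eventually_of_mem (isOpen_slit.mem_nhds hv) hX)
    (eventually_of_mem (isOpen_slit.mem_nhds hv) hY)

theorem mem_holonomy_of_mem_span {S Z : VF E M}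
    (hZ : Z ∈ Submodule.span ℝ {X : VF E M | IsHolonomyField S X}) (v : TM E M) :
    Z v ∈ holonomy S v := by
  induction hZ using Submodule.span_induction with
  | mem X hX => exact Submodule.subset_span ⟨X, hX, rfl⟩
  | zero => exact zero_mem _
  | add X Y _ _ hX hY => exact add_mem hX hY
  | smul c X _ hX => exact Submodule.smul_mem _ c hX

variable [FiniteDimensional ℝ E]

theorem IsSmoothVF.mlieBracket {X Y : VF E M} (hX : IsSmoothVF X) (hY : IsSmoothVF Y) :
    IsSmoothVF (mlieBracket (IT E) X Y) :=
  have := FiniteDimensional.complete ℝ (E × E)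
  isSmoothSectionOn_mlieBracket isOpen_slit hX hY

theorem leibniz_mlieBracket {X Y Z : VF E M} (hX : IsSmoothVF X) (hY : IsSmoothVF Y)
    (hZ : IsSmoothVF Z) {v : TM E M} (hv : v ∈ slit E M) :
    mlieBracket (IT E) X (mlieBracket (IT E) Y Z) v =
      mlieBracket (IT E) (mlieBracket (IT E) X Y) Z v +
        mlieBracket (IT E) Y (mlieBracket (IT E) X Z) v := by
  have := FiniteDimensional.complete ℝ (E × E)
  have : IsManifold (IT E) (minSmoothness ℝ 3) (TM E M) := IsManifold.of_le (n := ∞) (by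
    rw [minSmoothness_of_isRCLikeNormedField]
    exact WithTop.coe_le_coe.2 (le_top (a := (3 : ℕ∞))))
  exact leibniz_identity_mlieBracket_apply ((hX.contMDiffAt hv).of_le two_le_infty)
    ((hY.contMDiffAt hv).of_le two_le_infty) ((hZ.contMDiffAt hv).of_le two_le_infty)

/-- `[C, J] = -J`. -/
theorem mlieBracket_liouville_vertEndo {X : VF E M} (hX : IsSmoothVF X) {v : TM E M}
    (hv : v ∈ slit E M) :
    vertEndo v (mlieBracket (IT E) liouville X v) =
      mlieBracket (IT E) liouville (fun u ↦ vertEndo u (X u)) v + vertEndo v (X v) := by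
  have := FiniteDimensional.complete ℝ (E × E)
  have hsrc := mem_chart_source (ModelProd E E) v
  have hz := mem_extChartAt_target (I := IT E) v
  have hvz : (extChartAt (IT E) v).symm (extChartAt (IT E) v v) = v := extChartAt_to_inv v
  have hrep : ∀ Z : VF E M, localRep (IT E) (E × E) v Z (extChartAt (IT E) v v) =
      coordDeriv (IT E) v v (Z v) := fun Z ↦ by
    rw [localRep_vectorField _ hz, hvz]
  -- In coordinates `C` is the linear field `(0, y)`, so `[C, Z] = dZ(0, y) - (0, Z₂)`.
  have hbr : ∀ Z : VF E M, IsSmoothVF Z →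
      coordDeriv (IT E) v v (mlieBracket (IT E) liouville Z v) =
      fderiv ℝ (localRep (IT E) (E × E) v Z) (extChartAt (IT E) v v)
        (0, (extChartAt (IT E) v v).2) -
      (0, (localRep (IT E) (E × E) v Z (extChartAt (IT E) v v)).2) := fun Z hZ ↦ by
    rw [← hrep, localRep_mlieBracket isOpen_slit isSmoothVF_liouville hZ hz (by rwa [hvz])]
    have h1 : localRep (IT E) (E × E) v (liouville : VF E M) =ᶠ[𝓝 (extChartAt (IT E) v v)]
        ((ContinuousLinearMap.inr ℝ E E).comp (ContinuousLinearMap.snd ℝ E E)) := by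
      filter_upwards [extChartAt_target_mem_nhds (I := IT E) v] with z hz
      exact localRep_liouville hz
    rw [lieBracket, h1.fderiv_eq, ContinuousLinearMap.fderiv, localRep_liouville hz]
    rfl
  have hd : DifferentiableAt ℝ (localRep (IT E) (E × E) v X) (extChartAt (IT E) v v) :=
    ((hX.contDiffOn v).contDiffAt ((isOpen_slitChart v).mem_nhds
      (extChartAt_mem_slitChart hsrc hv))).differentiableAt (by simp)
  have h2 : localRep (IT E) (E × E) v (fun u ↦ vertEndo u (X u)) =ᶠ[𝓝 (extChartAt (IT E) v v)]
      ((ContinuousLinearMap.inr ℝ E E).comp (ContinuousLinearMap.fst ℝ E E)) ∘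
        localRep (IT E) (E × E) v X := by
    filter_upwards [extChartAt_target_mem_nhds (I := IT E) v] with z hz
    exact localRep_vertEndo hz X
  apply injective_coordDeriv (I := IT E) hsrc
  rw [map_add, coordDeriv_vertEndo hsrc, coordDeriv_vertEndo hsrc, hbr X hX, hbr _ hX.vertEndo,
    h2.fderiv_eq,
    fderiv_comp _ (ContinuousLinearMap.differentiableAt _) hd, ContinuousLinearMap.fderiv, localRep_vertEndo hz, ← hrep]
  simp

/-- The Jacobi identity gives `[C, Γ X] = Γ [C, X]`: the weight `-1` of `J` under `C` cancels the
weight `+1` of `S`. Hence `ΓX = X` is inherited by `[C, X]`. -/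
theorem IsHorizontal.mlieBracket_liouville {S X : VF E M} (hS : IsSpray S)
    (hX : IsHorizontal S X) : IsHorizontal S (mlieBracket (IT E) liouville X) := by
  obtain ⟨hXs, hΓ⟩ := hX
  have hCs := isSmoothVF_liouville (E := E) (M := M)
  have hSs := hS.smooth
  have hJX := hXs.vertEndo
  have hCX := hCs.mlieBracket hXs
  refine ⟨hCX, fun v hv ↦ ?_⟩
  have hXS := hXs.mlieBracket hSs
  have h1 : mlieBracket (IT E) (fun u ↦ vertEndo u (mlieBracket (IT E) liouville X u)) S v =
      mlieBracket (IT E) liouville (mlieBracket (IT E) (fun u ↦ vertEndo u (X u)) S) v := by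
    rw [mlieBracket_congr_slit (X' := mlieBracket (IT E) liouville (fun u ↦ vertEndo u (X u)) +
        fun u ↦ vertEndo u (X u)) (fun u hu ↦ mlieBracket_liouville_vertEndo hXs hu)
        (fun _ _ ↦ rfl) hv,
      mlieBracket_add_left ((hCs.mlieBracket hJX).mdifferentiableAt hv) (hJX.mdifferentiableAt hv),
      leibniz_mlieBracket hCs hJX hSs hv,
      mlieBracket_congr_slit (fun _ _ ↦ rfl) hS.homog hv]
  have h2 : mlieBracket (IT E) (mlieBracket (IT E) liouville X) S v =
      mlieBracket (IT E) liouville (mlieBracket (IT E) X S) v - mlieBracket (IT E) X S v := by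
    rw [leibniz_mlieBracket hCs hXs hSs hv,
      mlieBracket_congr_slit (fun _ _ ↦ rfl) hS.homog hv (X := X) (X' := X), add_sub_cancel_right]
  have h3 : mlieBracket (IT E) liouville (connection S X) v = mlieBracket (IT E) liouville X v :=
    mlieBracket_congr_slit (fun _ _ ↦ rfl) hΓ hv
  have h4 : connection S X = mlieBracket (IT E) (fun u ↦ vertEndo u (X u)) S +
      (-1 : ℝ) • fun u ↦ vertEndo u (mlieBracket (IT E) X S u) := by
    funext u
    simp [connection, sub_eq_add_neg]
  rw [h4, mlieBracket_add_right ((hJX.mlieBracket hSs).mdifferentiableAt hv)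
    ((hXS.vertEndo.const_smul _).mdifferentiableAt hv),
    mlieBracket_const_smul_right (hXS.vertEndo.mdifferentiableAt hv)] at h3
  rw [← h3, connection, h1, h2, vertEndo_sub, mlieBracket_liouville_vertEndo hXS hv]
  module

theorem IsHolonomyField.smooth {S X : VF E M} (hX : IsHolonomyField S X) : IsSmoothVF X := by
  induction hX with
  | horizontal X hX => exact hX.1
  | bracket X Y _ _ hX hY => exact hX.mlieBracket hY

theorem smooth_of_mem_span {S Z : VF E M}
    (hZ : Z ∈ Submodule.span ℝ {X : VF E M | IsHolonomyField S X}) : IsSmoothVF Z := by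
  induction hZ using Submodule.span_induction with
  | mem X hX => exact hX.smooth
  | zero => exact isSmoothVF_zero
  | add X Y _ _ hX hY => exact hX.add hY
  | smul c X _ hX => exact hX.const_smul c

/-- The inductive family of holonomy fields has no constructor for sums, whereas the Jacobi identity
produces sums; so the argument passes to the linear span, with equalities on the slit bundle only.
-/
theorem exists_mem_span_mlieBracket {S Z Y : VF E M}
    (hZ : Z ∈ Submodule.span ℝ {X : VF E M | IsHolonomyField S X}) (hY : IsHolonomyField S Y) :
    ∃ Z' ∈ Submodule.span ℝ {X : VF E M | IsHolonomyField S X},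
      ∀ v ∈ slit E M, mlieBracket (IT E) Z Y v = Z' v := by
  induction hZ using Submodule.span_induction with
  | mem X hX => exact ⟨_, Submodule.subset_span (.bracket X Y hX hY), fun _ _ ↦ rfl⟩
  | zero => exact ⟨0, zero_mem _, fun v _ ↦ by rw [mlieBracket_zero_left]⟩
  | add X X' hXm hXm' hX hX' =>
    obtain ⟨Z, hZ, hZe⟩ := hX
    obtain ⟨Z', hZ', hZe'⟩ := hX'
    refine ⟨Z + Z', add_mem hZ hZ', fun v hv ↦ ?_⟩
    rw [mlieBracket_add_left ((smooth_of_mem_span hXm).mdifferentiableAt hv)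
      ((smooth_of_mem_span hXm').mdifferentiableAt hv), hZe v hv, hZe' v hv]
    rfl
  | smul c X hXm hX =>
    obtain ⟨Z, hZ, hZe⟩ := hX
    refine ⟨c • Z, Submodule.smul_mem _ c hZ, fun v hv ↦ ?_⟩
    rw [mlieBracket_const_smul_left ((smooth_of_mem_span hXm).mdifferentiableAt hv), hZe v hv]
    rfl

/-- Induction on iterated brackets: `[C, [X, Y]] = [[C, X], Y] + [X, [C, Y]]` reduces to the
horizontal case. -/
theorem IsHolonomyField.mlieBracket_liouville {S X : VF E M} (hS : IsSpray S)
    (hX : IsHolonomyField S X) :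
    ∃ Z ∈ Submodule.span ℝ {X : VF E M | IsHolonomyField S X},
      ∀ v ∈ slit E M, mlieBracket (IT E) liouville X v = Z v := by
  induction hX with
  | horizontal X hX =>
    exact ⟨_, Submodule.subset_span (.horizontal _ (hX.mlieBracket_liouville hS)), fun _ _ ↦ rfl⟩
  | bracket X Y hXh hYh hX hY =>
    obtain ⟨Z, hZ, hZe⟩ := hX
    obtain ⟨Z', hZ', hZe'⟩ := hY
    obtain ⟨A, hA, hAe⟩ := exists_mem_span_mlieBracket hZ hYh
    obtain ⟨B, hB, hBe⟩ := exists_mem_span_mlieBracket hZ' hXh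
    refine ⟨A - B, sub_mem hA hB, fun v hv ↦ ?_⟩
    rw [leibniz_mlieBracket isSmoothVF_liouville hXh.smooth hYh.smooth hv,
      mlieBracket_congr_slit hZe (fun _ _ ↦ rfl) hv, mlieBracket_congr_slit (fun _ _ ↦ rfl) hZe' hv,
      hAe v hv, mlieBracket_swap_apply, hBe v hv, ← sub_eq_add_neg]
    rfl

end Holonomy

end SprayPDE

namespace SprayPDE

/-! ### The operator `(P_c, P_𝔥)` in coordinates -/

section Operator

variable {E : Type*} [NormedAddCommGroup E] [NormedSpace ℝ E]
  {M : Type*} [TopologicalSpace M] [ChartedSpace E M] [IsManifold 𝓘(ℝ, E) ∞ M]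

theorem isSmoothSectionOn_trivial {U : Set (TM E M)} {f : TM E M → ℝ} :
    IsSmoothSectionOn (IT E) ℝ (V := LineFib E M) U f ↔ ContMDiffOn (IT E) 𝓘(ℝ, ℝ) ∞ f U := by
  refine forall₂_congr fun v _ ↦ ?_
  rw [Bundle.contMDiffWithinAt_section]
  rfl

theorem localRep_function (p : TM E M) (f : TM E M → ℝ) :
    localRep (IT E) ℝ (V := LineFib E M) p f = f ∘ (extChartAt (IT E) p).symm := rfl

theorem contDiffOn_localRep_function {f : TM E M → ℝ}
    (hf : IsSmoothSectionOn (IT E) ℝ (V := LineFib E M) (slit E M) f) (p : TM E M) :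
    ContDiffOn ℝ ∞ (localRep (IT E) ℝ (V := LineFib E M) p f) (slitChart p) :=
  IsSmoothSectionOn.contDiffOn_localRep (I := IT E) isOpen_slit (fun _ _ ↦ mem_univ _) hf

theorem mdifferentiableAt_function {f : TM E M → ℝ}
    (hf : IsSmoothSectionOn (IT E) ℝ (V := LineFib E M) (slit E M) f) {v : TM E M}
    (hv : v ∈ slit E M) : MDifferentiableAt (IT E) 𝓘(ℝ, ℝ) f v :=
  ((isSmoothSectionOn_trivial.1 hf).contMDiffAt (isOpen_slit.mem_nhds hv)).mdifferentiableAt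
    (by simp)

theorem differential_apply {f : TM E M → ℝ}
    (hf : IsSmoothSectionOn (IT E) ℝ (V := LineFib E M) (slit E M) f) {p v : TM E M}
    (hv : v ∈ slit E M) (hp : v ∈ (chartAt (ModelProd E E) p).source) (ξ : TangentSpace (IT E) v) :
    differential f v ξ = fderiv ℝ (localRep (IT E) ℝ (V := LineFib E M) p f)
      (extChartAt (IT E) p v) (coordDeriv (IT E) p v ξ) :=
  (fderiv_comp_extChartAt_symm hp (mdifferentiableAt_function hf hv) ξ).symm

variable (𝔥 : ∀ v : TM E M, TangentSpace (IT E) v →L[ℝ] TangentSpace (IT E) v)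

/-- The coordinate expression of a field of endomorphisms. -/
noncomputable def endoRep (p : TM E M) (z : E × E) : (E × E) →L[ℝ] (E × E) :=
  (coordDeriv (IT E) p ((extChartAt (IT E) p).symm z)).comp
    ((𝔥 ((extChartAt (IT E) p).symm z)).comp
      ((trivializationAt (E × E) (TangentSpace (IT E) : TM E M → Type _) p).symmL ℝ
        ((extChartAt (IT E) p).symm z)))

theorem endoRep_apply (p : TM E M) (z w : E × E) :
    endoRep 𝔥 p z w = coordDeriv (IT E) p ((extChartAt (IT E) p).symm z)
      (𝔥 ((extChartAt (IT E) p).symm z)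
        (coordField (IT E) p w ((extChartAt (IT E) p).symm z))) := rfl

theorem endoRep_coordDeriv {p v : TM E M} (hp : v ∈ (chartAt (ModelProd E E) p).source)
    (ξ : TangentSpace (IT E) v) :
    endoRep 𝔥 p (extChartAt (IT E) p v) (coordDeriv (IT E) p v ξ) =
      coordDeriv (IT E) p v (𝔥 v ξ) := by
  have h : (extChartAt (IT E) p).symm (extChartAt (IT E) p v) = v :=
    (extChartAt (IT E) p).left_inv (by rwa [extChartAt_source])
  have h2 := coordField_coordDeriv (I := IT E) hp ξ
  rw [endoRep_apply, h, h2]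

variable {𝔥} in
-- Smoothness of `𝔥` is known only through its action on smooth fields; it is tested on coordinate
-- fields, cut off so as to be defined on the whole slit bundle.
theorem contDiffOn_endoRep [FiniteDimensional ℝ E] [T2Space M] {ℋ : ∀ v : TM E M, Submodule ℝ (TangentSpace (IT E) v)}
    (h𝔥 : IsSmoothProjection 𝔥 ℋ) (p : TM E M) :
    ContDiffOn ℝ ∞ (endoRep 𝔥 p) (slitChart p) := by
  have := t2Space_TM (E := E) (M := M)
  rw [contDiffOn_clm_apply]
  intro w z hz
  have hsrc := extChartAt_symm_mem_source hz.1
  obtain ⟨X, hX, hXe⟩ := exists_isSmoothSectionOn_eventuallyEq (chartAt (ModelProd E E) p).open_source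
    hsrc (isSmoothSectionOn_coordField (I := IT E) p w)
  have h1 := (h𝔥.smooth X (hX _)).contDiffOn p
  refine ((h1.contDiffAt ((isOpen_slitChart p).mem_nhds hz)).congr_of_eventuallyEq
    ?_).contDiffWithinAt
  have hc : ContinuousAt (extChartAt (IT E) p).symm z :=
    (continuousOn_extChartAt_symm p).continuousAt ((isOpen_extChartAt_target p).mem_nhds hz.1)
  filter_upwards [hc.eventually hXe, (isOpen_extChartAt_target p).mem_nhds hz.1] with u hu hu1
  rw [localRep_vectorField _ hu1, endoRep_apply, ← hu]

theorem localRep_sprayOperator {f : TM E M → ℝ}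
    (hf : IsSmoothSectionOn (IT E) ℝ (V := LineFib E M) (slit E M) f) {p : TM E M} {z : E × E}
    (hz : z ∈ slitChart p) :
    localRep (IT E) (ℝ × ((E × E) →L[ℝ] ℝ)) (V := SumFib E M) p (sprayOperator 𝔥 f) z =
      (fderiv ℝ (localRep (IT E) ℝ (V := LineFib E M) p f) z
          (localRep (IT E) (E × E) p liouville z) -
          2 * localRep (IT E) ℝ (V := LineFib E M) p f z,
        (fderiv ℝ (localRep (IT E) ℝ (V := LineFib E M) p f) z).comp (endoRep 𝔥 p z)) := by
  have hsrc := extChartAt_symm_mem_source hz.1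
  have hr : extChartAt (IT E) p ((extChartAt (IT E) p).symm z) = z :=
    (extChartAt (IT E) p).right_inv hz.1
  refine Prod.ext ?_ (ContinuousLinearMap.ext fun w ↦ ?_)
  · change differential f _ (liouville _) - 2 * f ((extChartAt (IT E) p).symm z) = _
    rw [differential_apply hf hz.2 hsrc, hr, localRep_vectorField _ hz.1]
    rfl
  · have hb : (extChartAt (IT E) p).symm z ∈
      (trivializationAt (E × E) (TangentSpace (IT E) : TM E M → Type _) p).baseSet := by
      simpa using hsrc
    change ContinuousLinearMap.inCoordinates (E × E) (TangentSpace (IT E)) ℝ (LineFib E M) p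
      ((extChartAt (IT E) p).symm z) p ((extChartAt (IT E) p).symm z)
      ((differential f _).comp (𝔥 _)) w = _
    rw [ContinuousLinearMap.inCoordinates_eq hb (mem_univ _)]
    change differential f _ (𝔥 _ ((trivializationAt (E × E)
      (TangentSpace (IT E) : TM E M → Type _) p).symm ((extChartAt (IT E) p).symm z) w)) = _
    rw [differential_apply hf hz.2 hsrc, hr, ← Trivialization.symmL_apply (R := ℝ) _ hb]
    rfl

variable {𝔥} in
theorem contDiffOn_localRep_sprayOperator [FiniteDimensional ℝ E] [T2Space M]
    {ℋ : ∀ v : TM E M, Submodule ℝ (TangentSpace (IT E) v)}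
    (h𝔥 : IsSmoothProjection 𝔥 ℋ) {f : TM E M → ℝ}
    (hf : IsSmoothSectionOn (IT E) ℝ (V := LineFib E M) (slit E M) f) (p : TM E M) :
    ContDiffOn ℝ ∞ (localRep (IT E) (ℝ × ((E × E) →L[ℝ] ℝ)) (V := SumFib E M) p
      (sprayOperator 𝔥 f)) (slitChart p) := by
  have h1 := contDiffOn_localRep_function hf p
  have h2 : ContDiffOn ℝ ∞ (fderiv ℝ (localRep (IT E) ℝ (V := LineFib E M) p f)) (slitChart p) :=
    h1.fderiv_of_isOpen (isOpen_slitChart p) (by simp)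
  refine ContDiffOn.congr ?_ fun z hz ↦ localRep_sprayOperator 𝔥 hf hz
  exact ((h2.clm_apply (isSmoothVF_liouville.contDiffOn p)).sub (contDiffOn_const.mul h1)).prodMk
    (h2.clm_comp (contDiffOn_endoRep h𝔥 p))

theorem isLinearDiffOpOn_sprayOperator [FiniteDimensional ℝ E] [T2Space M]
    {ℋ : ∀ v : TM E M, Submodule ℝ (TangentSpace (IT E) v)}
    (h𝔥 : IsSmoothProjection 𝔥 ℋ) :
    IsLinearDiffOpOn (IT E) ℝ (ℝ × ((E × E) →L[ℝ] ℝ)) (V₁ := LineFib E M) (V₂ := SumFib E M)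
      (slit E M) 1 (sprayOperator 𝔥) where
  smooth f hf := (isSmoothSectionOn_iff isOpen_slit).2 fun v hv ↦ by
    refine contMDiffAt_section_of_localRep ?_
    exact (contDiffOn_localRep_sprayOperator h𝔥 hf v).contDiffAt
      ((isOpen_slitChart v).mem_nhds (extChartAt_mem_slitChart (mem_chart_source _ v) hv))
  add f g hf hg v hv := by
    have h : differential (fun u ↦ (f + g) u) v = differential f v + differential g v :=
      mfderiv_add (mdifferentiableAt_function hf hv) (mdifferentiableAt_function hg hv)
    refine Prod.ext ?_ (ContinuousLinearMap.ext fun w ↦ ?_)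
    · change differential (fun u ↦ (f + g) u) v (liouville v) - 2 * ((f v : ℝ) + g v) =
        (differential f v (liouville v) - 2 * (f v : ℝ)) +
          (differential g v (liouville v) - 2 * (g v : ℝ))
      rw [h, add_apply]
      ring
    · change differential (fun u ↦ (f + g) u) v (𝔥 v w) =
        differential f v (𝔥 v w) + differential g v (𝔥 v w)
      rw [h, add_apply]
  smul c f hf v hv := by
    have h : differential (fun u ↦ (c • f) u) v = c • differential f v :=
      const_smul_mfderiv (mdifferentiableAt_function hf hv) c
    refine Prod.ext ?_ (ContinuousLinearMap.ext fun w ↦ ?_)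
    · change differential (fun u ↦ (c • f) u) v (liouville v) - 2 * (c * (f v : ℝ)) =
        c * (differential f v (liouville v) - 2 * (f v : ℝ))
      rw [h, smul_apply, smul_eq_mul]
      ring
    · change differential (fun u ↦ (c • f) u) v (𝔥 v w) = c * differential f v (𝔥 v w)
      rw [h, smul_apply, smul_eq_mul]
  order f hf v hv hj := by
    have h0 : (f v : ℝ) = 0 := by
      have := DFunLike.congr_fun (congrFun hj 0) (0 : Fin 0 → E × E)
      have h1 : localRep (IT E) ℝ (V := LineFib E M) v f (extChartAt (IT E) v v) = 0 := this
      rwa [localRep_function, Function.comp, extChartAt_to_inv] at h1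
    have h1 (w : TangentSpace (IT E) v) : differential f v w = 0 := by
      rw [differential_apply hf hv (mem_chart_source _ v)]
      have := DFunLike.congr_fun (congrFun hj 1) (fun _ : Fin 1 ↦ coordDeriv (IT E) v v w)
      exact (iteratedFDeriv_one_apply _).symm.trans this
    refine Prod.ext ?_ (ContinuousLinearMap.ext fun w ↦ ?_)
    · change differential f v (liouville v) - 2 * (f v : ℝ) = (0 : ℝ)
      rw [h1, h0]
      ring
    · exact h1 _

end Operator

end SprayPDE

namespace SprayPDE

/-! ### The commuting system of a spray -/

section System

variable {E : Type*} [NormedAddCommGroup E] [NormedSpace ℝ E]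
  {M : Type*} [TopologicalSpace M] [ChartedSpace E M] [IsManifold 𝓘(ℝ, E) ∞ M]

theorem localRep_extChartAt {p u : TM E M} (hu : u ∈ (chartAt (ModelProd E E) p).source)
    (X : VF E M) :
    localRep (IT E) (E × E) p X (extChartAt (IT E) p u) = coordDeriv (IT E) p u (X u) := by
  rw [← extChartAt_source (IT E)] at hu
  rw [localRep_vectorField _ ((extChartAt (IT E) p).map_source hu),
    (extChartAt (IT E) p).left_inv hu]

theorem linearIndependent_localRep_iff {ι : Type*} {X : ι → VF E M} {p u : TM E M}
    (hu : u ∈ (chartAt (ModelProd E E) p).source) :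
    (LinearIndependent ℝ fun i ↦ localRep (IT E) (E × E) p (X i) (extChartAt (IT E) p u)) ↔
      LinearIndependent ℝ fun i ↦ X i u := by
  have h : (fun i ↦ localRep (IT E) (E × E) p (X i) (extChartAt (IT E) p u)) =
      (coordDeriv (IT E) p u : TangentSpace (IT E) u →ₗ[ℝ] E × E) ∘ fun i ↦ X i u :=
    funext fun i ↦ localRep_extChartAt hu (X i)
  rw [h]
  exact LinearMap.linearIndependent_iff _ (LinearMap.ker_eq_bot.2 (injective_coordDeriv hu))

/-- The Liouville field together with the fields `X i`. -/
noncomputable def adjoinLiouville {r : ℕ} (X : Fin r → VF E M) (a : Option (Fin r)) : VF E M :=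
  a.elim liouville X

/-- In the preferred chart at `p`, over `W`, the operator `(P_c, P_𝔥)` is equivalent to the
operators `f ↦ df(Y a) - l a f`, to all orders. -/
def IsLocalSystem {ι : Type*}
    (𝔥 : ∀ v : TM E M, TangentSpace (IT E) v →L[ℝ] TangentSpace (IT E) v) (p : TM E M)
    (W : Set (E × E)) (Y : ι → E × E → E × E) (l : ι → E × E → ℝ) : Prop :=
  ∀ f : TM E M → ℝ, IsSmoothSectionOn (IT E) ℝ (V := LineFib E M) (slit E M) f →
    ∀ x ∈ W, ∀ k, VanishesToOrder k
      (localRep (IT E) (ℝ × ((E × E) →L[ℝ] ℝ)) (V := SumFib E M) p (sprayOperator 𝔥 f)) x ↔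
      ∀ a, VanishesToOrder k
        (fun z ↦ fderiv ℝ (localRep (IT E) ℝ (V := LineFib E M) p f) z (Y a z) -
          l a z * localRep (IT E) ℝ (V := LineFib E M) p f z) x

variable [FiniteDimensional ℝ E]

instance finiteDimensional_tangentSpace (v : TM E M) : FiniteDimensional ℝ (TangentSpace (IT E) v) :=
  inferInstanceAs (FiniteDimensional ℝ (E × E))

/-- Holonomy fields forming a basis at `p` stay independent nearby, and by constancy of the rank
they still span. Independence together with `C` at `p` is the hypothesis that `C` is not in the
distribution. -/
theorem exists_holonomy_frame {S : VF E M} {p : TM E M} (hp : p ∈ slit E M)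
    (hC : liouville p ∉ holonomy S p)
    (hrank : ∀ᶠ u in 𝓝 p,
      Module.finrank ℝ (holonomy S u) = Module.finrank ℝ (holonomy S p)) :
    ∃ (r : ℕ) (X : Fin r → VF E M), (∀ i, IsHolonomyField S (X i)) ∧
      (LinearIndependent ℝ fun a ↦ adjoinLiouville X a p) ∧
      ∀ᶠ u in 𝓝 p, holonomy S u = Submodule.span ℝ (range fun i ↦ X i u) := by
  obtain ⟨f, hf, hspan, hind⟩ := Submodule.exists_fun_fin_finrank_span_eq ℝ
    {ξ : TangentSpace (IT E) p | ∃ X, IsHolonomyField S X ∧ X p = ξ}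
  choose X hX hXp using hf
  refine ⟨_, X, hX, ?_, ?_⟩
  · have h := (linearIndependent_option' (K := ℝ) (v := f) (x := liouville p)).2
      ⟨hind, by rw [hspan]; exact hC⟩
    have he : (fun a ↦ adjoinLiouville X a p) = fun o ↦ Option.casesOn' o (liouville p) f := by
      funext a
      cases a with
      | none => rfl
      | some i => exact hXp i
    rw [he]
    exact h
  · have hsrc := mem_chart_source (ModelProd E E) p
    have hcoord : LinearIndependent ℝ
        fun i ↦ localRep (IT E) (E × E) p (X i) (extChartAt (IT E) p p) := by
      rw [linearIndependent_localRep_iff hsrc, funext hXp]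
      exact hind
    have hcont : ContinuousAt (fun u i ↦ localRep (IT E) (E × E) p (X i) (extChartAt (IT E) p u))
        p := by
      refine continuousAt_pi.2 fun i ↦ ?_
      have h1 : ContinuousAt (localRep (IT E) (E × E) p (X i)) (extChartAt (IT E) p p) :=
        (((hX i).smooth.contDiffOn p).contDiffAt ((isOpen_slitChart p).mem_nhds
          (extChartAt_mem_slitChart hsrc hp))).continuousAt
      exact ContinuousAt.comp (f := extChartAt (IT E) p) h1 (continuousAt_extChartAt p)
    have hev := hcont.eventually (isOpen_setOfPred_linearIndependent.mem_nhds hcoord)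
    filter_upwards [hev, hrank, chart_source_mem_nhds (ModelProd E E) p] with u hu hru hus
    have hXu : LinearIndependent ℝ fun i ↦ X i u := (linearIndependent_localRep_iff hus).1 hu
    refine (Submodule.eq_of_le_of_finrank_eq (Submodule.span_le.2 ?_) ?_).symm
    · rintro _ ⟨i, rfl⟩
      exact Submodule.subset_span ⟨X i, hX i, rfl⟩
    · rw [finrank_span_eq_card hXu, Fintype.card_fin, hru]
      rfl

/-- The point is that the brackets lie in the holonomy distribution itself, not merely in its sum
with `C`: this is what makes the weight `2` of `C` compatible. -/
theorem mlieBracket_adjoinLiouville_mem {S : VF E M} (hS : IsSpray S) {r : ℕ} {X : Fin r → VF E M}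
    (hX : ∀ i, IsHolonomyField S (X i)) (a b : Option (Fin r)) {u : TM E M} (hu : u ∈ slit E M) :
    mlieBracket (IT E) (adjoinLiouville X a) (adjoinLiouville X b) u ∈ holonomy S u := by
  have key (i : Fin r) : mlieBracket (IT E) liouville (X i) u ∈ holonomy S u := by
    obtain ⟨Z, hZ, hZe⟩ := (hX i).mlieBracket_liouville hS
    rw [hZe u hu]
    exact mem_holonomy_of_mem_span hZ u
  match a, b with
  | none, none =>
    change mlieBracket (IT E) liouville liouville u ∈ _
    rw [mlieBracket_self]
    exact zero_mem _
  | none, some i => exact key i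
  | some i, none =>
    change mlieBracket (IT E) (X i) liouville u ∈ _
    rw [mlieBracket_swap_apply]
    exact neg_mem (key i)
  | some i, some j => exact Submodule.subset_span ⟨_, .bracket _ _ (hX i) (hX j), rfl⟩

theorem adjoinLiouville_smooth {S : VF E M} {r : ℕ} {X : Fin r → VF E M}
    (hX : ∀ i, IsHolonomyField S (X i)) (a : Option (Fin r)) :
    IsSmoothVF (adjoinLiouville X a) := by
  cases a with
  | none => exact isSmoothVF_liouville
  | some i => exact (hX i).smooth

theorem exists_commutingSystem_sprayOperator [T2Space M] {S : VF E M} (hS : IsSpray S)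
    {p : TM E M} (hp : p ∈ slit E M) (hC : liouville p ∉ holonomy S p)
    (hrank : ∀ᶠ u in 𝓝 p,
      Module.finrank ℝ (holonomy S u) = Module.finrank ℝ (holonomy S p))
    {𝔥 : ∀ v : TM E M, TangentSpace (IT E) v →L[ℝ] TangentSpace (IT E) v}
    (h𝔥 : IsSmoothProjection 𝔥 (holonomy S)) :
    ∃ (r : ℕ) (W : Set (E × E)) (t : (E × E) →L[ℝ] (Option (Fin r) → ℝ))
      (Y : Option (Fin r) → E × E → E × E) (l : Option (Fin r) → E × E → ℝ),
      CommutingSystem W t Y l ∧ extChartAt (IT E) p p ∈ W ∧ W ⊆ slitChart p ∧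
      IsLocalSystem 𝔥 p W Y l := by
  have := FiniteDimensional.complete ℝ (E × E)
  obtain ⟨r, X, hX, hind, hspan⟩ := exists_holonomy_frame hp hC hrank
  have hXs := adjoinLiouville_smooth hX
  have hsrc := mem_chart_source (ModelProd E E) p
  obtain ⟨O, hOs, hO, hpO⟩ := mem_nhds_iff.1 hspan
  set Xc : Option (Fin r) → E × E → E × E :=
    fun a ↦ localRep (IT E) (E × E) p (adjoinLiouville X a) with hXc
  set W₀ : Set (E × E) := slitChart p ∩
    ((extChartAt (IT E) p).target ∩ (extChartAt (IT E) p).symm ⁻¹' O) with hW₀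
  have hW₀o : IsOpen W₀ := (isOpen_slitChart p).inter (isOpen_chart_preimage hO)
  have hpW₀ : extChartAt (IT E) p p ∈ W₀ := ⟨extChartAt_mem_slitChart hsrc hp,
    mem_extChartAt_target p, by rwa [mem_preimage, extChartAt_to_inv]⟩
  have hXcs (a : Option (Fin r)) : ContDiffOn ℝ ∞ (Xc a) W₀ :=
    ((hXs a).contDiffOn p).mono inter_subset_left
  have hmem {z : E × E} (hz : z ∈ W₀) {ξ : TangentSpace (IT E) ((extChartAt (IT E) p).symm z)}
      (hξ : ξ ∈ holonomy S ((extChartAt (IT E) p).symm z)) :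
      ∃ c : Fin r → ℝ, coordDeriv (IT E) p _ ξ = ∑ i, c i • Xc (some i) z := by
    rw [show holonomy S ((extChartAt (IT E) p).symm z) = _ from hOs hz.2.2,
      Submodule.mem_span_range_iff_exists_fun] at hξ
    obtain ⟨c, rfl⟩ := hξ
    refine ⟨c, ?_⟩
    rw [map_sum]
    refine Finset.sum_congr rfl fun i _ ↦ ?_
    have h1 : Xc (some i) z = coordDeriv (IT E) p _ (X i ((extChartAt (IT E) p).symm z)) :=
      localRep_vectorField _ hz.1.1
    rw [map_smul, h1]
  -- The value `2` is the homogeneity degree in `P_c f = C f - 2 f`; the holonomy fields carry no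
  -- zeroth order term.
  set w : Option (Fin r) → ℝ := fun a ↦ a.elim 2 fun _ ↦ 0 with hw
  obtain ⟨W, t, Y, l, m, hWW₀, hpW, hsys, hm, hY, hXY⟩ := exists_commutingSystem hW₀o hpW₀ hXcs w
    ((linearIndependent_localRep_iff hsrc).2 hind)
    (fun z hz a b ↦ by
      obtain ⟨c, hc⟩ := hmem hz (mlieBracket_adjoinLiouville_mem hS hX a b hz.1.2)
      -- No bracket has a component along `C`, and `w` vanishes on the other indices.
      refine ⟨fun a ↦ a.elim 0 c, ?_, ?_⟩
      · rw [hXc, ← localRep_mlieBracket isOpen_slit (hXs a) (hXs b) hz.1.1 hz.1.2,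
          localRep_vectorField _ hz.1.1, hc, Fintype.sum_option]
        simp [hXc]
      · rw [Fintype.sum_option]
        simp [hw])
  have hWs : W ⊆ slitChart p := fun z hz ↦ (hWW₀ hz).1
  have h𝔥c := (contDiffOn_endoRep h𝔥 p).mono hWs
  have hmem𝔥 {z : E × E} (hz : z ∈ W) (v : E × E) :
      ∃ c : Fin r → ℝ, endoRep 𝔥 p z v = ∑ i, c i • Xc (some i) z := by
    rw [endoRep_apply]
    exact hmem (hWW₀ hz) ((h𝔥.proj _ (hWs hz).2).map_mem _)
  -- The projection fixes the frame fields, so each `X i f` is recovered by evaluating `P_𝔥 f` on `X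
  -- i`.
  have h𝔥X {z : E × E} (hz : z ∈ W) (i : Fin r) :
      endoRep 𝔥 p z (Xc (some i) z) = Xc (some i) z := by
    have h1 := endoRep_coordDeriv 𝔥 (extChartAt_symm_mem_source (hWs hz).1)
      (X i ((extChartAt (IT E) p).symm z))
    have h2 : 𝔥 _ (X i ((extChartAt (IT E) p).symm z)) = X i ((extChartAt (IT E) p).symm z) :=
      (h𝔥.proj _ (hWs hz).2).map_id _ (Submodule.subset_span ⟨X i, hX i, rfl⟩)
    rw [(extChartAt (IT E) p).right_inv (hWs hz).1, h2] at h1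
    have h3 : Xc (some i) z = coordDeriv (IT E) p _ (X i ((extChartAt (IT E) p).symm z)) :=
      localRep_vectorField _ (hWs hz).1
    rwa [← h3] at h1
  refine ⟨r, W, t, Y, l, hsys, hpW, hWs, fun f hf x hx k ↦ ?_⟩
  set F : E × E → ℝ := localRep (IT E) ℝ (V := LineFib E M) p f with hF
  have hFs : ContDiffOn ℝ ∞ F W := (contDiffOn_localRep_function hf p).mono hWs
  have hXD {z : E × E} (hz : z ∈ W) (b : Option (Fin r)) :
      fderiv ℝ F z (Xc b z) - w b * F z =
        ∑ a, t (Xc b z) a * (fderiv ℝ F z (Y a z) - l a z * F z) := by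
    obtain ⟨h1, h2⟩ := (hXY z hz b)
    rw [h2]
    nth_rw 1 [h1]
    simp only [map_sum, map_smul, smul_eq_mul, mul_sub, Finset.sum_sub_distrib, Finset.sum_mul,
      mul_assoc]
  have hYD {z : E × E} (hz : z ∈ W) (a : Option (Fin r)) :
      fderiv ℝ F z (Y a z) - l a z * F z =
        ∑ b, m a b z * (fderiv ℝ F z (Xc b z) - w b * F z) := by
    obtain ⟨h1, h2⟩ := hY z hz a
    rw [h1, h2]
    simp only [map_sum, map_smul, smul_eq_mul, mul_sub, Finset.sum_sub_distrib, Finset.sum_mul,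
      mul_assoc]
  -- The coefficients `q` express `(P_c f, P_𝔥 f)` through the `D a f`, using that `C` and the image
  -- of `𝔥` lie in the span of the frame; `L` inverts this through the matrix `m`.
  refine hsys.vanishesToOrder_iff hx hFs
    (q := fun a z ↦ (t (Xc none z) a,
      ((ContinuousLinearMap.proj (R := ℝ) (φ := fun _ ↦ ℝ) a).comp t).comp (endoRep 𝔥 p z)))
    (L := fun a z ↦ m a none z • ContinuousLinearMap.fst ℝ ℝ ((E × E) →L[ℝ] ℝ) +
      ∑ i, m a (some i) z • (ContinuousLinearMap.apply ℝ ℝ (Xc (some i) z)).comp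
        (ContinuousLinearMap.snd ℝ ℝ ((E × E) →L[ℝ] ℝ)))
    (fun a ↦ ?_) (fun a ↦ ?_) (fun z hz ↦ ?_) (fun z hz a ↦ ?_) k
  · have h1 : ContDiffOn ℝ ∞ (fun z ↦ t (Xc none z) a) W :=
      ((ContinuousLinearMap.proj (R := ℝ) (φ := fun _ ↦ ℝ) a).comp t).contDiff.comp_contDiffOn
        ((hXcs none).mono hWW₀)
    exact h1.prodMk (contDiffOn_const.clm_comp h𝔥c)
  · refine ((hm a none).smul contDiffOn_const).add (ContDiffOn.sum fun i _ ↦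
      (hm a (some i)).smul (ContDiffOn.clm_comp ?_ contDiffOn_const))
    exact contDiffOn_clm_apply.2 fun φ ↦ φ.contDiff.comp_contDiffOn ((hXcs (some i)).mono hWW₀)
  · rw [localRep_sprayOperator 𝔥 hf (hWs hz)]
    refine Prod.ext ?_ (ContinuousLinearMap.ext fun v ↦ ?_)
    · have h1 := hXD hz none
      simp only [Prod.fst_sum, Prod.smul_fst, smul_eq_mul]
      refine h1.trans (Finset.sum_congr rfl fun a _ ↦ mul_comm _ _)
    · obtain ⟨c, hc⟩ := hmem𝔥 hz v
      simp only [Prod.snd_sum, Prod.smul_snd, sum_apply, smul_apply,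
        ContinuousLinearMap.comp_apply, ContinuousLinearMap.proj_apply, smul_eq_mul, hc, map_sum,
        map_smul, Finset.mul_sum]
      rw [Finset.sum_comm]
      refine Finset.sum_congr rfl fun i _ ↦ ?_
      have h1 := hXD hz (some i)
      simp only [hw, Option.elim_some, zero_mul, sub_zero] at h1
      change c i * fderiv ℝ F z (Xc (some i) z) = _
      rw [h1, Finset.mul_sum]
      exact Finset.sum_congr rfl fun a _ ↦ by ring
  · rw [localRep_sprayOperator 𝔥 hf (hWs hz), hYD hz, Fintype.sum_option]
    simp only [add_apply, smul_apply, sum_apply, ContinuousLinearMap.comp_apply,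
      ContinuousLinearMap.coe_fst', ContinuousLinearMap.coe_snd', ContinuousLinearMap.apply_apply,
      h𝔥X hz, smul_eq_mul]
    refine congrArg₂ _ rfl (Finset.sum_congr rfl fun i _ ↦ ?_)
    simp [hw, hF]

end System

end SprayPDE

namespace SprayPDE

/-! ### Formal integrability and involutivity -/

section Conclusion

variable {E : Type*} [NormedAddCommGroup E] [NormedSpace ℝ E] [FiniteDimensional ℝ E]
  {M : Type*} [TopologicalSpace M] [T2Space M] [ChartedSpace E M] [IsManifold 𝓘(ℝ, E) ∞ M]

theorem exists_localRep_eventuallyEq {p : TM E M} {W : Set (E × E)} (hW : IsOpen W)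
    (hWs : W ⊆ slitChart p) {f : E × E → ℝ} (hf : ContDiffOn ℝ ∞ f W) {x : E × E} (hx : x ∈ W) :
    ∃ g : TM E M → ℝ, IsSmoothSectionOn (IT E) ℝ (V := LineFib E M) (slit E M) g ∧
      localRep (IT E) ℝ (V := LineFib E M) p g =ᶠ[𝓝 x] f := by
  have := t2Space_TM (E := E) (M := M)
  set O : Set (TM E M) := (extChartAt (IT E) p).source ∩ extChartAt (IT E) p ⁻¹' W with hOdef
  have hO : IsOpen O :=
    (continuousOn_extChartAt p).isOpen_inter_preimage (isOpen_extChartAt_source p) hW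
  have hmaps : ∀ z ∈ W, (extChartAt (IT E) p).symm z ∈ O := fun z hz ↦
    ⟨(extChartAt (IT E) p).map_target (hWs hz).1, by
      rwa [mem_preimage, (extChartAt (IT E) p).right_inv (hWs hz).1]⟩
  have hfO : IsSmoothSectionOn (IT E) ℝ (V := LineFib E M) O (f ∘ extChartAt (IT E) p) := by
    rw [isSmoothSectionOn_trivial]
    refine hf.contMDiffOn.comp ((contMDiffOn_extChartAt (x := p)).mono fun u hu ↦ ?_)
      fun u hu ↦ hu.2
    rw [← extChartAt_source (IT E)]
    exact hu.1
  obtain ⟨g, hg, hge⟩ := exists_isSmoothSectionOn_eventuallyEq (I := IT E) hO (hmaps x hx) hfO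
  refine ⟨g, hg _, ?_⟩
  have hc : ContinuousAt (extChartAt (IT E) p).symm x :=
    (continuousOn_extChartAt_symm p).continuousAt
      ((isOpen_extChartAt_target p).mem_nhds (hWs hx).1)
  filter_upwards [hc.eventually hge, (isOpen_extChartAt_target p).mem_nhds (hWs hx).1] with z hz hzt
  rw [localRep_function]
  refine Eq.trans hz ?_
  rw [Function.comp, (extChartAt (IT E) p).right_inv hzt]

theorem eventuallyEq_op {G ι : Type*} [NormedAddCommGroup G] [NormedSpace ℝ G] {f g : G → ℝ}
    {x : G} (h : f =ᶠ[𝓝 x] g) (Y : ι → G → G) (l : ι → G → ℝ) (a : ι) :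
    (fun z ↦ fderiv ℝ f z (Y a z) - l a z * f z) =ᶠ[𝓝 x]
      fun z ↦ fderiv ℝ g z (Y a z) - l a z * g z := by
  filter_upwards [h, h.fderiv (𝕜 := ℝ)] with z hz hz'
  rw [hz, hz']

variable {ι : Type*} [DecidableEq ι] {p : TM E M} {W : Set (E × E)}
  {t : (E × E) →L[ℝ] (ι → ℝ)} {Y : ι → E × E → E × E} {l : ι → E × E → ℝ}
  {𝔥 : ∀ v : TM E M, TangentSpace (IT E) v →L[ℝ] TangentSpace (IT E) v}

theorem formalSolutions_sprayOperator (hsys : CommutingSystem W t Y l) (hWs : W ⊆ slitChart p)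
    (h𝔥 : IsLocalSystem 𝔥 p W Y l) (k : ℕ) {u : TM E M} (hu : extChartAt (IT E) p u ∈ W) :
    formalSolutions (IT E) ℝ (ℝ × ((E × E) →L[ℝ] ℝ)) (V₁ := LineFib E M) (V₂ := SumFib E M)
      (slit E M) 1 (sprayOperator 𝔥) k p u =
      (localSolutions hsys (1 + k) hu : Set (JetModel (E × E) ℝ (1 + k))) := by
  ext ξ
  constructor
  · rintro ⟨g, hg, rfl, hPg⟩
    refine ⟨_, (contDiffOn_localRep_function hg p).mono hWs, rfl, ?_⟩
    have h1 := (h𝔥 g hg _ hu (k + 1)).1 (jetAt_eq_zero_iff.1 hPg)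
    rwa [add_comm] at h1
  · rintro ⟨f, hf, rfl, hPf⟩
    obtain ⟨g, hg, hge⟩ := exists_localRep_eventuallyEq hsys.isOpen hWs hf hu
    refine ⟨g, hg, jetAt_congr hge, jetAt_eq_zero_iff.2 ((h𝔥 g hg _ hu (k + 1)).2 fun a ↦ ?_)⟩
    rw [add_comm]
    exact (hPf a).congr (eventuallyEq_op hge Y l a)

theorem symbolKernel_sprayOperator (hsys : CommutingSystem W t Y l) (hWs : W ⊆ slitChart p)
    (h𝔥 : IsLocalSystem 𝔥 p W Y l) (hp : extChartAt (IT E) p p ∈ W) (k : ℕ) :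
    symbolKernel (IT E) ℝ (ℝ × ((E × E) →L[ℝ] ℝ)) (V₁ := LineFib E M) (V₂ := SumFib E M)
      (slit E M) 1 (sprayOperator 𝔥) k p =
    {A | ∃ f, ContDiffOn ℝ ∞ f W ∧ VanishesToOrder (1 + k) f (extChartAt (IT E) p p) ∧
      iteratedFDeriv ℝ (1 + k) f (extChartAt (IT E) p p) = A ∧
      ∀ a, VanishesToOrder (k + 1) (fun z ↦ fderiv ℝ f z (Y a z) - l a z * f z)
        (extChartAt (IT E) p p)} := by
  ext A
  constructor
  · rintro ⟨g, hg, hg0, rfl, hPg⟩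
    have hgW := (contDiffOn_localRep_function hg p).mono hWs
    refine ⟨_, hgW, hg0, rfl, (h𝔥 g hg _ hp (k + 1)).1 fun j hj ↦ ?_⟩
    -- The symbol condition concerns only the derivative of order `k`. The lower ones vanish
    -- automatically, because the function vanishes to order `1 + k` and the operator has order one.
    rcases Nat.lt_succ_iff_lt_or_eq.1 hj with hj | rfl
    · refine (h𝔥 g hg _ hp k).2 (fun a ↦ VanishesToOrder.op hsys hp hgW ?_ a) j hj
      rw [add_comm]
      exact hg0
    · exact hPg
  · rintro ⟨f, hf, hf0, rfl, hPf⟩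
    obtain ⟨g, hg, hge⟩ := exists_localRep_eventuallyEq hsys.isOpen hWs hf hp
    refine ⟨g, hg, hf0.congr hge, (hge.iteratedFDeriv ℝ _).eq_of_nhds, ?_⟩
    exact (h𝔥 g hg _ hp (k + 1)).2 (fun a ↦ (hPf a).congr (eventuallyEq_op hge Y l a)) k
      (Nat.lt_succ_self k)

theorem isVectorBundleNear_sprayOperator [Fintype ι] (hsys : CommutingSystem W t Y l)
    (hWs : W ⊆ slitChart p) (h𝔥 : IsLocalSystem 𝔥 p W Y l) (hp : extChartAt (IT E) p p ∈ W)
    (k : ℕ) :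
    IsVectorBundleNear (IT E) ℝ (ℝ × ((E × E) →L[ℝ] ℝ)) (V₁ := LineFib E M) (V₂ := SumFib E M)
      (slit E M) 1 (sprayOperator 𝔥) k p := by
  obtain ⟨r, σ, hσ, hσ'⟩ := hsys.exists_frame ⟨_, hp⟩ (1 + k)
  refine ⟨(extChartAt (IT E) p).source ∩ extChartAt (IT E) p ⁻¹' W,
    (continuousOn_extChartAt p).isOpen_inter_preimage (isOpen_extChartAt_source p) hsys.isOpen,
    ⟨mem_extChartAt_source p, hp⟩, ?_, r, fun i u ↦ σ i (extChartAt (IT E) p u), fun i ↦ ?_, ?_⟩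
  · rintro u ⟨hu, huW⟩
    have hs := (hWs huW).2
    rw [mem_preimage, (extChartAt (IT E) p).left_inv hu] at hs
    rw [extChartAt_source] at hu
    have hb : u ∈ (trivializationAt (E × E) (TangentSpace (IT E) : TM E M → Type _) p).baseSet := by
      simpa using hu
    exact ⟨⟨⟨hs, hu⟩, mem_univ _⟩, ⟨mem_univ _, hb, mem_univ _⟩⟩
  · refine (hσ i).contMDiffOn.comp ((contMDiffOn_extChartAt (x := p)).mono fun u hu ↦ ?_)
      fun u hu ↦ hu.2
    rw [← extChartAt_source (IT E)]
    exact hu.1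
  · rintro u ⟨-, huW⟩
    obtain ⟨h1, h2⟩ := hσ' _ huW
    exact ⟨h1, by rw [h2, formalSolutions_sprayOperator hsys hWs h𝔥 k huW]⟩

theorem formallyIntegrableAt_sprayOperator [Fintype ι] (hsys : CommutingSystem W t Y l)
    (hWs : W ⊆ slitChart p) (h𝔥 : IsLocalSystem 𝔥 p W Y l) (hp : extChartAt (IT E) p p ∈ W) :
    FormallyIntegrableAt (IT E) ℝ (ℝ × ((E × E) →L[ℝ] ℝ)) (V₁ := LineFib E M) (V₂ := SumFib E M)
      (slit E M) 1 (sprayOperator 𝔥) p := by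
  refine ⟨isVectorBundleNear_sprayOperator hsys hWs h𝔥 hp, fun k ↦ ?_⟩
  rw [formalSolutions_sprayOperator hsys hWs h𝔥 _ hp, formalSolutions_sprayOperator hsys hWs h𝔥 _ hp]
  exact hsys.surjOn_truncateJet (1 + k) hp

theorem symbolInvolutiveAt_sprayOperator [Fintype ι] (hsys : CommutingSystem W t Y l)
    (hWs : W ⊆ slitChart p) (h𝔥 : IsLocalSystem 𝔥 p W Y l) (hp : extChartAt (IT E) p p ∈ W) :
    SymbolInvolutiveAt (IT E) ℝ (ℝ × ((E × E) →L[ℝ] ℝ)) (V₁ := LineFib E M) (V₂ := SumFib E M)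
      (slit E M) 1 (sprayOperator 𝔥) p := by
  have hy : LinearIndependent ℝ fun a ↦ Y a (extChartAt (IT E) p p) := by
    refine LinearIndependent.of_comp (t : (E × E) →ₗ[ℝ] (ι → ℝ)) ?_
    have h : ((t : (E × E) →ₗ[ℝ] (ι → ℝ)) ∘ fun a ↦ Y a (extChartAt (IT E) p p)) =
        Pi.basisFun ℝ ι := by
      funext a
      rw [Pi.basisFun_apply]
      exact hsys.t_Y _ hp a
    rw [h]
    exact (Pi.basisFun ℝ ι).linearIndependent
  obtain ⟨e, he⟩ := exists_quasiRegular_basis hy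
  have h0 := (symbolKernel_sprayOperator hsys hWs h𝔥 hp 0).trans (hsys.symbol_zero hp)
  have h1 := (symbolKernel_sprayOperator hsys hWs h𝔥 hp 1).trans (hsys.symbol_one hp)
  have h2 (j : ℕ) : symbolKernelAnnihilating (IT E) ℝ (ℝ × ((E × E) →L[ℝ] ℝ))
      (V₁ := LineFib E M) (V₂ := SumFib E M) (slit E M) 1 (sprayOperator 𝔥) p e j =
      {A | (∀ a, A (fun _ ↦ Y a (extChartAt (IT E) p p)) = 0) ∧
        ∀ i : Fin (Module.finrank ℝ (E × E)), (i : ℕ) < j → A (fun _ ↦ e i) = 0} := by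
    ext A
    refine and_congr (by rw [h0]; rfl) (forall₂_congr fun i _ ↦ ⟨fun h ↦ h _ ⟨0, rfl⟩, ?_⟩)
    rintro h v ⟨a, ha⟩
    rw [← h]
    refine congrArg A (funext fun b ↦ ?_)
    rw [← ha, show b = a from Fin.ext (by omega)]
  refine ⟨e, ?_⟩
  rw [h0, h1, he]
  exact congrArg _ (Finset.sum_congr rfl fun j _ ↦ (congrArg (Set.finrank ℝ) (h2 j)).symm)

end Conclusion

end SprayPDE

theorem mainTheorem5 {E : Type*} [NormedAddCommGroup E] [NormedSpace ℝ E] [FiniteDimensional ℝ E]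
    {M : Type*} [TopologicalSpace M] [T2Space M] [ChartedSpace E M] [IsManifold 𝓘(ℝ, E) ∞ M]
    (S : SprayPDE.VF E M) (hS : SprayPDE.IsSpray S)
    (hC : ∀ v ∈ SprayPDE.slit E M, SprayPDE.liouville v ∉ SprayPDE.holonomy S v)
    (hrank : ∀ v ∈ SprayPDE.slit E M, ∀ᶠ u in 𝓝 v,
      Module.finrank ℝ (SprayPDE.holonomy S u) = Module.finrank ℝ (SprayPDE.holonomy S v))
    (𝔥 : ∀ v : SprayPDE.TM E M,
      TangentSpace (SprayPDE.IT E) v →L[ℝ] TangentSpace (SprayPDE.IT E) v)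
    (h𝔥 : SprayPDE.IsSmoothProjection 𝔥 (SprayPDE.holonomy S)) :
    SprayPDE.IsLinearDiffOpOn (SprayPDE.IT E) ℝ (ℝ × ((E × E) →L[ℝ] ℝ)) (SprayPDE.slit E M) 1
      (SprayPDE.sprayOperator 𝔥) ∧
    ∀ v ∈ SprayPDE.slit E M,
      SprayPDE.FormallyIntegrableAt (SprayPDE.IT E) ℝ (ℝ × ((E × E) →L[ℝ] ℝ)) (SprayPDE.slit E M) 1
        (SprayPDE.sprayOperator 𝔥) v ∧
      SprayPDE.SymbolInvolutiveAt (SprayPDE.IT E) ℝ (ℝ × ((E × E) →L[ℝ] ℝ)) (SprayPDE.slit E M) 1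
        (SprayPDE.sprayOperator 𝔥) v := by
  refine ⟨SprayPDE.isLinearDiffOpOn_sprayOperator 𝔥 h𝔥, fun v hv ↦ ?_⟩
  obtain ⟨r, W, t, Y, l, hsys, hvW, hWs, hloc⟩ :=
    SprayPDE.exists_commutingSystem_sprayOperator hS hv (hC v hv) (hrank v hv) h𝔥
  exact ⟨SprayPDE.formallyIntegrableAt_sprayOperator hsys hWs hloc hvW,
    SprayPDE.symbolInvolutiveAt_sprayOperator hsys hWs hloc hvW⟩
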